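/- Let $(X,Y,Z)\in\mathbb R^{d_x}\times\mathbb R^{d_y}\times\mathbb R^{d_z}$, $d_z\ge 1$, have a joint density $f(x,y,z)=f(x,y\mid z)f(z)$, and let $f^{CI}(x,y,z)=f(x\mid z)f(y\mid z)f(z)$. Let $d_{TV}(\mu,\nu)=\sup_p|E_\mu p-E_\nu p|$ over measurable $p$ with values in $[0,1]$, and $G(t)=P(f(Z)\le t)$ for $t>0$. **Data.** Let $\mathcal U_1,\mathcal U_2,\mathcal U_3$ be three data-sets of $n\ge 1$ samples each, all $3n$ samples being i.i.d. from $f$. For each $u=(x,y,z)\in\mathcal U_2$ let $u'=(x,y',z)$, where $y'$ is the $Y$-part of the sample of $\mathcal U_3$ whose $Z$-part is nearest to $z$ in Euclidean norm. Let $\phi$ be the law of one such $u'$. Give label $1$ to the samples of $\mathcal U_1$ and label $0$ to the $n$ samples $u'$, and let $S$ be a training set of $n$ of these $2n$ labelled samples, chosen uniformly at random and independently of the samples. Let $q$ be the law of a labelled sample $(u,\ell)$ with $q(\ell=1)=q(\ell=0)=\frac12$, $u\sim f$ given $\ell=1$ and $u\sim\phi$ given $\ell=0$. **Risk.** Let $\mathcal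 G$ be a class of measurable $\{0,1\}$-valued classifiers of finite VC dimension $V$ which contains a countable subclass such that each member of $\mathcal G$ is a pointwise limit of a sequence from it. Let $L(g(u),\ell)$ be a loss with $|L|\le B$, $R_q(g)=E_q L(g(u),\ell)$, and $R_S(g)$ the average of $L(g(u),\ell)$ over $(u,\ell)\in S$. Let $g_S$ be any minimiser of $R_S$ over $\mathcal G$, and $R_q^*=\inf_{g\in\mathcal G}R_q(g)$. **Assumptions.** (A) $f(z)$ is twice continuously differentiable, its Hessian has spectral norm at most $c$ almost everywhere, and $f(z)$ is Lipschitz with constant $\ell_0$. (B) For all $z$ and all $a$ with $\|a-z\|\le\epsilon_1$, the Kullback–Leibler divergence $D_z(z')=\int\log\frac{f(y|z)}{f(y|z')}f(y|z)\,dy$ is well defined and finite at $z'=a$ and twice continuously differentiable at $a$, and the largest eigenvalue of its Hessian at $a$ is at most $\beta$. (C) $\int f(z)^{1-1/d}\,dz\le c_3$ with $d=\max(d_z,2)$. There is a universal constant $C>0$ such that for all $d_z\ge 1$, $c$ and $\ell_0$ there is a function $o_n(1/\epsilon)$, with $o_n(1/\epsilon)\to 0$ as $n\to\infty$ for each fixed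 $\epsilon>0$, for which the following hold. For $0<\delta<1$ and $\epsilon>0$ write $$\gamma_n=C\,B\left(\Big(\sqrt V+\sqrt{\log\tfrac1\delta}\Big)\left(\Big(\frac{\log(n/\delta)}{n}\Big)^{1/3}+\sqrt{\frac{4^{d_z}\log(n/\delta)+o_n(1/\epsilon)}{n}}\right)+G(\epsilon)\right).$$ (i) Under (A), for all $n\ge 1$, $0<\delta<1$ and $\epsilon>0$, with probability at least $1-8\delta$, $R_q(g_S)-R_q^*\le\gamma_n$. (ii) Let $0<\epsilon'<\epsilon_1$. There is $N$, depending only on $d_z,c,\ell_0,\epsilon_1,\beta,c_3,\epsilon'$, such that the following holds for all $n\ge N$, $0<\delta<1$ and $\epsilon>0$. Assume (A), (B), (C), let $L$ be the $0$-$1$ loss $\mathbf 1_{g(u)\ne\ell}$ (so $B=1$), and suppose $R_q^*\le\frac12\big(1-d_{TV}(f,\phi)\big)+\eta$. Then with probability at least $1-8\delta$, $$\tfrac12\big(1-d_{TV}(f,f^{CI})\big)-\tfrac{b(n)}2\;\le\;R_q(g_S)\;\le\;\tfrac12\big(1-d_{TV}(f,f^{CI})\big)+\tfrac{b(n)}2+\eta+\gamma_n,$$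 where, with $\gamma_{d}$ the volume of the unit ball of $\mathbb R^{d}$, $$b(n)=\frac12\sqrt{\frac\beta4\,\frac{c_3\,2^{1/d_z}\,\Gamma(1/d_z)}{(n\gamma_{d_z})^{1/d_z}d_z}+\frac{\beta\epsilon' G(2c\epsilon'^2)}4}+\exp\!\Big(-\tfrac12 n\gamma_{d_z}c\,\epsilon'^{\,d_z+2}\Big)+G(2c\epsilon'^2).$$ -/

import Mathlib

open MeasureTheory Filter Topology
open scoped NNReal ENNReal

noncomputable section

namespace CondIndep

/-- `ℝ^d` with the Euclidean norm. -/
abbrev Eu (d : ℕ) : Type := EuclideanSpace ℝ (Fin d)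

/-- The space of samples `u = (x, y, z)`. -/
abbrev Sample (dx dy dz : ℕ) : Type := Eu dx × Eu dy × Eu dz

/-- The total variation distance: the supremum over all measurable `p` with values in `[0, 1]` of
`|E_μ p - E_ν p|`. -/
def tvDist {α : Type*} [MeasurableSpace α] (μ ν : Measure α) : ℝ :=
  sSup {r : ℝ | ∃ p : α → ℝ, Measurable p ∧ (∀ a, p a ∈ Set.Icc (0 : ℝ) 1) ∧
    r = |∫ a, p a ∂μ - ∫ a, p a ∂ν|}

/-- The matrix of second partial derivatives of `g` at `a`. -/
def hessianMatrix {d : ℕ} (g : Eu d → ℝ) (a : Eu d) : Matrix (Fin d) (Fin d) ℝ :=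
  Matrix.of fun i j =>
    iteratedFDeriv ℝ 2 g a ![EuclideanSpace.single i (1 : ℝ), EuclideanSpace.single j (1 : ℝ)]

/-- The volume of the unit ball of `ℝ^d`. -/
def unitBallVolume (d : ℕ) : ℝ := (volume (Metric.ball (0 : Eu d) 1)).toReal

/-- A joint probability density of `(X, Y, Z)`, given as the product of a version `margZ z` of the
density `f(z)` of `Z` and a version `cond x y z` of the conditional density `f(x, y | z)`. -/
structure JointDensity (dx dy dz : ℕ) where
  margZ : Eu dz → ℝ
  cond : Eu dx → Eu dy → Eu dz → ℝ
  margZ_nonneg : ∀ z, 0 ≤ margZ z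
  cond_nonneg : ∀ x y z, 0 ≤ cond x y z
  measurable_margZ : Measurable margZ
  measurable_cond : Measurable fun u : Sample dx dy dz => cond u.1 u.2.1 u.2.2
  lintegral_margZ : ∫⁻ z, ENNReal.ofReal (margZ z) = 1
  lintegral_cond : ∀ z, ∫⁻ x, ∫⁻ y, ENNReal.ofReal (cond x y z) = 1

namespace JointDensity

variable {dx dy dz : ℕ} (J : JointDensity dx dy dz)

/-- The joint density `f(x, y, z)`. -/
def density (u : Sample dx dy dz) : ℝ := J.cond u.1 u.2.1 u.2.2 * J.margZ u.2.2

/-- The conditional density `f(x | z)`. -/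
def condX (x : Eu dx) (z : Eu dz) : ℝ := ∫ y, J.cond x y z

/-- The conditional density `f(y | z)`. -/
def condY (y : Eu dy) (z : Eu dz) : ℝ := ∫ x, J.cond x y z

/-- The density `f^CI(x, y, z) = f(x | z) f(y | z) f(z)`. -/
def densityCI (u : Sample dx dy dz) : ℝ :=
  J.condX u.1 u.2.2 * J.condY u.2.1 u.2.2 * J.margZ u.2.2

/-- The law of `(X, Y, Z)`. -/
def law : Measure (Sample dx dy dz) := volume.withDensity fun u => ENNReal.ofReal (J.density u)

/-- The law with density `f^CI`. -/
def lawCI : Measure (Sample dx dy dz) :=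
  volume.withDensity fun u => ENNReal.ofReal (J.densityCI u)

lemma measurable_density : Measurable J.density :=
  J.measurable_cond.mul (J.measurable_margZ.comp (measurable_snd.comp measurable_snd))

instance isProbabilityMeasure_law : IsProbabilityMeasure J.law := by
  constructor
  have hm : Measurable fun u : Sample dx dy dz => ENNReal.ofReal (J.density u) :=
    J.measurable_density.ennreal_ofReal
  have hyz : Measurable fun p : Eu dx × Eu dz => ∫⁻ y, ENNReal.ofReal (J.density (p.1, y, p.2)) :=
    (hm.comp (by fun_prop : Measurable fun q : (Eu dx × Eu dz) × Eu dy =>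
      ((q.1.1, q.2, q.1.2) : Sample dx dy dz))).lintegral_prod_right'
  rw [law, withDensity_apply _ MeasurableSet.univ, Measure.restrict_univ,
    Measure.volume_eq_prod, lintegral_prod _ hm.aemeasurable]
  have h1 : ∀ x : Eu dx, ∫⁻ p : Eu dy × Eu dz, ENNReal.ofReal (J.density (x, p)) =
      ∫⁻ z, ∫⁻ y, ENNReal.ofReal (J.density (x, y, z)) := fun x => by
    rw [Measure.volume_eq_prod]
    exact lintegral_prod_symm _ (hm.comp measurable_prodMk_left).aemeasurable
  simp_rw [h1]
  rw [lintegral_lintegral_swap hyz.aemeasurable, ← J.lintegral_margZ]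
  refine lintegral_congr fun z => ?_
  have hc : Measurable fun p : Eu dx × Eu dy => ENNReal.ofReal (J.cond p.1 p.2 z) :=
    (J.measurable_cond.comp (g := fun u : Sample dx dy dz => J.cond u.1 u.2.1 u.2.2)
      (f := fun p : Eu dx × Eu dy => (p.1, p.2, z)) (by fun_prop)).ennreal_ofReal
  simp_rw [density, ENNReal.ofReal_mul (J.cond_nonneg _ _ _)]
  have h2 : ∀ x, ∫⁻ y, ENNReal.ofReal (J.cond x y z) * ENNReal.ofReal (J.margZ z) =
      (∫⁻ y, ENNReal.ofReal (J.cond x y z)) * ENNReal.ofReal (J.margZ z) := fun x =>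
    lintegral_mul_const _ (hc.comp measurable_prodMk_left)
  simp_rw [h2]
  rw [lintegral_mul_const _ hc.lintegral_prod_right, J.lintegral_cond, one_mul]

/-- `G(t) = P(f(Z) ≤ t)`. -/
def lowMass (t : ℝ) : ℝ := (J.law {u | J.margZ u.2.2 ≤ t}).toReal

/-- The integrand `log (f(y|z) / f(y|z')) f(y|z)` of the Kullback-Leibler divergence. -/
def klIntegrand (z z' : Eu dz) (y : Eu dy) : ℝ :=
  Real.log (J.condY y z / J.condY y z') * J.condY y z

/-- The function `z' ↦ ∫ log (f(y|z) / f(y|z')) f(y|z) dy`. -/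
def klTo (z z' : Eu dz) : ℝ := ∫ y, J.klIntegrand z z' y

/-- The generalized curvature matrix `I_a(z)`. -/
def curvature (z a : Eu dz) : Matrix (Fin dz) (Fin dz) ℝ := hessianMatrix (J.klTo z) a

/-- The smoothness assumption on `f(y | z)`: the largest eigenvalue of `I_a(z)` is at most `β`
whenever `‖a - z‖ ≤ ε₁`. The first three clauses say that `I_a(z)` makes sense: the logarithm is
that of a positive number for almost every `y` with `f(y|z) > 0`, the integral converges, and it is
twice continuously differentiable. -/
structure SmoothCond (ε₁ β : ℝ) : Prop where
  support : ∀ z a : Eu dz, ‖a - z‖ ≤ ε₁ → ∀ᵐ y, 0 < J.condY y z → 0 < J.condY y a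
  integrable : ∀ z a : Eu dz, ‖a - z‖ ≤ ε₁ → Integrable (J.klIntegrand z a)
  contDiffAt : ∀ z a : Eu dz, ‖a - z‖ ≤ ε₁ → ContDiffAt ℝ 2 (J.klTo z) a
  eigenvalue_le : ∀ z a : Eu dz, ‖a - z‖ ≤ ε₁ → ∀ lam : ℝ,
    Module.End.HasEigenvalue (Matrix.toLin' (J.curvature z a)) lam → lam ≤ β

/-- `f(z)` is twice continuously differentiable, the spectral norm of its Hessian matrix is at most
`c` almost everywhere, and `f(z)` is Lipschitz with constant `ℓ`. -/
structure SmoothMarg (c : ℝ) (ℓ : ℝ≥0) : Prop where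
  contDiff : ContDiff ℝ 2 J.margZ
  hessian_le : ∀ᵐ z, ‖Matrix.toEuclideanCLM (𝕜 := ℝ) (hessianMatrix J.margZ z)‖ ≤ c
  lipschitz : LipschitzWith ℓ J.margZ

/-- `∫ f(z)^(1 - 1/d) dz ≤ c₃` for `d = max(d_z, 2)`. -/
def TailBound (c₃ : ℝ) : Prop :=
  ∫⁻ z, ENNReal.ofReal (J.margZ z ^ (1 - 1 / (max dz 2 : ℕ) : ℝ)) ≤ ENNReal.ofReal c₃

end JointDensity

section Bootstrap

variable {dx dy dz n : ℕ} [NeZero n]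

lemma exists_nearest (z : Eu dz) (v : Fin n → Sample dx dy dz) :
    (Finset.univ.filter fun j => ∀ k, dist z (v j).2.2 ≤ dist z (v k).2.2).Nonempty := by
  obtain ⟨j, hj⟩ := Finite.exists_min fun j => dist z (v j).2.2
  exact ⟨j, by simpa using hj⟩

/-- The index of the nearest neighbour of `z` among the `Z`-coordinates of `v` (in case of a tie,
the smallest such index). -/
def nearest (z : Eu dz) (v : Fin n → Sample dx dy dz) : Fin n :=
  (Finset.univ.filter fun j => ∀ k, dist z (v j).2.2 ≤ dist z (v k).2.2).min' (exists_nearest z v)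

/-- The bootstrapped sample: the `Y`-coordinates of `u` are replaced by those of its nearest
neighbour in the data-set `v`. -/
def bootstrap (u : Sample dx dy dz) (v : Fin n → Sample dx dy dz) : Sample dx dy dz :=
  (u.1, (v (nearest u.2.2 v)).2.1, u.2.2)

lemma measurable_bootstrap :
    Measurable fun p : Sample dx dy dz × (Fin n → Sample dx dy dz) => bootstrap p.1 p.2 := by
  have hS : ∀ j : Fin n, MeasurableSet {p : Sample dx dy dz × (Fin n → Sample dx dy dz) |
      ∀ k, dist p.1.2.2 (p.2 j).2.2 ≤ dist p.1.2.2 (p.2 k).2.2} := fun j => by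
    rw [Set.ofPred_forall]
    exact MeasurableSet.iInter fun k => measurableSet_le (by fun_prop) (by fun_prop)
  have hn : Measurable fun p : Sample dx dy dz × (Fin n → Sample dx dy dz) =>
      nearest p.1.2.2 p.2 := by
    refine measurable_to_countable' fun j => ?_
    have : (fun p : Sample dx dy dz × (Fin n → Sample dx dy dz) => nearest p.1.2.2 p.2) ⁻¹' {j} =
        {p | ∀ k, dist p.1.2.2 (p.2 j).2.2 ≤ dist p.1.2.2 (p.2 k).2.2} ∩
        ⋂ i : {i : Fin n // i < j},
          {p | ∀ k, dist p.1.2.2 (p.2 i.1).2.2 ≤ dist p.1.2.2 (p.2 k).2.2}ᶜ := by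
      ext p
      simp only [Set.mem_preimage, Set.mem_singleton_iff, nearest, Finset.min'_eq_iff,
        Finset.mem_filter, Finset.mem_univ, true_and, Set.mem_inter_iff, Set.mem_ofPred_eq,
        Set.mem_iInter, Set.mem_compl_iff, Subtype.forall]
      exact and_congr_right fun _ => forall_congr' fun i =>
        ⟨fun h hi hk => absurd (h hk) (not_le.2 hi), fun h hk => not_lt.1 fun hi => h hi hk⟩
    rw [this]
    exact (hS j).inter (MeasurableSet.iInter fun i => (hS i.1).compl)
  have hY : Measurable fun p : Sample dx dy dz × (Fin n → Sample dx dy dz) =>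
      (p.2 (nearest p.1.2.2 p.2)).2.1 := by
    have h : Measurable fun q : Fin n × (Fin n → Sample dx dy dz) => (q.2 q.1).2.1 :=
      measurable_from_prod_countable_right fun j =>
        (by fun_prop : Measurable fun v : Fin n → Sample dx dy dz => (v j).2.1)
    exact h.comp (hn.prodMk measurable_snd)
  exact (by fun_prop : Measurable fun p : Sample dx dy dz × (Fin n → Sample dx dy dz) =>
    p.1.1).prodMk (hY.prodMk (by fun_prop))

end Bootstrap

/-- The law `φ` of one bootstrapped sample, when `2n` i.i.d. samples are supplied. -/
def JointDensity.lawBoot {dx dy dz : ℕ} (J : JointDensity dx dy dz) (n : ℕ) [NeZero n] :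
    Measure (Sample dx dy dz) :=
  (J.law.prod (Measure.pi fun _ : Fin n => J.law)).map fun p => bootstrap p.1 p.2

/-- The distribution `q` of a labelled sample: the label is `1` (`true`) or `0` (`false`) with
probability `1/2`, and given the label the sample has law `f` or `φ` respectively. -/
def JointDensity.lawLabelled {dx dy dz : ℕ} (J : JointDensity dx dy dz) (n : ℕ) [NeZero n] :
    Measure (Sample dx dy dz × Bool) :=
  (1 / 2 : ℝ≥0∞) • J.law.map (fun u => (u, true)) +
    (1 / 2 : ℝ≥0∞) • (J.lawBoot n).map (fun u => (u, false))

/-- The expected risk `R_q(g)` for the loss `L`. -/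
def risk {U : Type*} [MeasurableSpace U] (L : Bool → Bool → ℝ) (q : Measure (U × Bool))
    (g : U → Bool) : ℝ :=
  ∫ p, L (g p.1) p.2 ∂q

/-- The `0`-`1` loss. -/
def zeroOneLoss (a b : Bool) : ℝ := if a = b then 0 else 1

/-- The choices of a training set: the sets of `n` of the `2n` labelled samples. The left summand
of `Fin n ⊕ Fin n` numbers the samples with label `1`, the right one those with label `0`. -/
def Split (n : ℕ) : Type := {T : Finset (Fin n ⊕ Fin n) // T.card = n}

instance (n : ℕ) : MeasurableSpace (Split n) := ⊤

/-- The randomness of the algorithm: the data-sets `U₁`, `U₂`, `U₃` and the training set. -/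
abbrev Outcome (dx dy dz n : ℕ) : Type :=
  (Fin n → Sample dx dy dz) × (Fin n → Sample dx dy dz) × (Fin n → Sample dx dy dz) × Split n

/-- The `3n` samples are i.i.d., and the training set is chosen uniformly, independently of them. -/
def JointDensity.lawOutcome {dx dy dz : ℕ} (J : JointDensity dx dy dz) (n : ℕ) :
    Measure (Outcome dx dy dz n) :=
  (Measure.pi fun _ => J.law).prod ((Measure.pi fun _ => J.law).prod
    ((Measure.pi fun _ => J.law).prod (ProbabilityTheory.uniformOn Set.univ)))

section Algorithm

variable {dx dy dz n : ℕ} [NeZero n]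

/-- The labelled data-set: the samples of `U₁` with label `1`, and the samples of `U₂`, modified by
the nearest-neighbour bootstrap from `U₃`, with label `0`. -/
def labelled (ω : Outcome dx dy dz n) : Fin n ⊕ Fin n → Sample dx dy dz × Bool :=
  Sum.elim (fun i => (ω.1 i, true)) (fun i => (bootstrap (ω.2.1 i) ω.2.2.1, false))

/-- The empirical risk `R_S(g)` on the training set. -/
def empRisk (L : Bool → Bool → ℝ) (ω : Outcome dx dy dz n) (g : Sample dx dy dz → Bool) : ℝ :=
  (1 / n : ℝ) * ∑ i ∈ ω.2.2.2.1, L (g (labelled ω i).1) (labelled ω i).2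

/-- `g` is an empirical risk minimizer over the class `𝒢`. -/
def IsERM (L : Bool → Bool → ℝ) (𝒢 : Set (Sample dx dy dz → Bool)) (ω : Outcome dx dy dz n)
    (g : Sample dx dy dz → Bool) : Prop :=
  g ∈ 𝒢 ∧ ∀ g' ∈ 𝒢, empRisk L ω g ≤ empRisk L ω g'

end Algorithm

/-- A finite set is shattered by a class of classifiers. -/
def Shatters {U : Type*} (𝒢 : Set (U → Bool)) (T : Finset U) : Prop :=
  ∀ A ⊆ T, ∃ g ∈ 𝒢, ∀ u ∈ T, g u = true ↔ u ∈ A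

/-- The VC dimension of a class of classifiers: the largest cardinality of a shattered set. -/
def vcDim {U : Type*} (𝒢 : Set (U → Bool)) : ℕ∞ :=
  ⨆ T : {T : Finset U // Shatters 𝒢 T}, (T.1.card : ℕ∞)

/-- The usual measurability condition on a class of classifiers: each one is measurable, and is the
pointwise limit of a sequence from a fixed countable subclass. -/
def PointwiseMeasurable {U : Type*} [MeasurableSpace U] (𝒢 : Set (U → Bool)) : Prop :=
  (∀ g ∈ 𝒢, Measurable g) ∧ ∃ 𝒢₀ ⊆ 𝒢, 𝒢₀.Countable ∧
    ∀ g ∈ 𝒢, ∃ s : ℕ → U → Bool, (∀ k, s k ∈ 𝒢₀) ∧ ∀ u, ∀ᶠ k in atTop, s k u = g u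

/-- The bound `γ_n`, where `B` bounds the loss, `o` is the value of `o_n(1/ε)`, and `G = G(ε)`. -/
def gammaBound (C B : ℝ) (V dz n : ℕ) (δ o G : ℝ) : ℝ :=
  C * B * ((√(V : ℝ) + √(Real.log (1 / δ))) *
    ((Real.log (n / δ) / n) ^ (1 / 3 : ℝ) + √((4 ^ dz * Real.log (n / δ) + o) / n)) + G)

/-- The bound `b(n)`, where `G = G(2 c ε²)`. -/
def bootBound (β c₃ c ε : ℝ) (dz n : ℕ) (G : ℝ) : ℝ :=
  1 / 2 * √(β / 4 * (c₃ * 2 ^ (1 / dz : ℝ) * Real.Gamma (1 / dz)) /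
      ((n * unitBallVolume dz) ^ (1 / dz : ℝ) * dz) + β * ε * G / 4) +
    Real.exp (-(1 / 2) * n * unitBallVolume dz * c * ε ^ (dz + 2)) + G

end CondIndep

end

/-!
The proof has two independent parts: uniform convergence of the empirical risk, and a comparison of
the bootstrap law `φ` with `f^CI` in total variation.

*Excess risk.* An empirical risk minimizer has excess risk at most twice the uniform deviation of
the empirical risk. This deviation has four sources: the samples with label `1`; the samples with
label `0`, given the data-set `v` of neighbours; the risk of a point bootstrapped from `v`, as a
function of `v`; and the numbers of the two labels in the training set. The first two concern i.i.d.
samples, and the last is a hypergeometric tail. The third is the main difficulty. One point of `v`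
may be the nearest neighbour of a large part of the space, so there are no bounded differences. They
are restored by a truncation (`truncRisk`) to the points with `f(z) > ε` whose nearest neighbour is
within a radius `r`: as `f(z)` is Lipschitz, hence bounded, a change of one neighbour then affects
only a mass of order `r ^ d`. With balls of volume `n ^ (-11 / 12)` this truncation costs only
`G(ε)` and an exponentially small term, and the fluctuations are `O(n ^ (-5 / 12) √log n)`, better
than the rate `n ^ (-1 / 3)` that is asked for. The slack absorbs all constants, including those that
depend on the dimension and on the Lipschitz constant, once `n` is large; for small `n` the
remainder `o_n(1 / ε)` makes the bound trivial.

All the uniform deviation inequalities are instances of `measure_exists_deviation_le`, a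
symmetrization by random exchange of the sample with a ghost sample. It asks only for bounded
differences and for a finite cover of the class on each pool of `2n` points. For the nearest-neighbour
functional, the relevant distance of two classifiers is their `L¹` distance under the average of all
laws of samples that receive the `y` of some point of the pool, and `exists_cover_of_vcDim_le` bounds
the covering numbers of a VC class in every `L¹` metric.

*Bootstrap bias.* The nearest neighbour is selected by `z`-coordinates alone, so its `y`-coordinate
has the conditional density at its own `z` (`lintegral_nearest_y`). Hence a bootstrapped sample
differs from one of `f^CI` only in that `y` is drawn from `f(y | z')` in place of `f(y | z)`, with
`z'` the nearest neighbour of `z`. The divergence `D_z` vanishes at its minimum `z`, so the bound on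
its Hessian gives `D_z(a) ≤ β ‖a - z‖² / 2`; passing through the Hellinger distance, `f(y | z)` is
Lipschitz in `z` with constant `√(2 β)` in `L¹` (`condDist_le`). At the radius `n ^ (-3 / (4 d))` the
nearest neighbour is farther off only with probability `exp (-a n ^ (1 / 4))` where
`f(z) > 2 c ε'²`, and both this and the radius are `o(n ^ (-1 / (2 d)))`, the order of the first term
of `b(n)`. Total variation enters the risk because a classifier is a test function, and its `0`-`1`
risk is at least the Bayes risk.
-/

namespace CondIndep

/-! ### Bounded differences and exchange of two samples -/

/-- McDiarmid's inequality for a uniform sign pattern, as a bound on the exponential moment. The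
induction averages out one coordinate at a time. -/
lemma sum_exp_le_of_boundedDifferences (c : ℝ) : ∀ (n : ℕ) (F : (Fin n → Bool) → ℝ),
    (∀ σ j b, |F (Function.update σ j b) - F σ| ≤ c) →
    ∑ σ, Real.exp (F σ) ≤ 2 ^ n * Real.exp ((∑ σ, F σ) / 2 ^ n + n * c ^ 2 / 8) := by
  intro n
  induction n with
  | zero =>
    intro F _
    simp
  | succ n ih =>
    intro F hF
    have hsum : ∀ H : (Fin (n + 1) → Bool) → ℝ, ∑ σ, H σ =
        ∑ σ : Fin n → Bool, (H (Fin.cons true σ) + H (Fin.cons false σ)) := fun H => by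
      rw [← (Fin.consEquiv fun _ : Fin (n + 1) => Bool).sum_comp, Fintype.sum_prod_type,
        Fintype.sum_bool, ← Finset.sum_add_distrib]
      rfl
    set G : (Fin n → Bool) → ℝ := fun σ => (F (Fin.cons true σ) + F (Fin.cons false σ)) / 2 with hG
    have hGd : ∀ σ j b, |G (Function.update σ j b) - G σ| ≤ c := fun σ j b => by
      have h1 := hF (Fin.cons true σ) j.succ b
      have h2 := hF (Fin.cons false σ) j.succ b
      rw [← Fin.cons_update] at h1 h2
      rw [abs_le] at h1 h2 ⊢
      constructor <;> simp only [hG] <;> linarith [h1.1, h1.2, h2.1, h2.2]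
    have key : ∀ σ : Fin n → Bool, Real.exp (F (Fin.cons true σ)) + Real.exp (F (Fin.cons false σ)) ≤
        2 * (Real.exp (G σ) * Real.exp (c ^ 2 / 8)) := fun σ => by
      set d := (F (Fin.cons true σ) - F (Fin.cons false σ)) / 2 with hd
      have h1 := hF (Fin.cons false σ) 0 true
      rw [Fin.update_cons_zero] at h1
      have e1 : F (Fin.cons true σ) = G σ + d := by simp only [hG, hd]; ring
      have e2 : F (Fin.cons false σ) = G σ + -d := by simp only [hG, hd]; ring
      have h3 : Real.exp d + Real.exp (-d) = 2 * Real.cosh d := by rw [Real.cosh_eq]; ring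
      have h4 : d ^ 2 / 2 ≤ c ^ 2 / 8 := by
        have : (2 * d) ^ 2 ≤ c ^ 2 := by
          rw [← sq_abs (2 * d)]
          refine pow_le_pow_left₀ (abs_nonneg _) ?_ 2
          rw [hd, mul_div_cancel₀ _ two_ne_zero]
          exact h1
        nlinarith
      rw [e1, e2, Real.exp_add, Real.exp_add, ← mul_add, h3]
      have h5 := (Real.cosh_le_exp_half_sq d).trans (Real.exp_le_exp.2 h4)
      have := mul_le_mul_of_nonneg_left h5 (Real.exp_pos (G σ)).le
      linarith
    rw [hsum, hsum]
    have hGsum : ∑ σ : Fin n → Bool, (F (Fin.cons true σ) + F (Fin.cons false σ)) = 2 * ∑ σ, G σ := by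
      rw [Finset.mul_sum]
      exact Finset.sum_congr rfl fun σ _ => by simp only [hG]; ring
    calc _ ≤ ∑ σ, 2 * (Real.exp (G σ) * Real.exp (c ^ 2 / 8)) := Finset.sum_le_sum fun σ _ => key σ
      _ = 2 * ((∑ σ, Real.exp (G σ)) * Real.exp (c ^ 2 / 8)) := by
        rw [← Finset.mul_sum, Finset.sum_mul]
      _ ≤ 2 * ((2 ^ n * Real.exp ((∑ σ, G σ) / 2 ^ n + n * c ^ 2 / 8)) * Real.exp (c ^ 2 / 8)) := by
        gcongr
        exact ih G hGd
      _ = _ := by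
        rw [hGsum, mul_assoc (2 ^ n), ← Real.exp_add, ← mul_assoc, pow_succ' 2 n,
          mul_div_mul_left _ _ two_ne_zero]
        congr 2
        push_cast
        ring

/-- The sample that takes its `i`-th point from `w` where `σ i` is true, and from `w'` elsewhere. -/
def mix {n : ℕ} {W : Type*} (σ : Fin n → Bool) (w w' : Fin n → W) : Fin n → W :=
  fun i => if σ i then w i else w' i

lemma mix_update {n : ℕ} {W : Type*} (σ : Fin n → Bool) (j : Fin n) (b : Bool) (w w' : Fin n → W) :
    mix (Function.update σ j b) w w' =
      Function.update (mix σ w w') j (if b then w j else w' j) := by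
  funext i
  by_cases h : i = j
  · subst h; simp [mix]
  · simp [mix, h]

lemma mix_not {n : ℕ} {W : Type*} (σ : Fin n → Bool) (w w' : Fin n → W) :
    mix (fun i => !σ i) w w' = mix σ w' w := by
  funext i
  by_cases h : σ i <;> simp [mix, h]

/-- The exchange of some points between two independent i.i.d. samples preserves their joint law. -/
lemma measurePreserving_mix {n : ℕ} {W : Type*} [MeasurableSpace W] (μ : Measure W)
    [IsProbabilityMeasure μ] (σ : Fin n → Bool) :
    MeasurePreserving (fun p : (Fin n → W) × (Fin n → W) => (mix σ p.1 p.2, mix σ p.2 p.1))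
      ((Measure.pi fun _ => μ).prod (Measure.pi fun _ => μ))
      ((Measure.pi fun _ => μ).prod (Measure.pi fun _ => μ)) := by
  have h1 := measurePreserving_arrowProdEquivProdArrow W W (Fin n) (fun _ => μ) (fun _ => μ)
  have h2 : MeasurePreserving (fun (p : Fin n → W × W) i => if σ i then p i else (p i).swap)
      (Measure.pi fun _ => μ.prod μ) (Measure.pi fun _ => μ.prod μ) := by
    refine measurePreserving_pi (fun _ => μ.prod μ) (fun _ => μ.prod μ)
      (f := fun i x => if σ i then x else x.swap) fun i => ?_
    by_cases h : σ i
    · simp only [h, if_true]; exact MeasurePreserving.id _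
    · simp only [h]; exact Measure.measurePreserving_swap
  convert h1.comp (h2.comp h1.symm) using 1
  funext p
  ext i
  · by_cases h : σ i <;>
    simp [mix, h, MeasurableEquiv.arrowProdEquivProdArrow, Equiv.arrowProdEquivProdArrow]
  · by_cases h : σ i <;>
    simp [mix, h, MeasurableEquiv.arrowProdEquivProdArrow, Equiv.arrowProdEquivProdArrow]

/-! ### Symmetrization -/

section Symmetrization

variable {W ι : Type*} {n : ℕ}

/-- The exponential moment, under random exchanges between two fixed samples, of the supremum of
the differences `F θ w - F θ w'`. The supremum runs over finitely many `θ` up to an error `τ`, and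
for each of these the difference has mean zero, as it changes sign when the two samples swap roles. -/
lemma sum_iSup_exp_mix_le (F : ι → (Fin n → W) → ℝ) {c : ℝ}
    (hdiff : ∀ θ w j x, |F θ (Function.update w j x) - F θ w| ≤ c) {P : ℕ} {τ : ℝ}
    (w w' : Fin n → W) (T : Finset ι) (hT : T.card ≤ P)
    (hcover : ∀ θ, ∃ θ' ∈ T, ∀ σ, |F θ (mix σ w w') - F θ' (mix σ w w')| ≤ τ)
    {s : ℝ} (hs : 0 ≤ s) :
    ∑ σ : Fin n → Bool, ⨆ θ, ENNReal.ofReal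
        (Real.exp (s * (F θ (mix σ w w') - F θ (mix σ w' w)))) ≤
      2 ^ n * ENNReal.ofReal (P * Real.exp (2 * s * τ + s ^ 2 * n * c ^ 2 / 2)) := by
  set D : ι → (Fin n → Bool) → ℝ := fun θ σ => F θ (mix σ w w') - F θ (mix σ w' w) with hD
  have hflip : ∀ θ σ, D θ (fun i => !σ i) = - D θ σ := fun θ σ => by
    simp only [hD, mix_not]
    ring
  have hsum0 : ∀ θ, ∑ σ, D θ σ = 0 := fun θ => by
    have h : ∑ σ, D θ σ = ∑ σ : Fin n → Bool, D θ (fun i => !σ i) :=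
      ((Equiv.piCongrRight fun _ : Fin n => Equiv.boolNot).sum_comp (D θ)).symm
    simp_rw [hflip, Finset.sum_neg_distrib] at h
    linarith
  have hexp : ∀ θ, ∑ σ, Real.exp (s * D θ σ) ≤ 2 ^ n * Real.exp (s ^ 2 * n * c ^ 2 / 2) := fun θ => by
    have h := sum_exp_le_of_boundedDifferences (s * (2 * c)) n (fun σ => s * D θ σ) fun σ j b => by
      have h1 := hdiff θ (mix σ w w') j (if b then w j else w' j)
      have h2 := hdiff θ (mix σ w' w) j (if b then w' j else w j)
      rw [← mix_update] at h1 h2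
      rw [← mul_sub, abs_mul, abs_of_nonneg hs]
      refine mul_le_mul_of_nonneg_left ?_ hs
      rw [abs_le] at h1 h2 ⊢
      constructor <;> simp only [hD] <;> linarith [h1.1, h1.2, h2.1, h2.2]
    rw [← Finset.mul_sum, hsum0, mul_zero, zero_div, zero_add] at h
    refine h.trans (le_of_eq ?_)
    congr 2
    ring
  calc _ ≤ ∑ σ : Fin n → Bool, ∑ θ' ∈ T,
        ENNReal.ofReal (Real.exp (2 * s * τ) * Real.exp (s * D θ' σ)) := by
        refine Finset.sum_le_sum fun σ _ => iSup_le fun θ => ?_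
        obtain ⟨θ', hθ', h⟩ := hcover θ
        refine le_trans (ENNReal.ofReal_le_ofReal ?_) (Finset.single_le_sum (f := fun θ' =>
          ENNReal.ofReal (Real.exp (2 * s * τ) * Real.exp (s * D θ' σ))) (fun _ _ => zero_le) hθ')
        rw [← Real.exp_add, Real.exp_le_exp]
        have h1 := abs_le.1 (h σ)
        have h2 := abs_le.1 (h fun i => !σ i)
        rw [mix_not] at h2
        have h3 : D θ σ ≤ 2 * τ + D θ' σ := by simp only [hD]; linarith [h1.2, h2.1]
        have := mul_le_mul_of_nonneg_left h3 hs
        simp only [hD] at this ⊢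
        linarith
    _ = ∑ θ' ∈ T, ENNReal.ofReal (Real.exp (2 * s * τ) * ∑ σ, Real.exp (s * D θ' σ)) := by
        rw [Finset.sum_comm]
        refine Finset.sum_congr rfl fun θ' _ => ?_
        rw [← ENNReal.ofReal_sum_of_nonneg fun σ _ => by positivity, Finset.mul_sum]
    _ ≤ ∑ θ' ∈ T, ENNReal.ofReal
          (Real.exp (2 * s * τ) * (2 ^ n * Real.exp (s ^ 2 * n * c ^ 2 / 2))) := by
        gcongr with θ' _
        exact hexp θ'
    _ ≤ P * ENNReal.ofReal
          (Real.exp (2 * s * τ) * (2 ^ n * Real.exp (s ^ 2 * n * c ^ 2 / 2))) := by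
        rw [Finset.sum_const, nsmul_eq_mul]
        gcongr
    _ = _ := by
        rw [Real.exp_add]
        have h2 : (2 : ℝ≥0∞) ^ n = ENNReal.ofReal (2 ^ n) := by
          rw [ENNReal.ofReal_pow (by norm_num)]; norm_num
        rw [h2, ← ENNReal.ofReal_natCast, ← ENNReal.ofReal_mul (by positivity),
          ← ENNReal.ofReal_mul (by positivity)]
        congr 1
        ring

/-- A uniform deviation inequality for functionals `F θ` of an i.i.d. sample, which have bounded
differences and, on every pool of `2n` points, agree up to `τ` with one of `P` of them. -/
theorem measure_exists_deviation_le [MeasurableSpace W] [Countable ι] (μ : Measure W)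
    [IsProbabilityMeasure μ] (hn : 0 < n) (F : ι → (Fin n → W) → ℝ)
    (hF : ∀ θ, Measurable (F θ)) {B : ℝ} (hB : ∀ θ w, |F θ w| ≤ B) {c : ℝ} (hc : 0 < c)
    (hdiff : ∀ θ w j x, |F θ (Function.update w j x) - F θ w| ≤ c) {P : ℕ} {τ : ℝ}
    (hcover : ∀ w w', ∃ T : Finset ι, T.card ≤ P ∧
      ∀ θ, ∃ θ' ∈ T, ∀ σ, |F θ (mix σ w w') - F θ' (mix σ w w')| ≤ τ)
    {X : ℝ} (hX : 0 ≤ X) :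
    (Measure.pi fun _ : Fin n => μ)
        {w | ∃ θ, 2 * τ + c * √(2 * n * X) ≤ F θ w - ∫ v, F θ v ∂(Measure.pi fun _ => μ)} ≤
      ENNReal.ofReal (P * Real.exp (-X)) := by
  set π : Measure (Fin n → W) := Measure.pi fun _ => μ with hπ
  set s : ℝ := √(2 * n * X) / (n * c) with hs
  have hn' : (0 : ℝ) < n := by exact_mod_cast hn
  have hs0 : 0 ≤ s := by positivity
  set t : ℝ := 2 * τ + c * √(2 * n * X) with ht
  have hsq : √(2 * n * X) ^ 2 = 2 * n * X := Real.sq_sqrt (by positivity)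
  have hst : s * t = 2 * s * τ + 2 * X := by
    have : s * (c * √(2 * n * X)) = 2 * X := by
      have : s * (c * √(2 * n * X)) = √(2 * n * X) ^ 2 / n := by
        rw [hs]; field_simp
      rw [this, hsq]; field_simp
    rw [ht, mul_add, this]; ring
  have hs2 : s ^ 2 * n * c ^ 2 / 2 = X := by
    rw [hs, div_pow, hsq]; field_simp
  have hint : ∀ θ, Integrable (F θ) π := fun θ =>
    Integrable.of_bound (hF θ).aestronglyMeasurable B (ae_of_all _ fun w => hB θ w)
  set M : (Fin n → W) × (Fin n → W) → ℝ≥0∞ := fun p =>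
    ⨆ θ, ENNReal.ofReal (Real.exp (s * (F θ p.1 - F θ p.2))) with hM
  have hMm : Measurable M := Measurable.iSup fun θ =>
    (((((hF θ).comp measurable_fst).sub ((hF θ).comp measurable_snd)).const_mul s).exp).ennreal_ofReal
  -- the ghost sample: Jensen's inequality replaces the mean by an independent copy
  have hJ : ∀ w, (⨆ θ, ENNReal.ofReal (Real.exp (s * (F θ w - ∫ v, F θ v ∂π)))) ≤
      ∫⁻ w', M (w, w') ∂π := fun w => by
    refine iSup_le fun θ => ?_
    have hi : Integrable (fun w' => Real.exp (s * (F θ w - F θ w'))) π := by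
      refine Integrable.of_bound (((measurable_const.sub (hF θ)).const_mul s).exp).aestronglyMeasurable
        (Real.exp (s * (2 * B))) (ae_of_all _ fun w' => ?_)
      rw [Real.norm_eq_abs, Real.abs_exp, Real.exp_le_exp]
      refine mul_le_mul_of_nonneg_left ?_ hs0
      linarith [(abs_le.1 (hB θ w)).2, (abs_le.1 (hB θ w')).1]
    have h1 : Real.exp (s * (F θ w - ∫ v, F θ v ∂π)) ≤ ∫ w', Real.exp (s * (F θ w - F θ w')) ∂π := by
      have := convexOn_exp.map_integral_le (μ := π) (f := fun w' => s * (F θ w - F θ w'))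
        Real.continuous_exp.continuousOn isClosed_univ (ae_of_all _ fun _ => Set.mem_univ _)
        (((integrable_const _).sub (hint θ)).const_mul s) hi
      rwa [integral_const_mul, integral_sub (integrable_const _) (hint θ), integral_const,
        probReal_univ, one_smul] at this
    calc _ ≤ ENNReal.ofReal (∫ w', Real.exp (s * (F θ w - F θ w')) ∂π) := ENNReal.ofReal_le_ofReal h1
      _ = ∫⁻ w', ENNReal.ofReal (Real.exp (s * (F θ w - F θ w'))) ∂π :=
        ofReal_integral_eq_lintegral_ofReal hi (ae_of_all _ fun _ => (Real.exp_pos _).le)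
      _ ≤ _ := lintegral_mono fun w' =>
        le_iSup (fun θ => ENNReal.ofReal (Real.exp (s * (F θ w - F θ w')))) θ
  -- random exchange of the sample with the ghost sample
  have hE : ∫⁻ p, M p ∂(π.prod π) ≤ ENNReal.ofReal (P * Real.exp (2 * s * τ + X)) := by
    have h1 : ∀ σ : Fin n → Bool, ∫⁻ p, M (mix σ p.1 p.2, mix σ p.2 p.1) ∂(π.prod π) =
        ∫⁻ p, M p ∂(π.prod π) := fun σ => (measurePreserving_mix μ σ).lintegral_comp hMm
    have h2 : (2 : ℝ≥0∞) ^ n * ∫⁻ p, M p ∂(π.prod π) ≤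
        2 ^ n * ENNReal.ofReal (P * Real.exp (2 * s * τ + X)) := by
      calc _ = ∑ σ : Fin n → Bool, ∫⁻ p, M (mix σ p.1 p.2, mix σ p.2 p.1) ∂(π.prod π) := by
            simp_rw [h1]
            simp
        _ = ∫⁻ p, ∑ σ : Fin n → Bool, M (mix σ p.1 p.2, mix σ p.2 p.1) ∂(π.prod π) :=
            (lintegral_finsetSum _ fun σ _ => hMm.comp (measurePreserving_mix μ σ).measurable).symm
        _ ≤ ∫⁻ _, 2 ^ n * ENNReal.ofReal (P * Real.exp (2 * s * τ + X)) ∂(π.prod π) := by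
            refine lintegral_mono fun p => ?_
            obtain ⟨T, hT, h⟩ := hcover p.1 p.2
            rw [← hs2]
            exact sum_iSup_exp_mix_le F hdiff p.1 p.2 T hT h hs0
        _ = _ := by simp
    exact (ENNReal.mul_le_mul_iff_right (by positivity) (ENNReal.pow_ne_top (by norm_num))).1 h2
  calc π {w | ∃ θ, t ≤ F θ w - ∫ v, F θ v ∂π}
      ≤ π {w | ENNReal.ofReal (Real.exp (s * t)) ≤
          ⨆ θ, ENNReal.ofReal (Real.exp (s * (F θ w - ∫ v, F θ v ∂π)))} := by
        refine measure_mono fun w ⟨θ, hθ⟩ => ?_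
        refine le_trans (ENNReal.ofReal_le_ofReal (Real.exp_le_exp.2
          (mul_le_mul_of_nonneg_left hθ hs0)))
          (le_iSup (fun θ => ENNReal.ofReal (Real.exp (s * (F θ w - ∫ v, F θ v ∂π)))) θ)
    _ ≤ (∫⁻ w, ⨆ θ, ENNReal.ofReal (Real.exp (s * (F θ w - ∫ v, F θ v ∂π))) ∂π) /
          ENNReal.ofReal (Real.exp (s * t)) :=
        meas_ge_le_lintegral_div (Measurable.iSup fun θ =>
          ((((hF θ).sub_const _).const_mul s).exp).ennreal_ofReal).aemeasurable
          (by simp [Real.exp_pos]) ENNReal.ofReal_ne_top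
    _ ≤ ENNReal.ofReal (P * Real.exp (2 * s * τ + X)) / ENNReal.ofReal (Real.exp (s * t)) := by
        gcongr
        refine (lintegral_mono hJ).trans ?_
        rwa [← lintegral_prod _ hMm.aemeasurable]
    _ = _ := by
        rw [← ENNReal.ofReal_div_of_pos (Real.exp_pos _), mul_div_assoc, ← Real.exp_sub, hst]
        congr 3
        ring

end Symmetrization

/-! ### Covering numbers of VC classes -/

section VC

variable {U : Type*}

lemma sum_choose_le_pow (m V : ℕ) : ∑ k ∈ Finset.Iic V, m.choose k ≤ (m + 1) ^ V := by
  rw [add_pow]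
  have : Finset.Iic V = Finset.range (V + 1) := by ext k; simp
  rw [this]
  refine Finset.sum_le_sum fun k hk => ?_
  rw [one_pow, mul_one]
  exact (Nat.choose_le_pow m k).trans (Nat.le_mul_of_pos_right _
    (Nat.choose_pos (Nat.lt_succ_iff.1 (Finset.mem_range.1 hk))))

lemma Shatters.card_le {𝒢 : Set (U → Bool)} {V : ℕ} (hV : vcDim 𝒢 ≤ V) {T : Finset U}
    (hT : Shatters 𝒢 T) : T.card ≤ V := by
  have h : (T.card : ℕ∞) ≤ vcDim 𝒢 :=
    le_iSup (fun T : {T : Finset U // Shatters 𝒢 T} => (T.1.card : ℕ∞)) ⟨T, hT⟩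
  exact_mod_cast h.trans hV

/-- The Sauer-Shelah lemma, for points that may coincide. -/
lemma card_le_of_injOn_restrict {𝒢 : Set (U → Bool)} {V : ℕ} (hV : vcDim 𝒢 ≤ V) {m : ℕ}
    (x : Fin m → U) {ι : Type*} (e : ι → U → Bool) (he : ∀ a, e a ∈ 𝒢) (T : Finset ι)
    (hinj : ∀ a ∈ T, ∀ b ∈ T, (∀ i, e a (x i) = e b (x i)) → a = b) :
    T.card ≤ (m + 1) ^ V := by
  classical
  set 𝒜 : Finset (Finset (Fin m)) := T.image fun a => Finset.univ.filter fun i => e a (x i) = true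
    with h𝒜
  have hcard : 𝒜.card = T.card := by
    refine Finset.card_image_of_injOn fun a ha b hb hab => hinj a ha b hb fun i => ?_
    have := Finset.ext_iff.1 hab i
    simp only [Finset.mem_filter, Finset.mem_univ, true_and] at this
    exact Bool.eq_iff_iff.2 this
  have hsh : ∀ s : Finset (Fin m), 𝒜.Shatters s → s.card ≤ V := fun s hs => by
    have hpat : ∀ t ⊆ s, ∃ a, ∀ i ∈ s, e a (x i) = true ↔ i ∈ t := fun t ht => by
      obtain ⟨u, hu, hut⟩ := hs ht
      obtain ⟨a, -, rfl⟩ := Finset.mem_image.1 hu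
      refine ⟨a, fun i hi => ?_⟩
      rw [← hut]
      simp [hi]
    have hxinj : Set.InjOn x s := fun i hi j hj hij => by
      obtain ⟨a, ha⟩ := hpat {i} (by simpa using hi)
      have h1 := (ha i hi).2 (by simp)
      rw [hij] at h1
      exact (Finset.mem_singleton.1 ((ha j hj).1 h1)).symm
    rw [← Finset.card_image_of_injOn hxinj]
    refine Shatters.card_le hV fun A hA => ?_
    obtain ⟨a, ha⟩ := hpat (s.filter fun i => x i ∈ A) (Finset.filter_subset _ _)
    refine ⟨e a, he a, fun u hu => ?_⟩
    obtain ⟨i, hi, rfl⟩ := Finset.mem_image.1 hu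
    rw [ha i hi]
    simp [hi]
  have hvc : 𝒜.vcDim ≤ V := Finset.sup_le fun s hs => hsh s (Finset.mem_shatterer.1 hs)
  calc T.card = 𝒜.card := hcard.symm
    _ ≤ 𝒜.shatterer.card := Finset.card_le_card_shatterer 𝒜
    _ ≤ ∑ k ∈ Finset.Iic 𝒜.vcDim, (Fintype.card (Fin m)).choose k :=
      Finset.card_shatterer_le_sum_vcDim
    _ ≤ ∑ k ∈ Finset.Iic V, m.choose k := by
      rw [Fintype.card_fin]
      exact Finset.sum_le_sum_of_subset (Finset.Iic_subset_Iic.2 hvc)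
    _ ≤ (m + 1) ^ V := sum_choose_le_pow m V

variable [MeasurableSpace U]

/-- A `τ`-separated family in a VC class has at most `(m + 1) ^ V` members. A larger one would have
a subfamily whose pairs are all told apart, with positive probability, by `m` random points, contrary
to the Sauer-Shelah lemma. -/
lemma card_le_of_separated {𝒢 : Set (U → Bool)} {V : ℕ} (hV : vcDim 𝒢 ≤ V) {ι : Type*}
    (e : ι → U → Bool) (he : ∀ a, e a ∈ 𝒢) (hm : ∀ a, Measurable (e a)) (Q : Measure U)
    [IsProbabilityMeasure Q] {τ : ℝ} {m : ℕ}
    (hmτ : (((m + 1) ^ V + 1 : ℕ) : ℝ) ^ 2 * Real.exp (-(m * τ)) < 1) (T : Finset ι)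
    (hT : ∀ a ∈ T, ∀ b ∈ T, a ≠ b → τ < Q.real {u | e a u ≠ e b u}) :
    T.card ≤ (m + 1) ^ V := by
  classical
  by_contra! hlt
  obtain ⟨T', hT'T, hT'⟩ := Finset.exists_subset_card_eq (Nat.succ_le_of_lt hlt)
  have hmeas : ∀ a b, MeasurableSet {u | e a u ≠ e b u} := fun a b =>
    (measurableSet_eq_fun (hm a) (hm b)).compl
  set S : ι × ι → Set (Fin m → U) := fun p => Set.univ.pi fun _ => {u | e p.1 u ≠ e p.2 u}ᶜ with hS
  have hSle : ∀ p ∈ T'.offDiag, (Measure.pi fun _ => Q).real (S p) ≤ Real.exp (-(m * τ)) := by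
    intro p hp
    rw [Finset.mem_offDiag] at hp
    have h1 := hT p.1 (hT'T hp.1) p.2 (hT'T hp.2.1) hp.2.2
    have h2 : (Measure.pi fun _ : Fin m => Q).real (S p) =
        (1 - Q.real {u | e p.1 u ≠ e p.2 u}) ^ m := by
      rw [← probReal_compl_eq_one_sub (hmeas _ _), measureReal_def, hS, Measure.pi_pi]
      simp [measureReal_def]
    rw [h2, show -(m * τ) = m * (-τ) by ring, Real.exp_nat_mul]
    refine pow_le_pow_left₀ (by linarith [measureReal_le_one (μ := Q) (s := {u | e p.1 u ≠ e p.2 u})])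
      ?_ m
    linarith [Real.add_one_le_exp (-τ)]
  have hunion : (Measure.pi fun _ => Q).real (⋃ p ∈ T'.offDiag, S p) < 1 := by
    calc _ ≤ ∑ p ∈ T'.offDiag, (Measure.pi fun _ => Q).real (S p) :=
          measureReal_biUnion_finset_le _ _
      _ ≤ ∑ p ∈ T'.offDiag, Real.exp (-(m * τ)) := Finset.sum_le_sum hSle
      _ ≤ (((m + 1) ^ V + 1 : ℕ) : ℝ) ^ 2 * Real.exp (-(m * τ)) := by
          rw [Finset.sum_const, nsmul_eq_mul]
          gcongr
          rw [← Nat.cast_pow, Nat.cast_le, Finset.offDiag_card, hT', sq]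
          exact Nat.sub_le _ _
      _ < 1 := hmτ
  obtain ⟨x, hx⟩ : ∃ x, x ∉ ⋃ p ∈ T'.offDiag, S p := by
    by_contra! h
    rw [Set.eq_univ_of_forall h, probReal_univ] at hunion
    exact lt_irrefl _ hunion
  have := card_le_of_injOn_restrict hV x e he T' fun a ha b hb hab => by
    by_contra hne
    refine hx (Set.mem_biUnion (x := (a, b)) (Finset.mem_offDiag.2 ⟨ha, hb, hne⟩) fun i _ => ?_)
    simpa using hab i
  omega

/-- A VC class has polynomial covering numbers in `L¹(Q)`, for each probability measure `Q`: a
maximal `τ`-separated subset is a `τ`-net, and `m` random points tell its members apart. -/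
theorem exists_cover_of_vcDim_le {𝒢 : Set (U → Bool)} {V : ℕ} (hV : vcDim 𝒢 ≤ V) {ι : Type*}
    (e : ι → U → Bool) (he : ∀ a, e a ∈ 𝒢) (hm : ∀ a, Measurable (e a)) (Q : Measure U)
    [IsProbabilityMeasure Q] {τ : ℝ} (hτ : 0 ≤ τ) {m : ℕ}
    (hmτ : (((m + 1) ^ V + 1 : ℕ) : ℝ) ^ 2 * Real.exp (-(m * τ)) < 1) :
    ∃ T : Finset ι, T.card ≤ (m + 1) ^ V ∧ ∀ a, ∃ b ∈ T, Q.real {u | e a u ≠ e b u} ≤ τ := by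
  classical
  set S : Set ℕ := {k | ∃ T : Finset ι, T.card = k ∧
    ∀ a ∈ T, ∀ b ∈ T, a ≠ b → τ < Q.real {u | e a u ≠ e b u}} with hS
  have hbdd : BddAbove S := ⟨(m + 1) ^ V, fun k ⟨T, hk, hT⟩ =>
    hk ▸ card_le_of_separated hV e he hm Q hmτ T hT⟩
  obtain ⟨T, hTk, hT⟩ := Nat.sSup_mem (s := S) ⟨0, ∅, by simp⟩ hbdd
  refine ⟨T, card_le_of_separated hV e he hm Q hmτ T hT, fun a => ?_⟩
  by_contra! h
  have haT : a ∉ T := fun ha => by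
    have := h a ha
    simp at this
    linarith
  have hsymm : ∀ b, {u | e b u ≠ e a u} = {u | e a u ≠ e b u} := fun b => by
    ext u; exact ne_comm
  have hmem : T.card + 1 ∈ S := by
    refine ⟨insert a T, Finset.card_insert_of_notMem haT, fun x hx y hy hxy => ?_⟩
    rcases Finset.mem_insert.1 hx with rfl | hx'
    · rcases Finset.mem_insert.1 hy with rfl | hy'
      · exact absurd rfl hxy
      · exact h y hy'
    · rcases Finset.mem_insert.1 hy with rfl | hy'
      · rw [hsymm]; exact h x hx'
      · exact hT x hx' y hy' hxy
  have := le_csSup hbdd hmem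
  omega

end VC

/-! ### Uniform deviations over VC classes -/

section Deviation

variable {U W ι : Type*}

lemma abs_comp_sub_comp_le {l : Bool → ℝ} {B : ℝ} (hl : ∀ b, |l b| ≤ B) (g g' : U → Bool) (u : U) :
    |l (g u) - l (g' u)| ≤ 2 * B * {u | g u ≠ g' u}.indicator 1 u := by
  by_cases h : g u = g' u
  · simp [h]
  · have hu : u ∈ {u | g u ≠ g' u} := h
    rw [Set.indicator_of_mem hu, Pi.one_apply, mul_one]
    linarith [abs_sub (l (g u)) (l (g' u)), hl (g u), hl (g' u)]

lemma mix_indicator_le {n : ℕ} (σ : Fin n → Bool) (w w' : Fin n → W) (h : W → ℝ) (hh : ∀ x, 0 ≤ h x)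
    (i : Fin n) : h (mix σ w w' i) ≤ h (w i) + h (w' i) := by
  by_cases hi : σ i <;> simp [mix, hi, hh]

variable [MeasurableSpace U] [MeasurableSpace W]

/-- The average of finitely many measures. -/
noncomputable def avgMeasure {I : Type*} [Fintype I] (κ : I → Measure U) : Measure U :=
  (Fintype.card I : ℝ≥0∞)⁻¹ • ∑ i, κ i

lemma isProbabilityMeasure_avgMeasure {I : Type*} [Fintype I] [Nonempty I] (κ : I → Measure U)
    (hκ : ∀ i, IsProbabilityMeasure (κ i)) : IsProbabilityMeasure (avgMeasure κ) := by
  constructor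
  rw [avgMeasure, Measure.smul_apply, Measure.finsetSum_apply]
  simp only [measure_univ, Finset.sum_const, Finset.card_univ, nsmul_eq_mul, mul_one, smul_eq_mul]
  exact ENNReal.inv_mul_cancel (by simp) (by simp)

lemma card_mul_avgMeasure_real {I : Type*} [Fintype I] [Nonempty I] (κ : I → Measure U)
    [hκ : ∀ i, IsProbabilityMeasure (κ i)] (s : Set U) :
    Fintype.card I * (avgMeasure κ).real s = ∑ i, (κ i).real s := by
  rw [avgMeasure, measureReal_def, Measure.smul_apply, Measure.finsetSum_apply, smul_eq_mul,
    ENNReal.toReal_mul, ENNReal.toReal_inv, ENNReal.toReal_natCast, ENNReal.toReal_sum (by simp),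
    ← mul_assoc, mul_inv_cancel₀ (by simp), one_mul]
  rfl

/-- The uniform deviation inequality for functionals indexed by a VC class, which depend on the
classifier through its values on a pool of `2n` points only. -/
theorem measure_exists_deviation_le_of_vcDim_le [Countable ι] (μ : Measure W)
    [IsProbabilityMeasure μ] {n : ℕ} (hn : 0 < n) {𝒢 : Set (U → Bool)} {V : ℕ} (hV : vcDim 𝒢 ≤ V)
    (e : ι → U → Bool) (he : ∀ a, e a ∈ 𝒢) (hm : ∀ a, Measurable (e a))
    (F : ι → (Fin n → W) → ℝ)
    (hF : ∀ θ, Measurable (F θ)) {B : ℝ} (hB : ∀ θ w, |F θ w| ≤ B) {c : ℝ} (hc : 0 < c)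
    (hdiff : ∀ θ w j x, |F θ (Function.update w j x) - F θ w| ≤ c) {A : ℝ} (hA : 0 ≤ A)
    (hpool : ∀ w w', ∃ Q : Measure U, IsProbabilityMeasure Q ∧ ∀ θ θ' σ,
      |F θ (mix σ w w') - F θ' (mix σ w w')| ≤ A * Q.real {u | e θ u ≠ e θ' u})
    {τ : ℝ} (hτ : 0 ≤ τ) {m : ℕ}
    (hmτ : (((m + 1) ^ V + 1 : ℕ) : ℝ) ^ 2 * Real.exp (-(m * τ)) < 1)
    {X : ℝ} (hX : 0 ≤ X) :
    (Measure.pi fun _ : Fin n => μ)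
        {w | ∃ θ, 2 * (A * τ) + c * √(2 * n * X) ≤ F θ w - ∫ v, F θ v ∂(Measure.pi fun _ => μ)} ≤
      ENNReal.ofReal ((m + 1) ^ V * Real.exp (-X)) := by
  have h := measure_exists_deviation_le μ hn F hF hB hc hdiff (P := (m + 1) ^ V) (τ := A * τ)
    (fun w w' => ?_) hX
  · exact_mod_cast h
  obtain ⟨Q, hQ, hQF⟩ := hpool w w'
  obtain ⟨T, hT, hcov⟩ := exists_cover_of_vcDim_le hV e he hm Q hτ hmτ
  refine ⟨T, hT, fun a => ?_⟩
  obtain ⟨b, hb, hab⟩ := hcov a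
  exact ⟨b, hb, fun σ => (hQF a b σ).trans (mul_le_mul_of_nonneg_left hab hA)⟩

/-- Uniform convergence of the empirical risk over a subset `A` of an i.i.d. sample. -/
theorem measure_exists_iid_deviation_le [Countable ι] (ν : Measure U)
    [IsProbabilityMeasure ν] {n : ℕ} (hn : 0 < n) {𝒢 : Set (U → Bool)} {V : ℕ} (hV : vcDim 𝒢 ≤ V)
    (e : ι → U → Bool) (he : ∀ a, e a ∈ 𝒢) (hm : ∀ a, Measurable (e a))
    {l : Bool → ℝ} {B : ℝ} (hl : ∀ b, |l b| ≤ B) (hB0 : 0 < B) (A : Finset (Fin n))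
    {τ : ℝ} (hτ : 0 ≤ τ) {m : ℕ}
    (hmτ : (((m + 1) ^ V + 1 : ℕ) : ℝ) ^ 2 * Real.exp (-(m * τ)) < 1)
    {X : ℝ} (hX : 0 ≤ X) :
    (Measure.pi fun _ : Fin n => ν)
        {w | ∃ θ, 2 * (4 * B * τ) + 2 * B / n * √(2 * n * X) ≤
          1 / n * ∑ i ∈ A, l (e θ (w i)) - A.card / n * ∫ u, l (e θ u) ∂ν} ≤
      ENNReal.ofReal ((m + 1) ^ V * Real.exp (-X)) := by
  have hn' : (0 : ℝ) < n := by exact_mod_cast hn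
  have hml : ∀ θ, Measurable fun u => l (e θ u) := fun θ =>
    (measurable_of_finite l).comp (hm θ)
  set F : ι → (Fin n → U) → ℝ := fun θ w => 1 / n * ∑ i ∈ A, l (e θ (w i)) with hF
  have hFm : ∀ θ, Measurable (F θ) := fun θ =>
    (Finset.measurable_sum _ fun i _ => (hml θ).comp (measurable_pi_apply i)).const_mul _
  have hAn : (A.card : ℝ) ≤ n := by
    exact_mod_cast (Finset.card_le_univ A).trans_eq (Fintype.card_fin n)
  have hFB : ∀ θ w, |F θ w| ≤ B := fun θ w => by
    have h1 : |∑ i ∈ A, l (e θ (w i))| ≤ n * B := by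
      refine (Finset.abs_sum_le_sum_abs _ _).trans ((Finset.sum_le_card_nsmul _ _ B
        fun i _ => hl _).trans ?_)
      rw [nsmul_eq_mul]
      gcongr
    rw [hF, abs_mul, abs_of_nonneg (by positivity), one_div, inv_mul_le_iff₀ hn']
    exact h1
  have hint : ∀ θ, ∫ w, F θ w ∂(Measure.pi fun _ => ν) = A.card / n * ∫ u, l (e θ u) ∂ν := fun θ => by
    have hi : ∀ i : Fin n, ∫ w : Fin n → U, l (e θ (w i)) ∂(Measure.pi fun _ => ν) =
        ∫ u, l (e θ u) ∂ν := fun i =>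
      integral_comp_eval (μ := fun _ : Fin n => ν) (hml θ).aestronglyMeasurable
    simp only [hF]
    rw [integral_const_mul, integral_finsetSum]
    · simp_rw [hi]
      rw [Finset.sum_const, nsmul_eq_mul]
      ring
    · exact fun i _ => Integrable.of_bound
        ((hml θ).comp (measurable_pi_apply i)).aestronglyMeasurable B (ae_of_all _ fun w => hl _)
  have := measure_exists_deviation_le_of_vcDim_le ν hn hV e he hm F hFm hFB
    (c := 2 * B / n) (by positivity) (fun θ w j x => ?_) (A := 4 * B) (by positivity)
    (fun w w' => ?_) hτ hmτ hX
  · simp_rw [hint] at this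
    exact this
  · simp only [hF]
    rw [← mul_sub, ← Finset.sum_sub_distrib, abs_mul, abs_of_nonneg (by positivity), one_div,
      inv_mul_le_iff₀ hn', mul_div_cancel₀ _ hn'.ne']
    calc |∑ i ∈ A, (l (e θ (Function.update w j x i)) - l (e θ (w i)))|
        ≤ ∑ i ∈ A, |l (e θ (Function.update w j x i)) - l (e θ (w i))| :=
          Finset.abs_sum_le_sum_abs _ _
      _ ≤ ∑ i, |l (e θ (Function.update w j x i)) - l (e θ (w i))| :=
          Finset.sum_le_univ_sum_of_nonneg fun _ => abs_nonneg _
      _ = |l (e θ (Function.update w j x j)) - l (e θ (w j))| :=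
          Finset.sum_eq_single j (fun i _ hij => by simp [hij]) (by simp)
      _ ≤ 2 * B := by
          linarith [abs_sub (l (e θ (Function.update w j x j))) (l (e θ (w j))),
            hl (e θ (Function.update w j x j)), hl (e θ (w j))]
  · have : Nonempty (Fin n ⊕ Fin n) := ⟨Sum.inl ⟨0, hn⟩⟩
    set κ : Fin n ⊕ Fin n → Measure U :=
      Sum.elim (fun i => Measure.dirac (w i)) fun i => Measure.dirac (w' i) with hκ
    have hκp : ∀ i, IsProbabilityMeasure (κ i) := by
      rintro (i | i) <;> simp only [hκ, Sum.elim_inl, Sum.elim_inr] <;> infer_instance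
    refine ⟨avgMeasure κ, isProbabilityMeasure_avgMeasure κ hκp, fun θ θ' σ => ?_⟩
    have hs : MeasurableSet {u | e θ u ≠ e θ' u} := (measurableSet_eq_fun (hm θ) (hm θ')).compl
    have h := card_mul_avgMeasure_real κ {u | e θ u ≠ e θ' u}
    have hdir : ∀ x : U, (Measure.dirac x).real {u | e θ u ≠ e θ' u} =
        {u | e θ u ≠ e θ' u}.indicator 1 x := fun x => by
      rw [measureReal_def, Measure.dirac_apply' _ hs]
      by_cases hx : x ∈ {u | e θ u ≠ e θ' u}
      · rw [Set.indicator_of_mem hx, Set.indicator_of_mem hx]; simp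
      · rw [Set.indicator_of_notMem hx, Set.indicator_of_notMem hx]; simp
    simp only [hκ, Fintype.sum_sum_type, Sum.elim_inl, Sum.elim_inr, hdir, Fintype.card_sum,
      Fintype.card_fin] at h
    rw [← Finset.sum_add_distrib] at h
    push_cast at h
    simp only [hF]
    rw [← mul_sub, ← Finset.sum_sub_distrib, abs_mul, abs_of_nonneg (by positivity), one_div,
      inv_mul_le_iff₀ hn']
    calc |∑ i ∈ A, (l (e θ (mix σ w w' i)) - l (e θ' (mix σ w w' i)))|
        ≤ ∑ i ∈ A, |l (e θ (mix σ w w' i)) - l (e θ' (mix σ w w' i))| :=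
          Finset.abs_sum_le_sum_abs _ _
      _ ≤ ∑ i, |l (e θ (mix σ w w' i)) - l (e θ' (mix σ w w' i))| :=
          Finset.sum_le_univ_sum_of_nonneg fun _ => abs_nonneg _
      _ ≤ ∑ i, 2 * B * ({u | e θ u ≠ e θ' u}.indicator 1 (w i) +
            {u | e θ u ≠ e θ' u}.indicator 1 (w' i)) := Finset.sum_le_sum fun i _ =>
          (abs_comp_sub_comp_le hl _ _ _).trans (mul_le_mul_of_nonneg_left
            (mix_indicator_le σ w w' _ (fun x => Set.indicator_nonneg (by simp) x) i)
            (by positivity))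
      _ = _ := by
          rw [← Finset.mul_sum, ← h]
          simp only [hκ]
          ring

end Deviation

/-! ### The random training set -/

section Split

lemma sum_exp_split_le (n : ℕ) (s : ℝ) :
    ∑ T : Finset (Fin n ⊕ Fin n), Real.exp (s * (T.toLeft.card - T.toRight.card)) ≤
      4 ^ n * Real.exp (s ^ 2 * n / 4) := by
  set f : Fin n ⊕ Fin n → ℝ := Sum.elim (fun _ => Real.exp s) fun _ => Real.exp (-s) with hf
  have h1 : ∀ T : Finset (Fin n ⊕ Fin n), Real.exp (s * (T.toLeft.card - T.toRight.card)) =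
      ∏ i ∈ T, f i := fun T => by
    rw [Finset.prod_sum_eq_prod_toLeft_mul_prod_toRight]
    simp only [hf, Sum.elim_inl, Sum.elim_inr, Finset.prod_const]
    rw [← Real.exp_nat_mul, ← Real.exp_nat_mul, ← Real.exp_add]
    congr 1
    ring
  simp_rw [h1]
  have h2 := Finset.prod_one_add (f := f) Finset.univ
  rw [Finset.powerset_univ] at h2
  rw [← h2, Fintype.prod_sum_type]
  simp only [hf, Sum.elim_inl, Sum.elim_inr, Finset.prod_const, Finset.card_univ, Fintype.card_fin]
  rw [← mul_pow]
  have h3 : (1 + Real.exp s) * (1 + Real.exp (-s)) = 4 * Real.cosh (s / 2) ^ 2 := by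
    rw [Real.cosh_eq]
    have e1 : Real.exp s = Real.exp (s / 2) ^ 2 := by rw [← Real.exp_nat_mul]; congr 1; push_cast; ring
    have e2 : Real.exp (-s) = Real.exp (-(s / 2)) ^ 2 := by
      rw [← Real.exp_nat_mul]; congr 1; push_cast; ring
    have e3 : Real.exp (s / 2) * Real.exp (-(s / 2)) = 1 := by rw [← Real.exp_add]; simp
    rw [e1, e2]
    linear_combination (Real.exp (s / 2) * Real.exp (-(s / 2)) - 1) * e3
  rw [h3, mul_pow]
  gcongr
  calc (Real.cosh (s / 2) ^ 2) ^ n ≤ (Real.exp ((s / 2) ^ 2 / 2) ^ 2) ^ n := by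
        have := (Real.cosh_pos (s / 2)).le
        gcongr
        exact Real.cosh_le_exp_half_sq _
    _ = Real.exp (s ^ 2 * n / 4) := by
        rw [← Real.exp_nat_mul, ← Real.exp_nat_mul]
        congr 1
        push_cast
        ring

instance (n : ℕ) : Fintype (Split n) :=
  inferInstanceAs (Fintype {T : Finset (Fin n ⊕ Fin n) // T.card = n})

instance (n : ℕ) : MeasurableSingletonClass (Split n) := ⟨fun _ => trivial⟩

lemma card_split (n : ℕ) : Fintype.card (Split n) = n.centralBinom := by
  refine (Fintype.card_finset_len n).trans ?_
  rw [Fintype.card_sum, Fintype.card_fin, Nat.centralBinom, two_mul]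

instance (n : ℕ) : Nonempty (Split n) := by
  rw [← Fintype.card_pos_iff, card_split]
  exact n.centralBinom_pos

instance (n : ℕ) : IsProbabilityMeasure (ProbabilityTheory.uniformOn (Set.univ : Set (Split n))) :=
  ProbabilityTheory.isProbabilityMeasure_uniformOn Set.finite_univ Set.univ_nonempty

/-- The hypergeometric law is dominated by `2n` times a binomial law. -/
lemma uniformOn_split_exp_le {n : ℕ} (hn : 0 < n) (s t : ℝ) :
    ProbabilityTheory.uniformOn Set.univ
      {T : Split n | t ≤ s * ((T.1.toLeft.card : ℝ) - T.1.toRight.card)} ≤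
      ENNReal.ofReal (2 * n * Real.exp (s ^ 2 * n / 4 - t)) := by
  classical
  rw [ProbabilityTheory.uniformOn_univ, Measure.count_apply_finite _ (Set.toFinite _), card_split]
  set S := (Set.toFinite {T : Split n | t ≤ s * ((T.1.toLeft.card : ℝ) - T.1.toRight.card)}).toFinset
    with hS
  have hc : (0 : ℝ) < n.centralBinom := by exact_mod_cast n.centralBinom_pos
  have h1 : (S.card : ℝ) ≤ Real.exp (-t) * (4 ^ n * Real.exp (s ^ 2 * n / 4)) := by
    calc (S.card : ℝ) = ∑ T ∈ S, (1 : ℝ) := by simp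
      _ ≤ ∑ T ∈ S, Real.exp (-t) * Real.exp (s * ((T.1.toLeft.card : ℝ) - T.1.toRight.card)) := by
          refine Finset.sum_le_sum fun T hT => ?_
          rw [← Real.exp_add, Real.one_le_exp_iff]
          have : t ≤ s * ((T.1.toLeft.card : ℝ) - T.1.toRight.card) := by simpa [hS] using hT
          linarith
      _ = Real.exp (-t) * ∑ T ∈ S.image (fun T : Split n => T.1),
            Real.exp (s * ((T.toLeft.card : ℝ) - T.toRight.card)) := by
          rw [Finset.mul_sum]
          exact (Finset.sum_image (g := fun T : Split n => T.1)
            (f := fun T => Real.exp (-t) * Real.exp (s * ((T.toLeft.card : ℝ) - T.toRight.card)))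
            fun T _ T' _ h => Subtype.ext h).symm
      _ ≤ Real.exp (-t) * ∑ T : Finset (Fin n ⊕ Fin n),
            Real.exp (s * ((T.toLeft.card : ℝ) - T.toRight.card)) := by
          gcongr
          exact Finset.subset_univ _
      _ ≤ _ := by
          gcongr
          exact sum_exp_split_le n s
  have h2 : (4 : ℝ) ^ n ≤ 2 * n * n.centralBinom := by
    exact_mod_cast Nat.four_pow_le_two_mul_self_mul_centralBinom n hn
  refine ENNReal.div_le_of_le_mul ?_
  rw [← ENNReal.ofReal_natCast, ← ENNReal.ofReal_natCast, ← ENNReal.ofReal_mul (by positivity)]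
  refine ENNReal.ofReal_le_ofReal (h1.trans ?_)
  rw [sub_eq_add_neg, Real.exp_add]
  calc _ = 4 ^ n * (Real.exp (s ^ 2 * n / 4) * Real.exp (-t)) := by ring
    _ ≤ 2 * n * n.centralBinom * (Real.exp (s ^ 2 * n / 4) * Real.exp (-t)) := by gcongr
    _ = _ := by ring

/-- The numbers of samples of the two labels in the training set are nearly equal. -/
lemma uniformOn_split_deviation_le {n : ℕ} (hn : 0 < n) {X : ℝ} (hX : 0 ≤ X) :
    ProbabilityTheory.uniformOn Set.univ
      {T : Split n | √(n * X) ≤ |(T.1.toLeft.card : ℝ) - T.1.toRight.card|} ≤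
      ENNReal.ofReal (4 * n * Real.exp (-X)) := by
  have hn' : (0 : ℝ) < n := by exact_mod_cast hn
  set y := √(n * X) with hy
  have hy2 : y ^ 2 = n * X := Real.sq_sqrt (by positivity)
  have hy0 : 0 ≤ y := Real.sqrt_nonneg _
  have e1 : (2 * y / n) ^ 2 * n / 4 = X := by
    rw [div_pow, mul_pow, hy2]; field_simp; ring
  have e2 : (-(2 * y / n)) ^ 2 * n / 4 = X := by rw [neg_sq, e1]
  have e3 : 2 * y / n * y = 2 * X := by
    rw [show 2 * y / n * y = 2 * y ^ 2 / n by ring, hy2]; field_simp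
  have h1 := uniformOn_split_exp_le hn (2 * y / n) (2 * X)
  have h2 := uniformOn_split_exp_le hn (-(2 * y / n)) (2 * X)
  rw [e1] at h1
  rw [e2] at h2
  refine (measure_mono fun T (hT : y ≤ _) => ?_).trans ((measure_union_le _ _).trans
    ((add_le_add h1 h2).trans (le_of_eq ?_)))
  · rcases le_abs.1 hT with h | h
    · exact Or.inl (e3 ▸ mul_le_mul_of_nonneg_left h (by positivity))
    · right
      have := mul_le_mul_of_nonneg_left h (by positivity : 0 ≤ 2 * y / n)
      rw [e3] at this
      show 2 * X ≤ _
      linarith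
  · rw [← ENNReal.ofReal_add (by positivity) (by positivity)]
    congr 1
    rw [show X - 2 * X = -X by ring]
    ring

end Split

/-! ### The nearest-neighbour functional and its truncation -/

section NearestNeighbour

variable {dx dy dz n : ℕ}

/-- The points with `z` in `K` and within `r` of the `z`-coordinate of some sample. -/
def nearSet (K : Set (Eu dz)) (r : ℝ) (v : Fin n → Sample dx dy dz) : Set (Sample dx dy dz) :=
  {u | u.2.2 ∈ K ∧ ∃ j, dist u.2.2 (v j).2.2 ≤ r}

/-- The points with `z` in `K` and farther than `r` from the `z`-coordinates of all samples. -/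
def farSet (K : Set (Eu dz)) (r : ℝ) (v : Fin n → Sample dx dy dz) : Set (Sample dx dy dz) :=
  {u | u.2.2 ∈ K ∧ ∀ j, r < dist u.2.2 (v j).2.2}

lemma measurableSet_nearSet {K : Set (Eu dz)} (hK : MeasurableSet K) (r : ℝ) :
    MeasurableSet {p : Sample dx dy dz × (Fin n → Sample dx dy dz) | p.1 ∈ nearSet K r p.2} := by
  have h : MeasurableSet {p : Sample dx dy dz × (Fin n → Sample dx dy dz) |
      ∃ j, dist p.1.2.2 (p.2 j).2.2 ≤ r} := by
    rw [Set.ofPred_exists]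
    exact MeasurableSet.iUnion fun j => measurableSet_le (by fun_prop) (by fun_prop)
  exact (hK.preimage (by fun_prop)).inter h

lemma measurableSet_farSet {K : Set (Eu dz)} (hK : MeasurableSet K) (r : ℝ) :
    MeasurableSet {p : Sample dx dy dz × (Fin n → Sample dx dy dz) | p.1 ∈ farSet K r p.2} := by
  have h : MeasurableSet {p : Sample dx dy dz × (Fin n → Sample dx dy dz) |
      ∀ j, r < dist p.1.2.2 (p.2 j).2.2} := by
    rw [Set.ofPred_forall]
    exact MeasurableSet.iInter fun j => measurableSet_lt (by fun_prop) (by fun_prop)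
  exact (hK.preimage (by fun_prop)).inter h

lemma mem_nearSet_update_iff {K : Set (Eu dz)} {u x : Sample dx dy dz}
    {v : Fin n → Sample dx dy dz} {j : Fin n} {r : ℝ}
    (hj : r < dist u.2.2 (v j).2.2) (hx : r < dist u.2.2 x.2.2) :
    u ∈ nearSet K r (Function.update v j x) ↔ u ∈ nearSet K r v := by
  refine and_congr_right fun _ => exists_congr fun k => ?_
  by_cases hkj : k = j
  · subst hkj
    rw [Function.update_self]
    constructor <;> intro h <;> linarith
  · rw [Function.update_of_ne hkj]

lemma mem_farSet_iff {K : Set (Eu dz)} {u : Sample dx dy dz} {v : Fin n → Sample dx dy dz} {r : ℝ} :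
    u ∈ farSet K r v ↔ u.2.2 ∈ K ∧ u ∉ nearSet K r v := by
  simp only [farSet, nearSet, Set.mem_ofPred_eq]
  grind

lemma measurableSet_farSet_section {K : Set (Eu dz)} (hK : MeasurableSet K) (r : ℝ)
    (v : Fin n → Sample dx dy dz) : MeasurableSet (farSet K r v) :=
  (measurableSet_farSet hK r).preimage (measurable_id.prodMk measurable_const)

lemma abs_integral_sub_integral_le (ρ : Measure (Sample dx dy dz)) [IsFiniteMeasure ρ]
    {a b : Sample dx dy dz → ℝ} (ha : Integrable a ρ)
    (hb : Integrable b ρ) {C : ℝ} {S : Set (Sample dx dy dz)} (hS : MeasurableSet S)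
    (h : ∀ u, |a u - b u| ≤ C * S.indicator 1 u) : |∫ u, a u ∂ρ - ∫ u, b u ∂ρ| ≤ C * ρ.real S := by
  rw [← integral_sub ha hb, ← integral_indicator_one hS, ← integral_const_mul]
  refine (abs_integral_le_integral_abs).trans (integral_mono (ha.sub hb).abs ?_ h)
  exact ((integrable_const (1 : ℝ)).indicator hS).const_mul C

/-- The mass of the points within `r` of one of two given centres. -/
lemma real_twoBalls_le {ρ : Measure (Sample dx dy dz)} {κ r : ℝ}
    (hκ : ∀ a : Eu dz, ρ.real {u | dist u.2.2 a ≤ r} ≤ κ) (a b : Eu dz) :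
    ρ.real ({u | dist u.2.2 a ≤ r} ∪ {u | dist u.2.2 b ≤ r}) ≤ 2 * κ := by
  linarith [measureReal_union_le (μ := ρ) {u | dist u.2.2 a ≤ r} {u | dist u.2.2 b ≤ r}, hκ a, hκ b]

lemma measurableSet_twoBalls (r : ℝ) (a b : Eu dz) :
    MeasurableSet ({u : Sample dx dy dz | dist u.2.2 a ≤ r} ∪ {u | dist u.2.2 b ≤ r}) :=
  (measurableSet_le (by fun_prop) (by fun_prop)).union (measurableSet_le (by fun_prop) (by fun_prop))

variable {ρ : Measure (Sample dx dy dz)} [IsProbabilityMeasure ρ] {K : Set (Eu dz)} {r : ℝ}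

/-- Bounded differences: one sample affects only the points within `r` of its old or new position. -/
lemma farMass_update (hK : MeasurableSet K) {κ : ℝ}
    (hκ : ∀ a : Eu dz, ρ.real {u | dist u.2.2 a ≤ r} ≤ κ) (v : Fin n → Sample dx dy dz) (j : Fin n)
    (x : Sample dx dy dz) :
    |ρ.real (farSet K r (Function.update v j x)) - ρ.real (farSet K r v)| ≤ 2 * κ := by
  rw [← integral_indicator_one (measurableSet_farSet_section hK r v),
    ← integral_indicator_one (measurableSet_farSet_section hK r _)]
  refine (abs_integral_sub_integral_le ρ (C := 1)
    ((integrable_const (1 : ℝ)).indicator (measurableSet_farSet_section hK r _))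
    ((integrable_const (1 : ℝ)).indicator (measurableSet_farSet_section hK r _))
    (measurableSet_twoBalls r (v j).2.2 x.2.2) fun u => ?_).trans
    ((one_mul _).trans_le (real_twoBalls_le hκ _ _))
  by_cases hu : u ∈ {u : Sample dx dy dz | dist u.2.2 (v j).2.2 ≤ r} ∪ {u | dist u.2.2 x.2.2 ≤ r}
  · rw [Set.indicator_of_mem hu, Pi.one_apply, mul_one]
    by_cases h1 : u ∈ farSet K r (Function.update v j x) <;> by_cases h2 : u ∈ farSet K r v <;>
      simp [h1, h2]
  · rw [Set.indicator_of_notMem hu, mul_zero]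
    simp only [Set.mem_union, Set.mem_ofPred_eq, not_or, not_le] at hu
    have h : u ∈ farSet K r (Function.update v j x) ↔ u ∈ farSet K r v := by
      rw [mem_farSet_iff, mem_farSet_iff, mem_nearSet_update_iff hu.1 hu.2]
    by_cases h2 : u ∈ farSet K r v
    · simp [h2, h.2 h2]
    · simp [h2, mt h.1 h2]

lemma measurable_farMass (hK : MeasurableSet K) :
    Measurable fun v : Fin n → Sample dx dy dz => ρ.real (farSet K r v) :=
  (measurable_measure_prodMk_right (measurableSet_farSet hK r)).ennreal_toReal

/-- The mean mass of the points without a near neighbour, if each ball of radius `r` with centre in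
`K` has mass at least `p`. -/
lemma integral_farMass_le (hK : MeasurableSet K) {p : ℝ}
    (hp : ∀ z ∈ K, p ≤ ρ.real {u | dist z u.2.2 ≤ r}) :
    ∫ v, ρ.real (farSet K r v) ∂(Measure.pi fun _ : Fin n => ρ) ≤ Real.exp (-(n * p)) := by
  have hS := measurableSet_farSet (n := n) (dx := dx) (dy := dy) hK r
  have hsec : ∀ u : Sample dx dy dz, (Measure.pi fun _ : Fin n => ρ) {v | u ∈ farSet K r v} ≤
      ENNReal.ofReal (Real.exp (-(n * p))) := fun u => by
    by_cases hu : u.2.2 ∈ K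
    · have h1 : {v : Fin n → Sample dx dy dz | u ∈ farSet K r v} =
          Set.univ.pi fun _ => {w | dist u.2.2 w.2.2 ≤ r}ᶜ := by
        ext v
        simp [farSet, hu]
      have hm : MeasurableSet {w : Sample dx dy dz | dist u.2.2 w.2.2 ≤ r} :=
        measurableSet_le (by fun_prop) (by fun_prop)
      have hle : ρ.real {w : Sample dx dy dz | dist u.2.2 w.2.2 ≤ r} ≤ 1 := measureReal_le_one
      rw [h1, Measure.pi_pi, Finset.prod_const, Finset.card_univ, Fintype.card_fin,
        ← ofReal_measureReal, probReal_compl_eq_one_sub hm,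
        ← ENNReal.ofReal_pow (by linarith)]
      refine ENNReal.ofReal_le_ofReal ?_
      rw [show -(n * p) = n * (-p) by ring, Real.exp_nat_mul]
      refine pow_le_pow_left₀ (by linarith) ?_ n
      linarith [Real.add_one_le_exp (-p), hp u.2.2 hu]
    · have h1 : {v : Fin n → Sample dx dy dz | u ∈ farSet K r v} = ∅ := by
        ext v
        simp [farSet, hu]
      simp [h1]
  have h2 : ∫⁻ v, ρ (farSet K r v) ∂(Measure.pi fun _ : Fin n => ρ) ≤
      ENNReal.ofReal (Real.exp (-(n * p))) := by
    calc _ = (ρ.prod (Measure.pi fun _ : Fin n => ρ)) {p | p.1 ∈ farSet K r p.2} :=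
          (Measure.prod_apply_symm hS).symm
      _ = ∫⁻ u, (Measure.pi fun _ : Fin n => ρ) {v | u ∈ farSet K r v} ∂ρ := Measure.prod_apply hS
      _ ≤ ∫⁻ _, ENNReal.ofReal (Real.exp (-(n * p))) ∂ρ := lintegral_mono hsec
      _ = _ := by simp
  simp only [measureReal_def]
  have hm : Measurable fun v : Fin n → Sample dx dy dz => ρ (farSet K r v) :=
    measurable_measure_prodMk_right hS
  rw [integral_toReal hm.aemeasurable
    (ae_of_all _ fun v => measure_lt_top _ _)]
  exact ENNReal.toReal_le_of_le_ofReal (Real.exp_pos _).le h2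

variable [NeZero n]

lemma dist_nearest_le (z : Eu dz) (v : Fin n → Sample dx dy dz) (k : Fin n) :
    dist z (v (nearest z v)).2.2 ≤ dist z (v k).2.2 :=
  (Finset.mem_filter.1 (Finset.min'_mem _ (exists_nearest z v))).2 k

/-- A change of one sample has no effect on the bootstrap at points near to some sample, but far
from the old and from the new position of the changed one. -/
lemma bootstrap_update {u x : Sample dx dy dz} {v : Fin n → Sample dx dy dz} {j : Fin n} {r : ℝ}
    (hj : r < dist u.2.2 (v j).2.2) (hx : r < dist u.2.2 x.2.2)
    (hk : ∃ k, dist u.2.2 (v k).2.2 ≤ r) :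
    bootstrap u (Function.update v j x) = bootstrap u v := by
  obtain ⟨k₀, hk₀⟩ := hk
  have hk₀j : k₀ ≠ j := fun h => by rw [h] at hk₀; linarith
  have hfil : (Finset.univ.filter fun i => ∀ k, dist u.2.2 (Function.update v j x i).2.2 ≤
      dist u.2.2 (Function.update v j x k).2.2) =
      Finset.univ.filter fun i => ∀ k, dist u.2.2 (v i).2.2 ≤ dist u.2.2 (v k).2.2 := by
    refine Finset.filter_congr fun i _ => ?_
    by_cases hij : i = j
    · subst hij
      constructor
      · intro h
        have := h k₀
        rw [Function.update_self, Function.update_of_ne hk₀j] at this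
        linarith
      · intro h
        have := h k₀
        linarith
    · rw [Function.update_of_ne hij]
      constructor
      · intro h k
        by_cases hkj : k = j
        · have := h k₀
          rw [Function.update_of_ne hk₀j] at this
          rw [hkj]
          linarith
        · simpa [hkj] using h k
      · intro h k
        by_cases hkj : k = j
        · have := h k₀
          rw [hkj, Function.update_self]
          linarith
        · simpa [hkj] using h k
  have hnear : nearest u.2.2 (Function.update v j x) = nearest u.2.2 v := by
    simp only [nearest, hfil]
  have hne : nearest u.2.2 v ≠ j := fun h => by
    have := dist_nearest_le u.2.2 v k₀
    rw [h] at this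
    linarith
  simp only [bootstrap, hnear, Function.update_of_ne hne]

variable (ρ)

/-- The risk of `g`, for the loss `l`, at a point bootstrapped from the data-set `v`. -/
noncomputable def bootRisk (l : Bool → ℝ) (g : Sample dx dy dz → Bool)
    (v : Fin n → Sample dx dy dz) : ℝ :=
  ∫ u, l (g (bootstrap u v)) ∂ρ

/-- The part of `bootRisk` that comes from the points whose nearest neighbour is within `r` and
whose `z` is in `K`. Unlike `bootRisk`, it has small bounded differences as a function of `v`. -/
noncomputable def truncRisk (l : Bool → ℝ) (K : Set (Eu dz)) (r : ℝ) (g : Sample dx dy dz → Bool)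
    (v : Fin n → Sample dx dy dz) : ℝ :=
  ∫ u, (nearSet K r v).indicator (fun u => l (g (bootstrap u v))) u ∂ρ

variable {ρ} {l : Bool → ℝ} {B : ℝ} {g : Sample dx dy dz → Bool}

lemma measurable_loss_bootstrap (l : Bool → ℝ) (hg : Measurable g) :
    Measurable fun p : Sample dx dy dz × (Fin n → Sample dx dy dz) => l (g (bootstrap p.1 p.2)) :=
  (measurable_of_finite l).comp (hg.comp measurable_bootstrap)

lemma measurable_truncated_loss (l : Bool → ℝ) (hK : MeasurableSet K) (hg : Measurable g) :
    Measurable fun p : Sample dx dy dz × (Fin n → Sample dx dy dz) =>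
      (nearSet K r p.2).indicator (fun u => l (g (bootstrap u p.2))) p.1 := by
  exact (measurable_loss_bootstrap l hg).indicator (measurableSet_nearSet hK r)

lemma measurable_bootRisk (l : Bool → ℝ) (hg : Measurable g) :
    Measurable (bootRisk ρ l g (n := n)) :=
  (measurable_loss_bootstrap l hg).stronglyMeasurable.integral_prod_left'.measurable

lemma measurable_truncRisk (l : Bool → ℝ) (hK : MeasurableSet K) (hg : Measurable g) :
    Measurable (truncRisk ρ l K r g (n := n)) :=
  (measurable_truncated_loss l hK hg).stronglyMeasurable.integral_prod_left'.measurable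

lemma abs_truncated_loss_le (hl : ∀ b, |l b| ≤ B) (v : Fin n → Sample dx dy dz)
    (u : Sample dx dy dz) :
    |(nearSet K r v).indicator (fun u => l (g (bootstrap u v))) u| ≤ B := by
  by_cases h : u ∈ nearSet K r v
  · rw [Set.indicator_of_mem h]; exact hl _
  · rw [Set.indicator_of_notMem h, abs_zero]; exact (abs_nonneg _).trans (hl true)

lemma integrable_loss_bootstrap (hl : ∀ b, |l b| ≤ B) (hg : Measurable g)
    (v : Fin n → Sample dx dy dz) : Integrable (fun u => l (g (bootstrap u v))) ρ :=
  Integrable.of_bound ((measurable_loss_bootstrap l hg).comp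
    (measurable_id.prodMk measurable_const)).aestronglyMeasurable B (ae_of_all _ fun _ => hl _)

lemma integrable_truncated_loss (hl : ∀ b, |l b| ≤ B) (hK : MeasurableSet K) (hg : Measurable g)
    (v : Fin n → Sample dx dy dz) :
    Integrable (fun u => (nearSet K r v).indicator (fun u => l (g (bootstrap u v))) u) ρ :=
  Integrable.of_bound ((measurable_truncated_loss l hK hg).comp
    (measurable_id.prodMk measurable_const)).aestronglyMeasurable B
    (ae_of_all _ fun u => abs_truncated_loss_le hl v u)

lemma abs_bootRisk_le (hl : ∀ b, |l b| ≤ B) (v : Fin n → Sample dx dy dz) :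
    |bootRisk ρ l g v| ≤ B := by
  have := norm_integral_le_of_norm_le_const (μ := ρ) (C := B) (ae_of_all _ fun u =>
    (Real.norm_eq_abs _).trans_le (hl (g (bootstrap u v))))
  simpa [bootRisk] using this

lemma abs_truncRisk_le (hl : ∀ b, |l b| ≤ B) (v : Fin n → Sample dx dy dz) :
    |truncRisk ρ l K r g v| ≤ B := by
  have := norm_integral_le_of_norm_le_const (μ := ρ) (C := B) (ae_of_all _ fun u =>
    (Real.norm_eq_abs _).trans_le (abs_truncated_loss_le (K := K) (r := r) (g := g) hl v u))
  simpa [truncRisk] using this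

lemma abs_bootRisk_sub_truncRisk_le (hl : ∀ b, |l b| ≤ B) (hK : MeasurableSet K)
    (hg : Measurable g) (v : Fin n → Sample dx dy dz) :
    |bootRisk ρ l g v - truncRisk ρ l K r g v| ≤
      B * (ρ.real {u | u.2.2 ∉ K} + ρ.real (farSet K r v)) := by
  have hB : 0 ≤ B := (abs_nonneg _).trans (hl true)
  have hKs : MeasurableSet {u : Sample dx dy dz | u.2.2 ∉ K} := hK.compl.preimage (by fun_prop)
  refine (abs_integral_sub_integral_le ρ (integrable_loss_bootstrap hl hg v)
    (integrable_truncated_loss hl hK hg v) (hKs.union (measurableSet_farSet_section hK r v)) fun u => ?_).trans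
    (mul_le_mul_of_nonneg_left (measureReal_union_le _ _) hB)
  by_cases h : u ∈ nearSet K r v
  · rw [Set.indicator_of_mem h, sub_self, abs_zero]
    exact mul_nonneg hB (Set.indicator_nonneg (by simp) _)
  · have hu : u ∈ {u | u.2.2 ∉ K} ∪ farSet K r v := by
      by_cases hz : u.2.2 ∈ K
      · exact Or.inr (mem_farSet_iff.2 ⟨hz, h⟩)
      · exact Or.inl hz
    rw [Set.indicator_of_notMem h, sub_zero, Set.indicator_of_mem hu, Pi.one_apply, mul_one]
    exact hl _

/-- Bounded differences for the truncated risk. The truncation is what makes this true: without it, a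
single sample could be the nearest neighbour of a large part of the space. -/
lemma truncRisk_update (hl : ∀ b, |l b| ≤ B) (hK : MeasurableSet K) (hg : Measurable g) {κ : ℝ}
    (hκ : ∀ a : Eu dz, ρ.real {u | dist u.2.2 a ≤ r} ≤ κ) (v : Fin n → Sample dx dy dz) (j : Fin n)
    (x : Sample dx dy dz) :
    |truncRisk ρ l K r g (Function.update v j x) - truncRisk ρ l K r g v| ≤ 4 * B * κ := by
  have hB : 0 ≤ B := (abs_nonneg _).trans (hl true)
  refine (abs_integral_sub_integral_le ρ (C := 2 * B) (integrable_truncated_loss hl hK hg _)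
    (integrable_truncated_loss hl hK hg v) (measurableSet_twoBalls r (v j).2.2 x.2.2)
    fun u => ?_).trans ((mul_le_mul_of_nonneg_left (real_twoBalls_le hκ _ _)
      (by positivity)).trans_eq (by ring))
  by_cases hu : u ∈ {u : Sample dx dy dz | dist u.2.2 (v j).2.2 ≤ r} ∪ {u | dist u.2.2 x.2.2 ≤ r}
  · rw [Set.indicator_of_mem hu, Pi.one_apply, mul_one]
    refine (abs_sub _ _).trans ?_
    linarith [abs_truncated_loss_le (K := K) (r := r) (g := g) hl v u,
      abs_truncated_loss_le (K := K) (r := r) (g := g) hl (Function.update v j x) u]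
  · rw [Set.indicator_of_notMem hu, mul_zero]
    simp only [Set.mem_union, Set.mem_ofPred_eq, not_or, not_le] at hu
    have h := mem_nearSet_update_iff (K := K) hu.1 hu.2
    by_cases hn : u ∈ nearSet K r v
    · rw [Set.indicator_of_mem hn, Set.indicator_of_mem (h.2 hn), bootstrap_update hu.1 hu.2 hn.2,
        sub_self, abs_zero]
    · rw [Set.indicator_of_notMem hn, Set.indicator_of_notMem (mt h.1 hn), sub_self, abs_zero]

/-- The mass of the points that have no near neighbour concentrates around its mean. -/
lemma measure_farMass_deviation_le (hK : MeasurableSet K) {κ : ℝ} (hκ0 : 0 < κ)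
    (hκ : ∀ a : Eu dz, ρ.real {u | dist u.2.2 a ≤ r} ≤ κ) {X : ℝ} (hX : 0 ≤ X) :
    (Measure.pi fun _ : Fin n => ρ) {v | 2 * κ * √(2 * n * X) ≤ ρ.real (farSet K r v) -
        ∫ v, ρ.real (farSet K r v) ∂(Measure.pi fun _ : Fin n => ρ)} ≤
      ENNReal.ofReal (Real.exp (-X)) := by
  have h := measure_exists_deviation_le ρ (Nat.pos_of_neZero n) (ι := Unit)
    (fun _ v => ρ.real (farSet K r v)) (fun _ => measurable_farMass hK) (B := 1)
    (fun _ v => by rw [abs_of_nonneg measureReal_nonneg]; exact measureReal_le_one)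
    (c := 2 * κ) (by positivity) (fun _ => farMass_update hK hκ) (P := 1) (τ := 0)
    (fun w w' => ⟨{()}, by simp, fun _ => ⟨(), by simp, fun σ => by simp⟩⟩) hX
  simpa using h

/-- Uniform convergence of `truncRisk`, as a function of the data-set that supplies the nearest
neighbours. -/
theorem measure_exists_truncRisk_deviation_le {ι : Type*} [Countable ι]
    {𝒢 : Set (Sample dx dy dz → Bool)} {V : ℕ} (hV : vcDim 𝒢 ≤ V)
    (e : ι → Sample dx dy dz → Bool) (he : ∀ a, e a ∈ 𝒢) (hm : ∀ a, Measurable (e a))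
    (hl : ∀ b, |l b| ≤ B) (hB0 : 0 < B) (hK : MeasurableSet K) {κ : ℝ} (hκ0 : 0 < κ)
    (hκ : ∀ a : Eu dz, ρ.real {u | dist u.2.2 a ≤ r} ≤ κ)
    {τ : ℝ} (hτ : 0 ≤ τ) {m : ℕ}
    (hmτ : (((m + 1) ^ V + 1 : ℕ) : ℝ) ^ 2 * Real.exp (-(m * τ)) < 1)
    {X : ℝ} (hX : 0 ≤ X) :
    (Measure.pi fun _ : Fin n => ρ)
        {v | ∃ θ, 2 * (4 * B * n * τ) + 4 * B * κ * √(2 * n * X) ≤ truncRisk ρ l K r (e θ) v -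
          ∫ v, truncRisk ρ l K r (e θ) v ∂(Measure.pi fun _ : Fin n => ρ)} ≤
      ENNReal.ofReal ((m + 1) ^ V * Real.exp (-X)) := by
  have hn : 0 < n := Nat.pos_of_neZero n
  refine measure_exists_deviation_le_of_vcDim_le ρ hn hV e he hm _
    (fun θ => measurable_truncRisk l hK (hm θ)) (fun θ => abs_truncRisk_le hl)
    (c := 4 * B * κ) (by positivity) (fun θ => truncRisk_update hl hK (hm θ) hκ)
    (by positivity) (fun w w' => ?_) hτ hmτ hX
  have : Nonempty (Fin n ⊕ Fin n) := ⟨Sum.inl ⟨0, hn⟩⟩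
  have hmeas : ∀ x : Sample dx dy dz, Measurable fun u : Sample dx dy dz => (u.1, x.2.1, u.2.2) :=
    fun x => by fun_prop
  set κ' : Fin n ⊕ Fin n → Measure (Sample dx dy dz) :=
    Sum.elim (fun i => ρ.map fun u => (u.1, (w i).2.1, u.2.2))
      fun i => ρ.map fun u => (u.1, (w' i).2.1, u.2.2) with hκ'
  have hκp : ∀ i, IsProbabilityMeasure (κ' i) := by
    rintro (i | i) <;> simp only [hκ', Sum.elim_inl, Sum.elim_inr] <;>
      exact Measure.isProbabilityMeasure_map (hmeas _).aemeasurable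
  -- the distance of two classifiers is measured by all bootstrapped samples that the pool can produce
  refine ⟨avgMeasure κ', isProbabilityMeasure_avgMeasure κ' hκp, fun θ θ' σ => ?_⟩
  have hs : MeasurableSet {u | e θ u ≠ e θ' u} := (measurableSet_eq_fun (hm θ) (hm θ')).compl
  have h := card_mul_avgMeasure_real κ' {u | e θ u ≠ e θ' u}
  set D : Sample dx dy dz → Set (Sample dx dy dz) :=
    fun x => {u | e θ (u.1, x.2.1, u.2.2) ≠ e θ' (u.1, x.2.1, u.2.2)} with hD
  have hDm : ∀ x, MeasurableSet (D x) := fun x => hs.preimage (hmeas x)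
  have hmap : ∀ x : Sample dx dy dz, (ρ.map fun u => (u.1, x.2.1, u.2.2)).real
      {u | e θ u ≠ e θ' u} = ρ.real (D x) := fun x => by
    rw [measureReal_def, Measure.map_apply (hmeas x) hs]
    rfl
  simp only [hκ', Fintype.sum_sum_type, Sum.elim_inl, Sum.elim_inr, hmap, Fintype.card_sum,
    Fintype.card_fin] at h
  rw [← Finset.sum_add_distrib] at h
  push_cast at h
  calc |truncRisk ρ l K r (e θ) (mix σ w w') - truncRisk ρ l K r (e θ') (mix σ w w')|
      ≤ 2 * B * ρ.real (⋃ i, D (mix σ w w' i)) := by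
        refine abs_integral_sub_integral_le ρ (integrable_truncated_loss hl hK (hm θ) _)
          (integrable_truncated_loss hl hK (hm θ') _) (MeasurableSet.iUnion fun i => hDm _)
          fun u => ?_
        by_cases hu : u ∈ nearSet K r (mix σ w w')
        · rw [Set.indicator_of_mem hu, Set.indicator_of_mem hu]
          refine (abs_comp_sub_comp_le hl _ _ _).trans (mul_le_mul_of_nonneg_left ?_ (by positivity))
          by_cases hb : bootstrap u (mix σ w w') ∈ {u | e θ u ≠ e θ' u}
          · have hmem : u ∈ ⋃ i, D (mix σ w w' i) := Set.mem_iUnion.2 ⟨_, hb⟩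
            rw [Set.indicator_of_mem hb, Set.indicator_of_mem hmem]
            rfl
          · rw [Set.indicator_of_notMem hb]
            exact Set.indicator_nonneg (by simp) _
        · rw [Set.indicator_of_notMem hu, Set.indicator_of_notMem hu, sub_self, abs_zero]
          exact mul_nonneg (by positivity) (Set.indicator_nonneg (by simp) _)
    _ ≤ 2 * B * ∑ i, ρ.real (D (mix σ w w' i)) := by
        gcongr
        exact measureReal_iUnion_fintype_le _
    _ ≤ 2 * B * ∑ i, (ρ.real (D (w i)) + ρ.real (D (w' i))) := by
        gcongr with i
        exact mix_indicator_le σ w w' (fun x => ρ.real (D x)) (fun _ => measureReal_nonneg) i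
    _ = _ := by
        rw [← h]
        ring

end NearestNeighbour

/-! ### The law of the samples and the mass of balls -/

namespace JointDensity

variable {dx dy dz : ℕ} (J : JointDensity dx dy dz)

lemma measurable_ofReal_cond :
    Measurable fun u : Sample dx dy dz => ENNReal.ofReal (J.cond u.1 u.2.1 u.2.2) :=
  J.measurable_cond.ennreal_ofReal

/-- Integration first over `z`, then over `x`, then over `y`. -/
lemma lintegral_sample {h : Sample dx dy dz → ℝ≥0∞} (hh : Measurable h) :
    ∫⁻ u, h u = ∫⁻ z, ∫⁻ x, ∫⁻ y, h (x, y, z) := by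
  have hyz : Measurable fun p : Eu dx × Eu dz => ∫⁻ y, h (p.1, y, p.2) :=
    (hh.comp (by fun_prop : Measurable fun q : (Eu dx × Eu dz) × Eu dy =>
      ((q.1.1, q.2, q.1.2) : Sample dx dy dz))).lintegral_prod_right'
  rw [Measure.volume_eq_prod, lintegral_prod _ hh.aemeasurable]
  have h1 : ∀ x : Eu dx, ∫⁻ p : Eu dy × Eu dz, h (x, p) = ∫⁻ z, ∫⁻ y, h (x, y, z) := fun x => by
    rw [Measure.volume_eq_prod]
    exact lintegral_prod_symm _ (hh.comp measurable_prodMk_left).aemeasurable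
  simp_rw [h1]
  exact lintegral_lintegral_swap hyz.aemeasurable

lemma measurable_section_xy {h : Sample dx dy dz → ℝ≥0∞} (hh : Measurable h) (z : Eu dz) :
    Measurable fun p : Eu dx × Eu dy => h (p.1, p.2, z) :=
  hh.comp (by fun_prop : Measurable fun p : Eu dx × Eu dy => ((p.1, p.2, z) : Sample dx dy dz))

/-- Integration against the law of a sample: first `z` from its marginal, then `(x, y)` given `z`. -/
lemma lintegral_law {h : Sample dx dy dz → ℝ≥0∞} (hh : Measurable h) :
    ∫⁻ u, h u ∂J.law =
      ∫⁻ z, ENNReal.ofReal (J.margZ z) * ∫⁻ x, ∫⁻ y, ENNReal.ofReal (J.cond x y z) * h (x, y, z) := by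
  have hm : Measurable fun u : Sample dx dy dz => ENNReal.ofReal (J.density u) :=
    J.measurable_density.ennreal_ofReal
  rw [law, lintegral_withDensity_eq_lintegral_mul _ hm hh, lintegral_sample (hm.mul hh)]
  refine lintegral_congr fun z => ?_
  have hc : Measurable fun p : Eu dx × Eu dy => ENNReal.ofReal (J.cond p.1 p.2 z) * h (p.1, p.2, z) :=
    measurable_section_xy (J.measurable_ofReal_cond.mul hh) z
  rw [← lintegral_const_mul _ hc.lintegral_prod_right]
  refine lintegral_congr fun x => ?_
  have hcx : Measurable fun y => ENNReal.ofReal (J.cond x y z) * h (x, y, z) :=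
    hc.comp measurable_prodMk_left
  rw [← lintegral_const_mul _ hcx]
  refine lintegral_congr fun y => ?_
  simp only [Pi.mul_apply, density]
  rw [ENNReal.ofReal_mul (J.cond_nonneg _ _ _)]
  ring

lemma law_preimage_z {S : Set (Eu dz)} (hS : MeasurableSet S) :
    J.law {u | u.2.2 ∈ S} = ∫⁻ z in S, ENNReal.ofReal (J.margZ z) := by
  have hS' : MeasurableSet {u : Sample dx dy dz | u.2.2 ∈ S} := hS.preimage (by fun_prop)
  rw [← lintegral_indicator_one hS', J.lintegral_law (measurable_one.indicator hS'),
    ← lintegral_indicator hS]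
  refine lintegral_congr fun z => ?_
  by_cases hz : z ∈ S
  · have : ∀ (x : Eu dx) (y : Eu dy), {u : Sample dx dy dz | u.2.2 ∈ S}.indicator
        (1 : Sample dx dy dz → ℝ≥0∞) (x, y, z) = 1 := fun x y => Set.indicator_of_mem (by exact hz) _
    simp only [this, mul_one, J.lintegral_cond, Set.indicator_of_mem hz]
  · simp [hz]

end JointDensity

lemma unitBallVolume_pos (d : ℕ) : 0 < unitBallVolume d :=
  ENNReal.toReal_pos (Metric.measure_ball_pos _ _ one_pos).ne' measure_ball_lt_top.ne

lemma volume_closedBall_eq {d : ℕ} (a : Eu d) {r : ℝ} (hr : 0 ≤ r) :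
    volume (Metric.closedBall a r) = ENNReal.ofReal (r ^ d * unitBallVolume d) := by
  rw [Measure.addHaar_closedBall _ _ hr, finrank_euclideanSpace_fin, unitBallVolume,
    ENNReal.ofReal_mul (by positivity), ENNReal.ofReal_toReal measure_ball_lt_top.ne]

namespace JointDensity

variable {dx dy dz : ℕ} {J : JointDensity dx dy dz} {ℓ : ℝ≥0}

lemma law_near_eq (a : Eu dz) (r : ℝ) :
    J.law {u | dist u.2.2 a ≤ r} = ∫⁻ z in Metric.closedBall a r, ENNReal.ofReal (J.margZ z) :=
  J.law_preimage_z (S := Metric.closedBall a r) measurableSet_closedBall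

/-- A Lipschitz density is at least `f(a) - ℓ r` on the ball of radius `r` around `a`. -/
lemma le_law_real_near (hℓ : LipschitzWith ℓ J.margZ) (a : Eu dz) {r : ℝ} (hr : 0 ≤ r) :
    (J.margZ a - ℓ * r) * (r ^ dz * unitBallVolume dz) ≤ J.law.real {u | dist u.2.2 a ≤ r} := by
  have h0 := unitBallVolume_pos dz
  have hle : ∀ z ∈ Metric.closedBall a r, J.margZ a - ℓ * r ≤ J.margZ z := fun z hz => by
    have h1 := hℓ.dist_le_mul z a
    rw [Real.dist_eq, abs_le] at h1
    have h2 : (ℓ : ℝ) * dist z a ≤ ℓ * r := mul_le_mul_of_nonneg_left hz ℓ.2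
    linarith [h1.1]
  rw [measureReal_def, ← ENNReal.ofReal_le_iff_le_toReal (measure_ne_top _ _), law_near_eq,
    ENNReal.ofReal_mul' (by positivity), ← volume_closedBall_eq a hr, ← setLIntegral_const]
  exact setLIntegral_mono' measurableSet_closedBall fun z hz => ENNReal.ofReal_le_ofReal (hle z hz)

/-- A Lipschitz probability density is bounded, since a unit ball has mass at most one. -/
lemma margZ_le (hℓ : LipschitzWith ℓ J.margZ) (a : Eu dz) :
    J.margZ a ≤ ℓ + 1 / unitBallVolume dz := by
  have h := (le_law_real_near hℓ a zero_le_one).trans measureReal_le_one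
  rw [one_pow, one_mul, mul_one, ← le_div_iff₀ (unitBallVolume_pos dz)] at h
  linarith

lemma law_real_near_le (hℓ : LipschitzWith ℓ J.margZ) (a : Eu dz) {r : ℝ} (hr : 0 ≤ r) :
    J.law.real {u | dist u.2.2 a ≤ r} ≤
      (ℓ + 1 / unitBallVolume dz) * (r ^ dz * unitBallVolume dz) := by
  have h0 := unitBallVolume_pos dz
  refine ENNReal.toReal_le_of_le_ofReal (by positivity) ?_
  rw [law_near_eq, ENNReal.ofReal_mul (by positivity), ← volume_closedBall_eq a hr,
    ← setLIntegral_const]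
  exact setLIntegral_mono' measurableSet_closedBall fun z _ =>
    ENNReal.ofReal_le_ofReal (margZ_le hℓ z)

end JointDensity

/-! ### Uniform deviation of the empirical risk -/

section Outcome

lemma prod_le_of_left_sections {α β : Type*} [MeasurableSpace α] [MeasurableSpace β]
    {μ : Measure α} {ν : Measure β} [SFinite μ] [IsProbabilityMeasure ν] {E : Set (α × β)}
    (hE : MeasurableSet E) {p : ℝ≥0∞} (h : ∀ b, μ {a | (a, b) ∈ E} ≤ p) : μ.prod ν E ≤ p := by
  rw [Measure.prod_apply_symm hE]
  exact (lintegral_mono h).trans (by simp)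

lemma prod_le_of_right_sections {α β : Type*} [MeasurableSpace α] [MeasurableSpace β]
    {μ : Measure α} {ν : Measure β} [IsProbabilityMeasure μ] [SFinite ν] {E : Set (α × β)}
    (hE : MeasurableSet E) {p : ℝ≥0∞} (h : ∀ a, ν {b | (a, b) ∈ E} ≤ p) : μ.prod ν E ≤ p := by
  rw [Measure.prod_apply hE]
  exact (lintegral_mono h).trans (by simp)

lemma sum_eq_sum_indicator {n : ℕ} (A : Finset (Fin n)) (f : Fin n → ℝ) :
    ∑ i ∈ A, f i = ∑ i, (if i ∈ A then 1 else 0) * f i := by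
  simp

variable {dx dy dz n : ℕ} (J : JointDensity dx dy dz)

instance : IsProbabilityMeasure (J.lawOutcome n) := by
  unfold JointDensity.lawOutcome
  infer_instance

lemma lawOutcome_preimage_bootstrapData_le (E : Set (Fin n → Sample dx dy dz)) :
    J.lawOutcome n {ω | ω.2.2.1 ∈ E} ≤ (Measure.pi fun _ : Fin n => J.law) E := by
  have h : MeasurePreserving (fun ω : Outcome dx dy dz n => ω.2.2.1) (J.lawOutcome n)
      (Measure.pi fun _ : Fin n => J.law) :=
    measurePreserving_fst.comp (measurePreserving_snd.comp measurePreserving_snd)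
  rw [← h.map_eq]
  exact Measure.le_map_apply h.measurable.aemeasurable E

lemma lawOutcome_preimage_split_le (E : Set (Split n)) :
    J.lawOutcome n {ω | ω.2.2.2 ∈ E} ≤ ProbabilityTheory.uniformOn Set.univ E := by
  have h : MeasurePreserving (fun ω : Outcome dx dy dz n => ω.2.2.2) (J.lawOutcome n)
      (ProbabilityTheory.uniformOn Set.univ) :=
    measurePreserving_snd.comp (measurePreserving_snd.comp measurePreserving_snd)
  rw [← h.map_eq]
  exact Measure.le_map_apply h.measurable.aemeasurable E

variable [NeZero n]

instance : IsProbabilityMeasure (J.lawBoot n) :=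
  Measure.isProbabilityMeasure_map measurable_bootstrap.aemeasurable

lemma integral_lawBoot {l : Bool → ℝ} {g : Sample dx dy dz → Bool} (hg : Measurable g) :
    ∫ u, l (g u) ∂(J.lawBoot n) =
      ∫ v, bootRisk J.law l g v ∂(Measure.pi fun _ : Fin n => J.law) := by
  have hlg : Measurable fun u => l (g u) := (measurable_of_finite l).comp hg
  have hint : Integrable (fun p : Sample dx dy dz × (Fin n → Sample dx dy dz) =>
      l (g (bootstrap p.1 p.2))) (J.law.prod (Measure.pi fun _ : Fin n => J.law)) :=
    Integrable.of_bound (measurable_loss_bootstrap l hg).aestronglyMeasurable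
      (max |l true| |l false|) (ae_of_all _ fun p => by
        rw [Real.norm_eq_abs]
        cases g (bootstrap p.1 p.2) <;> simp)
  rw [JointDensity.lawBoot, integral_map measurable_bootstrap.aemeasurable
    hlg.aestronglyMeasurable, integral_prod_symm _ hint]
  rfl

lemma risk_lawLabelled (L : Bool → Bool → ℝ) {g : Sample dx dy dz → Bool} (hg : Measurable g) :
    risk L (J.lawLabelled n) g = 1 / 2 * ∫ u, L (g u) true ∂J.law +
      1 / 2 * ∫ u, L (g u) false ∂(J.lawBoot n) := by
  have hm : Measurable fun p : Sample dx dy dz × Bool => L (g p.1) p.2 :=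
    (measurable_of_finite fun q : Bool × Bool => L q.1 q.2).comp
      ((hg.comp measurable_fst).prodMk measurable_snd)
  have hbd : ∃ C, ∀ p : Sample dx dy dz × Bool, ‖L (g p.1) p.2‖ ≤ C := by
    refine ⟨|L true true| + |L true false| + |L false true| + |L false false|, fun p => ?_⟩
    rw [Real.norm_eq_abs]
    have h1 := abs_nonneg (L true true)
    have h2 := abs_nonneg (L true false)
    have h3 := abs_nonneg (L false true)
    have h4 := abs_nonneg (L false false)
    cases g p.1 <;> cases p.2 <;> linarith
  obtain ⟨C, hC⟩ := hbd
  have h1 : Measurable fun u : Sample dx dy dz => (u, true) := by fun_prop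
  have h2 : Measurable fun u : Sample dx dy dz => (u, false) := by fun_prop
  have hi : ∀ μ : Measure (Sample dx dy dz × Bool), IsFiniteMeasure μ →
      Integrable (fun p => L (g p.1) p.2) μ := fun μ _ =>
    Integrable.of_bound hm.aestronglyMeasurable C (ae_of_all _ hC)
  have i1 := (hi (J.law.map fun u => (u, true)) inferInstance).smul_measure
    (c := (1 / 2 : ℝ≥0∞)) (by simp)
  have i2 := (hi ((J.lawBoot n).map fun u => (u, false)) inferInstance).smul_measure
    (c := (1 / 2 : ℝ≥0∞)) (by simp)
  rw [risk, JointDensity.lawLabelled, integral_add_measure i1 i2, integral_smul_measure,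
    integral_smul_measure, integral_map h1.aemeasurable hm.aestronglyMeasurable,
    integral_map h2.aemeasurable hm.aestronglyMeasurable]
  simp

lemma empRisk_eq (L : Bool → Bool → ℝ) (ω : Outcome dx dy dz n) (g : Sample dx dy dz → Bool) :
    empRisk L ω g = 1 / n * ∑ i ∈ ω.2.2.2.1.toLeft, L (g (ω.1 i)) true +
      1 / n * ∑ i ∈ ω.2.2.2.1.toRight, L (g (bootstrap (ω.2.1 i) ω.2.2.1)) false := by
  rw [empRisk, Finset.sum_sum_eq_sum_toLeft_add_sum_toRight, mul_add]
  rfl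

variable {ι : Type*} [Countable ι] {𝒢 : Set (Sample dx dy dz → Bool)} {V : ℕ}
  {e : ι → Sample dx dy dz → Bool} {l : Bool → ℝ} {B τ X : ℝ} {m : ℕ}

/-- Uniform deviations of the part of the empirical risk with label `1`. -/
lemma lawOutcome_label_one_le (hV : vcDim 𝒢 ≤ V) (he : ∀ a, e a ∈ 𝒢) (hm : ∀ a, Measurable (e a))
    (hl : ∀ b, |l b| ≤ B) (hB0 : 0 < B) (hτ : 0 ≤ τ)
    (hmτ : (((m + 1) ^ V + 1 : ℕ) : ℝ) ^ 2 * Real.exp (-(m * τ)) < 1) (hX : 0 ≤ X) :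
    J.lawOutcome n {ω | ∃ θ, 2 * (4 * B * τ) + 2 * B / n * √(2 * n * X) ≤
        1 / n * ∑ i ∈ ω.2.2.2.1.toLeft, l (e θ (ω.1 i)) -
          ω.2.2.2.1.toLeft.card / n * ∫ u, l (e θ u) ∂J.law} ≤
      ENNReal.ofReal ((m + 1) ^ V * Real.exp (-X)) := by
  refine prod_le_of_left_sections ?_ fun b => measure_exists_iid_deviation_le J.law
    (Nat.pos_of_neZero n) hV e he hm hl hB0 b.2.2.1.toLeft hτ hmτ hX
  rw [Set.ofPred_exists]
  refine MeasurableSet.iUnion fun θ => measurableSet_le measurable_const (Measurable.sub ?_ ?_)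
  · have h : (fun ω : Outcome dx dy dz n => 1 / (n : ℝ) * ∑ i ∈ ω.2.2.2.1.toLeft, l (e θ (ω.1 i))) =
        fun ω => 1 / (n : ℝ) * ∑ i, (if i ∈ ω.2.2.2.1.toLeft then 1 else 0) * l (e θ (ω.1 i)) := by
      funext ω
      rw [sum_eq_sum_indicator]
    rw [h]
    refine (Finset.measurable_sum _ fun i _ => Measurable.mul ?_ ?_).const_mul _
    · exact (measurable_from_top (f := fun S : Split n =>
        (if i ∈ S.1.toLeft then 1 else 0 : ℝ))).comp (by fun_prop)
    · exact (measurable_of_finite l).comp ((hm θ).comp (by fun_prop))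
  · exact ((measurable_from_top (f := fun S : Split n => (S.1.toLeft.card : ℝ) / n)).comp
      (by fun_prop)).mul_const _

/-- Uniform deviations of the part of the empirical risk with label `0`, given the data-set that
supplies the nearest neighbours. -/
lemma lawOutcome_label_zero_le (hV : vcDim 𝒢 ≤ V) (he : ∀ a, e a ∈ 𝒢) (hm : ∀ a, Measurable (e a))
    (hl : ∀ b, |l b| ≤ B) (hB0 : 0 < B) (hτ : 0 ≤ τ)
    (hmτ : (((m + 1) ^ V + 1 : ℕ) : ℝ) ^ 2 * Real.exp (-(m * τ)) < 1) (hX : 0 ≤ X) :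
    J.lawOutcome n {ω | ∃ θ, 2 * (4 * B * τ) + 2 * B / n * √(2 * n * X) ≤
        1 / n * ∑ i ∈ ω.2.2.2.1.toRight, l (e θ (bootstrap (ω.2.1 i) ω.2.2.1)) -
          ω.2.2.2.1.toRight.card / n * bootRisk J.law l (e θ) ω.2.2.1} ≤
      ENNReal.ofReal ((m + 1) ^ V * Real.exp (-X)) := by
  have hE : MeasurableSet {ω : Outcome dx dy dz n |
      ∃ θ, 2 * (4 * B * τ) + 2 * B / n * √(2 * n * X) ≤
        1 / n * ∑ i ∈ ω.2.2.2.1.toRight, l (e θ (bootstrap (ω.2.1 i) ω.2.2.1)) -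
          ω.2.2.2.1.toRight.card / n * bootRisk J.law l (e θ) ω.2.2.1} := by
    rw [Set.ofPred_exists]
    refine MeasurableSet.iUnion fun θ => measurableSet_le measurable_const (Measurable.sub ?_ ?_)
    · have h : (fun ω : Outcome dx dy dz n =>
          1 / (n : ℝ) * ∑ i ∈ ω.2.2.2.1.toRight, l (e θ (bootstrap (ω.2.1 i) ω.2.2.1))) =
          fun ω => 1 / (n : ℝ) * ∑ i, (if i ∈ ω.2.2.2.1.toRight then 1 else 0) *
            l (e θ (bootstrap (ω.2.1 i) ω.2.2.1)) := by
        funext ω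
        rw [sum_eq_sum_indicator]
      rw [h]
      refine (Finset.measurable_sum _ fun i _ => Measurable.mul ?_ ?_).const_mul _
      · exact (measurable_from_top (f := fun S : Split n =>
          (if i ∈ S.1.toRight then 1 else 0 : ℝ))).comp (by fun_prop)
      · exact (measurable_loss_bootstrap l (hm θ)).comp
          (by fun_prop : Measurable fun ω : Outcome dx dy dz n => (ω.2.1 i, ω.2.2.1))
    · exact ((measurable_from_top (f := fun S : Split n => (S.1.toRight.card : ℝ) / n)).comp
        (by fun_prop)).mul ((measurable_bootRisk l (hm θ)).comp (by fun_prop))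
  refine prod_le_of_right_sections hE fun u₁ => ?_
  refine prod_le_of_left_sections (hE.preimage measurable_prodMk_left) fun b => ?_
  have hb : Measurable fun u => bootstrap u b.1 :=
    measurable_bootstrap.comp (measurable_id.prodMk measurable_const)
  have hP : IsProbabilityMeasure (J.law.map fun u => bootstrap u b.1) :=
    Measure.isProbabilityMeasure_map hb.aemeasurable
  have hmp := measurePreserving_pi (fun _ : Fin n => J.law)
    (fun _ : Fin n => J.law.map fun u => bootstrap u b.1) (f := fun _ u => bootstrap u b.1)
    fun _ => hb.measurePreserving _
  have h := measure_exists_iid_deviation_le (J.law.map fun u => bootstrap u b.1)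
    (Nat.pos_of_neZero n) hV e he hm hl hB0 b.2.1.toRight hτ hmτ hX
  rw [← hmp.map_eq] at h
  refine le_trans ?_ ((Measure.le_map_apply hmp.measurable.aemeasurable _).trans h)
  refine measure_mono fun u₂ ⟨θ, hθ⟩ => ⟨θ, ?_⟩
  have hmap : ∫ u, l (e θ u) ∂(J.law.map fun u => bootstrap u b.1) = bootRisk J.law l (e θ) b.1 :=
    integral_map hb.aemeasurable ((measurable_of_finite l).comp (hm θ)).aestronglyMeasurable
  rw [hmap]
  exact hθ

/-- The error decomposition. `S₁`, `S₀` are the sums of losses over the `a` and `b` training samples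
with label `1` and `0`, `R` is the risk under `f`, `Φ` the conditional risk of a bootstrapped sample
given the data-set of neighbours, `T` its truncation, `H` the mass of the points without a near
neighbour, and a prefix `E` marks means. -/
lemma abs_risk_decomposition_le {n B a b S₁ S₀ R Φ EΦ T ET D₁ D₃ G H EH q y Z : ℝ}
    (hn : 0 < n) (hB : 0 ≤ B) (hab : a + b = n) (ha : 0 ≤ a) (hb : 0 ≤ b)
    (h1 : |1 / n * S₁ - a / n * R| ≤ D₁) (h2 : |1 / n * S₀ - b / n * Φ| ≤ D₁)
    (h3 : |T - ET| ≤ D₃) (hR : |R| ≤ B) (hEΦ : |EΦ| ≤ B) (hΦ : |Φ - T| ≤ B * (G + H))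
    (hE : |EΦ - ET| ≤ B * (G + EH)) (h4 : H ≤ EH + y) (hEH : EH ≤ q) (h5 : |a - b| ≤ Z) :
    |1 / n * S₁ + 1 / n * S₀ - (1 / 2 * R + 1 / 2 * EΦ)| ≤
      2 * D₁ + D₃ + B * (2 * G + y + 2 * q) + B * (Z / n) := by
  -- the last summand comes from the imbalance of the two labels in the training set
  have e1 : 1 / n * S₁ + 1 / n * S₀ - (1 / 2 * R + 1 / 2 * EΦ) =
      (1 / n * S₁ - a / n * R) + (1 / n * S₀ - b / n * Φ) +
        b / n * ((Φ - T) + (T - ET) - (EΦ - ET)) + (a - b) / (2 * n) * (R - EΦ) := by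
    have : b = n - a := by linarith
    subst this
    field_simp
    ring
  have hbn : b / n ≤ 1 := by rw [div_le_one hn]; linarith
  have hbn0 : 0 ≤ b / n := by positivity
  have h6 : |(Φ - T) + (T - ET) - (EΦ - ET)| ≤ D₃ + B * (2 * G + y + 2 * q) := by
    have := mul_le_mul_of_nonneg_left (show 2 * G + H + EH ≤ 2 * G + y + 2 * q by linarith) hB
    rw [abs_le] at h3 hΦ hE ⊢
    constructor <;> linarith [h3.1, h3.2, hΦ.1, hΦ.2, hE.1, hE.2]
  have h7 : |b / n * ((Φ - T) + (T - ET) - (EΦ - ET))| ≤ D₃ + B * (2 * G + y + 2 * q) := by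
    rw [abs_mul, abs_of_nonneg hbn0]
    exact (mul_le_of_le_one_left (abs_nonneg _) hbn).trans h6
  have h8 : |(a - b) / (2 * n) * (R - EΦ)| ≤ B * (Z / n) := by
    have hZ : 0 ≤ Z := (abs_nonneg _).trans h5
    have h9 : |R - EΦ| ≤ 2 * B := (abs_sub _ _).trans (by linarith)
    rw [abs_mul, abs_div, abs_of_pos (by positivity : 0 < 2 * n)]
    calc |a - b| / (2 * n) * |R - EΦ| ≤ Z / (2 * n) * (2 * B) := by gcongr
      _ = B * (Z / n) := by field_simp
  rw [e1]
  refine (abs_add_le _ _).trans ?_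
  linarith [abs_add_le (1 / n * S₁ - a / n * R + (1 / n * S₀ - b / n * Φ))
    (b / n * ((Φ - T) + (T - ET) - (EΦ - ET))),
    abs_add_le (1 / n * S₁ - a / n * R) (1 / n * S₀ - b / n * Φ)]

/-- The uniform deviation of the empirical risk from the risk, over a countable class. The set `K`
should hold most of the mass, and `z`-balls of radius `r` should have mass at most `κ`, and at
least `p` if their centre is in `K`. -/
theorem lawOutcome_deviation_le (hV : vcDim 𝒢 ≤ V) (he : ∀ a, e a ∈ 𝒢)
    (hm : ∀ a, Measurable (e a)) {L : Bool → Bool → ℝ}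
    (hL : ∀ a b, |L a b| ≤ B) (hB0 : 0 < B) (hτ : 0 ≤ τ)
    (hmτ : (((m + 1) ^ V + 1 : ℕ) : ℝ) ^ 2 * Real.exp (-(m * τ)) < 1) (hX : 0 ≤ X)
    {K : Set (Eu dz)} (hK : MeasurableSet K) {r κ p : ℝ} (hκ0 : 0 < κ)
    (hκ : ∀ a : Eu dz, J.law.real {u | dist u.2.2 a ≤ r} ≤ κ)
    (hp : ∀ z ∈ K, p ≤ J.law.real {u | dist z u.2.2 ≤ r}) :
    J.lawOutcome n {ω | ¬ ∀ θ, |empRisk L ω (e θ) - risk L (J.lawLabelled n) (e θ)| ≤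
        2 * (2 * (4 * B * τ) + 2 * B / n * √(2 * n * X)) +
        (2 * (4 * B * n * τ) + 4 * B * κ * √(2 * n * X)) +
        B * (2 * J.law.real {u | u.2.2 ∉ K} + 2 * κ * √(2 * n * X) + 2 * Real.exp (-(n * p))) +
        B * (√(n * X) / n)} ≤
      ENNReal.ofReal ((6 * (m + 1) ^ V + 1 + 4 * n) * Real.exp (-X)) := by
  set D₁ := 2 * (4 * B * τ) + 2 * B / n * √(2 * n * X) with hD₁
  set D₃ := 2 * (4 * B * n * τ) + 4 * B * κ * √(2 * n * X) with hD₃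
  have hn : (0 : ℝ) < n := by exact_mod_cast Nat.pos_of_neZero n
  set π : Measure (Fin n → Sample dx dy dz) := Measure.pi fun _ => J.law with hπ
  have hl : ∀ b c, |L c b| ≤ B := fun b c => hL c b
  have hl' : ∀ b c, |-L c b| ≤ B := fun b c => by rw [abs_neg]; exact hL c b
  set E₁ : (Bool → ℝ) → Set (Outcome dx dy dz n) := fun l => {ω | ∃ θ, D₁ ≤
        1 / n * ∑ i ∈ ω.2.2.2.1.toLeft, l (e θ (ω.1 i)) -
          ω.2.2.2.1.toLeft.card / n * ∫ u, l (e θ u) ∂J.law} with hE₁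
  set E₂ : (Bool → ℝ) → Set (Outcome dx dy dz n) := fun l => {ω | ∃ θ, D₁ ≤
        1 / n * ∑ i ∈ ω.2.2.2.1.toRight, l (e θ (bootstrap (ω.2.1 i) ω.2.2.1)) -
          ω.2.2.2.1.toRight.card / n * bootRisk J.law l (e θ) ω.2.2.1} with hE₂
  set E₃ : (Bool → ℝ) → Set (Outcome dx dy dz n) := fun l => {ω | ∃ θ, D₃ ≤
        truncRisk J.law l K r (e θ) ω.2.2.1 - ∫ v, truncRisk J.law l K r (e θ) v ∂π} with hE₃
  set E₄ : Set (Outcome dx dy dz n) := {ω | 2 * κ * √(2 * n * X) ≤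
        J.law.real (farSet K r ω.2.2.1) - ∫ v, J.law.real (farSet K r v) ∂π} with hE₄
  set E₅ : Set (Outcome dx dy dz n) := {ω | √(n * X) ≤
        |(ω.2.2.2.1.toLeft.card : ℝ) - ω.2.2.2.1.toRight.card|} with hE₅
  have b₁ : ∀ l : Bool → ℝ, (∀ b, |l b| ≤ B) → J.lawOutcome n (E₁ l) ≤
      ENNReal.ofReal ((m + 1) ^ V * Real.exp (-X)) := fun l hl =>
    lawOutcome_label_one_le J hV he hm hl hB0 hτ hmτ hX
  have b₂ : ∀ l : Bool → ℝ, (∀ b, |l b| ≤ B) → J.lawOutcome n (E₂ l) ≤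
      ENNReal.ofReal ((m + 1) ^ V * Real.exp (-X)) := fun l hl =>
    lawOutcome_label_zero_le J hV he hm hl hB0 hτ hmτ hX
  have b₃ : ∀ l : Bool → ℝ, (∀ b, |l b| ≤ B) → J.lawOutcome n (E₃ l) ≤
      ENNReal.ofReal ((m + 1) ^ V * Real.exp (-X)) := fun l hl =>
    (lawOutcome_preimage_bootstrapData_le J {v | ∃ θ, D₃ ≤
      truncRisk J.law l K r (e θ) v - ∫ v, truncRisk J.law l K r (e θ) v ∂π}).trans
    (measure_exists_truncRisk_deviation_le hV e he hm hl hB0 hK hκ0 hκ hτ hmτ hX)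
  have b₄ : J.lawOutcome n E₄ ≤ ENNReal.ofReal (Real.exp (-X)) :=
    (lawOutcome_preimage_bootstrapData_le J {v | 2 * κ * √(2 * n * X) ≤
        J.law.real (farSet K r v) - ∫ v, J.law.real (farSet K r v) ∂π}).trans
    (measure_farMass_deviation_le hK hκ0 hκ hX)
  have b₅ : J.lawOutcome n E₅ ≤ ENNReal.ofReal (4 * n * Real.exp (-X)) :=
    (lawOutcome_preimage_split_le J {T | √(n * X) ≤
        |(T.1.toLeft.card : ℝ) - T.1.toRight.card|}).trans
    (uniformOn_split_deviation_le (Nat.pos_of_neZero n) hX)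
  set l₁ : Bool → ℝ := fun a => L a true with hl₁
  set l₀ : Bool → ℝ := fun a => L a false with hl₀
  have hsub : {ω | ¬ ∀ θ, |empRisk L ω (e θ) - risk L (J.lawLabelled n) (e θ)| ≤
      2 * D₁ + D₃ + B * (2 * J.law.real {u | u.2.2 ∉ K} + 2 * κ * √(2 * n * X) +
        2 * Real.exp (-(n * p))) + B * (√(n * X) / n)} ⊆
      ((E₁ l₁ ∪ E₁ fun a => -l₁ a) ∪ (E₂ l₀ ∪ E₂ fun a => -l₀ a)) ∪
        ((E₃ l₀ ∪ E₃ fun a => -l₀ a) ∪ (E₄ ∪ E₅)) := by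
    refine fun ω hω => ?_
    contrapose hω
    simp only [Set.mem_union, not_or] at hω
    obtain ⟨⟨⟨h1, h1'⟩, h2, h2'⟩, ⟨h3, h3'⟩, h4, h5⟩ := hω
    simp only [hE₁, hE₂, hE₃, hE₄, hE₅, Set.mem_ofPred_eq, not_exists, not_le] at h1 h1' h2 h2' h3 h3' h4 h5
    simp only [Set.mem_ofPred_eq, not_not]
    intro θ
    have h1 := h1 θ
    have h1' := h1' θ
    have h2 := h2 θ
    have h2' := h2' θ
    have h3 := h3 θ
    have h3' := h3' θ
    have hnb : ∀ v : Fin n → Sample dx dy dz,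
        bootRisk J.law (fun a => -l₀ a) (e θ) v = -bootRisk J.law l₀ (e θ) v := fun v =>
      integral_neg _
    have hnt : ∀ v : Fin n → Sample dx dy dz,
        truncRisk J.law (fun a => -l₀ a) K r (e θ) v = -truncRisk J.law l₀ K r (e θ) v := fun v => by
      rw [truncRisk, truncRisk, ← integral_neg]
      refine integral_congr_ae (ae_of_all _ fun u => ?_)
      exact congrFun (Set.indicator_neg (nearSet K r v) fun u => l₀ (e θ (bootstrap u v))) u
    simp only [hnb, hnt, Finset.sum_neg_distrib, integral_neg] at h1' h2' h3'
    rw [empRisk_eq, risk_lawLabelled J L (hm θ),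
      integral_lawBoot (l := l₀) J (hm θ)]
    have hB : 0 ≤ B := hB0.le
    have hab := Finset.card_toLeft_add_card_toRight (u := ω.2.2.2.1)
    rw [ω.2.2.2.2] at hab
    have hab' : (ω.2.2.2.1.toLeft.card : ℝ) + ω.2.2.2.1.toRight.card = n := by exact_mod_cast hab
    have iΦ : Integrable (bootRisk J.law l₀ (e θ)) π :=
      Integrable.of_bound (measurable_bootRisk l₀ (hm θ)).aestronglyMeasurable B
        (ae_of_all _ fun v => abs_bootRisk_le (hl _) v)
    have iT : Integrable (truncRisk J.law l₀ K r (e θ)) π :=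
      Integrable.of_bound (measurable_truncRisk l₀ hK (hm θ)).aestronglyMeasurable B
        (ae_of_all _ fun v => abs_truncRisk_le (hl _) v)
    have iH : Integrable (fun v : Fin n → Sample dx dy dz => J.law.real (farSet K r v)) π :=
      Integrable.of_bound (measurable_farMass hK).aestronglyMeasurable 1
        (ae_of_all _ fun v => by
          rw [Real.norm_eq_abs, abs_of_nonneg measureReal_nonneg]; exact measureReal_le_one)
    have hEH : ∫ v, J.law.real (farSet K r v) ∂π ≤ Real.exp (-(n * p)) :=
      integral_farMass_le hK hp
    have hΦT : ∀ v : Fin n → Sample dx dy dz, _ :=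
      fun v => abs_bootRisk_sub_truncRisk_le (ρ := J.law) (r := r) (hl false) hK (hm θ) v
    have hE : |∫ v, bootRisk J.law l₀ (e θ) v ∂π - ∫ v, truncRisk J.law l₀ K r (e θ) v ∂π| ≤
        B * (J.law.real {u | u.2.2 ∉ K} + ∫ v, J.law.real (farSet K r v) ∂π) := by
      rw [← integral_sub iΦ iT]
      refine abs_integral_le_integral_abs.trans ((integral_mono (iΦ.sub iT).abs
        (((integrable_const _).add iH).const_mul B) hΦT).trans_eq ?_)
      rw [integral_const_mul, integral_add' (integrable_const _) iH]
      simp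
    have hΦ := hΦT ω.2.2.1
    have hEΦ : |∫ v, bootRisk J.law l₀ (e θ) v ∂π| ≤ B := by
      have := norm_integral_le_of_norm_le_const (μ := π) (C := B) (ae_of_all _ fun v =>
        (Real.norm_eq_abs _).trans_le (abs_bootRisk_le (ρ := J.law) (g := e θ) (hl false) v))
      simpa using this
    have hR : |∫ u, l₁ (e θ u) ∂J.law| ≤ B := by
      have := norm_integral_le_of_norm_le_const (μ := J.law) (C := B) (ae_of_all _ fun u =>
        (Real.norm_eq_abs _).trans_le (hl true (e θ u)))
      simpa using this
    change 2 * κ * √(2 * n * X) > _ at h4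
    exact abs_risk_decomposition_le hn hB hab' (Nat.cast_nonneg _) (Nat.cast_nonneg _)
      (abs_le.2 ⟨by linarith, by linarith⟩)
      (abs_le.2 ⟨by linarith, by linarith⟩) (abs_le.2 ⟨by linarith, by linarith⟩) hR hEΦ hΦ hE
      (by linarith) hEH h5.le
  refine (measure_mono hsub).trans ?_
  have hun : ∀ {E F : Set (Outcome dx dy dz n)} {a b : ℝ}, J.lawOutcome n E ≤ ENNReal.ofReal a →
      J.lawOutcome n F ≤ ENNReal.ofReal b → 0 ≤ a → 0 ≤ b →
      J.lawOutcome n (E ∪ F) ≤ ENNReal.ofReal (a + b) := fun hE hF ha hb =>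
    (measure_union_le _ _).trans ((add_le_add hE hF).trans_eq (ENNReal.ofReal_add ha hb).symm)
  refine (hun (hun (hun (b₁ _ (hl _)) (b₁ _ (hl' _)) ?_ ?_) (hun (b₂ _ (hl _)) (b₂ _ (hl' _)) ?_ ?_)
    ?_ ?_) (hun (hun (b₃ _ (hl _)) (b₃ _ (hl' _)) ?_ ?_) (hun b₄ b₅ ?_ ?_) ?_ ?_) ?_ ?_).trans_eq ?_
  any_goals positivity
  congr 1
  ring

end Outcome

/-! ### Empirical risk minimizers -/

section ERM

variable {dx dy dz n : ℕ} [NeZero n] {L : Bool → Bool → ℝ} {B : ℝ}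
  {𝒢 : Set (Sample dx dy dz → Bool)}

instance (J : JointDensity dx dy dz) : IsProbabilityMeasure (J.lawLabelled n) := by
  have h1 : IsProbabilityMeasure (J.law.map fun u : Sample dx dy dz => (u, true)) :=
    Measure.isProbabilityMeasure_map (by fun_prop)
  have h2 : IsProbabilityMeasure ((J.lawBoot n).map fun u : Sample dx dy dz => (u, false)) :=
    Measure.isProbabilityMeasure_map (by fun_prop)
  constructor
  simp [JointDensity.lawLabelled, ENNReal.inv_two_add_inv_two]

lemma abs_risk_le (hL : ∀ a b, |L a b| ≤ B) {U : Type*} [MeasurableSpace U] (q : Measure (U × Bool))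
    [IsProbabilityMeasure q] (g : U → Bool) : |risk L q g| ≤ B := by
  have := norm_integral_le_of_norm_le_const (μ := q) (C := B) (ae_of_all _ fun p =>
    (Real.norm_eq_abs _).trans_le (hL (g p.1) p.2))
  simpa [risk] using this

lemma risk_sub_iInf_le (hL : ∀ a b, |L a b| ≤ B) {U : Type*} [MeasurableSpace U]
    (q : Measure (U × Bool)) [IsProbabilityMeasure q] {𝒢 : Set (U → Bool)} {g : U → Bool}
    (hg : g ∈ 𝒢) : risk L q g - (⨅ g' : 𝒢, risk L q g') ≤ 2 * B := by
  have : Nonempty 𝒢 := ⟨⟨g, hg⟩⟩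
  have h1 : -B ≤ ⨅ g' : 𝒢, risk L q g' := le_ciInf fun g' => (abs_le.1 (abs_risk_le hL q g')).1
  linarith [(abs_le.1 (abs_risk_le hL q g)).2]

/-- A class of VC dimension zero has at most one member. -/
lemma risk_eq_iInf_of_vcDim_eq_zero {U : Type*} [MeasurableSpace U] (q : Measure (U × Bool))
    {𝒢 : Set (U → Bool)} (hV : vcDim 𝒢 = 0) {g : U → Bool} (hg : g ∈ 𝒢) :
    risk L q g = ⨅ g' : 𝒢, risk L q g' := by
  have heq : ∀ g' ∈ 𝒢, g' = g := fun g' hg' => by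
    funext u
    by_contra hne
    have hsh : Shatters 𝒢 {u} := fun A hA => by
      by_cases hu : u ∈ A
      · by_cases h : g u = true
        · exact ⟨g, hg, fun x hx => by rw [Finset.mem_singleton.1 hx]; simp [h, hu]⟩
        · refine ⟨g', hg', fun x hx => ?_⟩
          rw [Finset.mem_singleton.1 hx]
          cases h1 : g u <;> cases h2 : g' u <;> simp_all
      · by_cases h : g u = true
        · refine ⟨g', hg', fun x hx => ?_⟩
          rw [Finset.mem_singleton.1 hx]
          cases h1 : g u <;> cases h2 : g' u <;> simp_all
        · exact ⟨g, hg, fun x hx => by rw [Finset.mem_singleton.1 hx]; simp [h, hu]⟩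
    have := hsh.card_le (V := 0) (by rw [hV]; simp)
    simp at this
  have hr : ∀ g' : 𝒢, risk L q g' = risk L q g := fun g' => by rw [heq g' g'.2]
  have : Nonempty 𝒢 := ⟨⟨g, hg⟩⟩
  simp_rw [hr, ciInf_const]

/-- A uniform deviation bound extends from a countable subclass to its pointwise limits. -/
lemma abs_empRisk_sub_risk_le_of_limit (hL : ∀ a b, |L a b| ≤ B) (J : JointDensity dx dy dz)
    (ω : Outcome dx dy dz n) {D : ℝ} {s : ℕ → Sample dx dy dz → Bool}
    (hs : ∀ k, |empRisk L ω (s k) - risk L (J.lawLabelled n) (s k)| ≤ D)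
    (hsm : ∀ k, Measurable (s k)) {g : Sample dx dy dz → Bool}
    (hsg : ∀ u, ∀ᶠ k in atTop, s k u = g u) :
    |empRisk L ω g - risk L (J.lawLabelled n) g| ≤ D := by
  have h1 : Tendsto (fun k => empRisk L ω (s k)) atTop (𝓝 (empRisk L ω g)) := by
    refine Tendsto.const_mul _ (tendsto_finsetSum _ fun i _ => ?_)
    exact tendsto_const_nhds.congr' ((hsg (labelled ω i).1).mono fun k hk => by simp only [hk])
  have h2 : Tendsto (fun k => risk L (J.lawLabelled n) (s k)) atTop
      (𝓝 (risk L (J.lawLabelled n) g)) := by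
    refine tendsto_integral_of_dominated_convergence (fun _ => B) (fun k => ?_)
      (integrable_const _) (fun k => ae_of_all _ fun p => hL _ _) (ae_of_all _ fun p => ?_)
    · exact ((measurable_of_finite fun q : Bool × Bool => L q.1 q.2).comp
        (((hsm k).comp measurable_fst).prodMk measurable_snd)).aestronglyMeasurable
    · exact tendsto_const_nhds.congr' ((hsg p.1).mono fun k hk => by simp only [hk])
  exact le_of_tendsto (h1.sub h2).abs (Eventually.of_forall hs)

/-- The excess risk of an empirical risk minimizer is at most twice the uniform deviation. -/
lemma IsERM.risk_sub_iInf_le {ω : Outcome dx dy dz n} {g : Sample dx dy dz → Bool}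
    (hg : IsERM L 𝒢 ω g) {q : Measure (Sample dx dy dz × Bool)} {D : ℝ}
    (hD : ∀ g ∈ 𝒢, |empRisk L ω g - risk L q g| ≤ D) :
    risk L q g - (⨅ g' : 𝒢, risk L q g') ≤ 2 * D := by
  have : Nonempty 𝒢 := ⟨⟨g, hg.1⟩⟩
  have h : risk L q g - 2 * D ≤ ⨅ g' : 𝒢, risk L q g' := le_ciInf fun g' => by
    linarith [(abs_le.1 (hD g hg.1)).1, (abs_le.1 (hD g' g'.2)).2, hg.2 g' g'.2]
  linarith

variable {V : ℕ} {τ X : ℝ} {m : ℕ}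

/-- The excess risk of every empirical risk minimizer, in terms of the radius `r` of truncation and
the parameters of the covering. -/
theorem lawOutcome_erm_le (J : JointDensity dx dy dz) (h𝒢 : PointwiseMeasurable 𝒢)
    (hV : vcDim 𝒢 ≤ V)
    (hL : ∀ a b, |L a b| ≤ B) (hB0 : 0 < B) (hτ : 0 ≤ τ)
    (hmτ : (((m + 1) ^ V + 1 : ℕ) : ℝ) ^ 2 * Real.exp (-(m * τ)) < 1) (hX : 0 ≤ X)
    {K : Set (Eu dz)} (hK : MeasurableSet K) {r κ p : ℝ} (hκ0 : 0 < κ)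
    (hκ : ∀ a : Eu dz, J.law.real {u | dist u.2.2 a ≤ r} ≤ κ)
    (hp : ∀ z ∈ K, p ≤ J.law.real {u | dist z u.2.2 ≤ r}) {R : ℝ}
    (hR : 2 * (2 * (2 * (4 * B * τ) + 2 * B / n * √(2 * n * X)) +
        (2 * (4 * B * n * τ) + 4 * B * κ * √(2 * n * X)) +
        B * (2 * J.law.real {u | u.2.2 ∉ K} + 2 * κ * √(2 * n * X) + 2 * Real.exp (-(n * p))) +
        B * (√(n * X) / n)) ≤ R) :
    J.lawOutcome n {ω | ¬ ∀ g, IsERM L 𝒢 ω g →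
        risk L (J.lawLabelled n) g - (⨅ g' : 𝒢, risk L (J.lawLabelled n) g') ≤ R} ≤
      ENNReal.ofReal ((6 * (m + 1) ^ V + 1 + 4 * n) * Real.exp (-X)) := by
  obtain ⟨hmeas, 𝒢₀, h𝒢₀, hc, hlim⟩ := h𝒢
  have : Countable 𝒢₀ := hc.to_subtype
  refine (measure_mono fun ω hω => ?_).trans (lawOutcome_deviation_le J hV
    (e := fun θ : 𝒢₀ => θ.1) (fun θ => h𝒢₀ θ.2) (fun θ => hmeas _ (h𝒢₀ θ.2)) hL hB0 hτ hmτ hX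
    hK hκ0 hκ hp)
  refine fun hdev => hω fun g hg => (hg.risk_sub_iInf_le fun g hg => ?_).trans hR
  obtain ⟨s, hs, hsg⟩ := hlim g hg
  exact abs_empRisk_sub_risk_le_of_limit hL J ω (fun k => hdev ⟨s k, hs k⟩)
    (fun k => hmeas _ (h𝒢₀ (hs k))) hsg

end ERM

/-! ### Estimates for the rates -/

section Asymptotics

/-- The condition of `exists_cover_of_vcDim_le` for `τ = 1 / n ^ 2` and `m = n ^ 5`. -/
lemma covering_condition {n V : ℕ} (hn : 12 ≤ n) (hV : V ≤ n) :
    (((n ^ 5 + 1) ^ V + 1 : ℕ) : ℝ) ^ 2 * Real.exp (-((n ^ 5 : ℕ) * (1 / (n : ℝ) ^ 2))) < 1 := by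
  have hn0 : (0 : ℝ) < n := by positivity
  have h1 : (n ^ 5 + 1) ^ V + 1 ≤ n ^ (6 * n + 1) := by
    have h5 : n ^ 5 + 1 ≤ n ^ 6 := by
      have : 1 ≤ n ^ 5 := Nat.one_le_pow _ _ (by omega)
      calc n ^ 5 + 1 ≤ n ^ 5 * 2 := by omega
        _ ≤ n ^ 5 * n := by gcongr; omega
        _ = n ^ 6 := by ring
    have h6 : (n ^ 5 + 1) ^ V ≤ n ^ (6 * n) := by
      calc (n ^ 5 + 1) ^ V ≤ (n ^ 6) ^ V := by gcongr
        _ = n ^ (6 * V) := by rw [pow_mul]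
        _ ≤ n ^ (6 * n) := Nat.pow_le_pow_right (by omega) (by omega)
    have : 1 ≤ n ^ (6 * n) := Nat.one_le_pow _ _ (by omega)
    calc (n ^ 5 + 1) ^ V + 1 ≤ n ^ (6 * n) * 2 := by omega
      _ ≤ n ^ (6 * n) * n := by gcongr; omega
      _ = n ^ (6 * n + 1) := by ring
  have h2 : (((n ^ 5 + 1) ^ V + 1 : ℕ) : ℝ) ≤ (n : ℝ) ^ (6 * n + 1) := by exact_mod_cast h1
  have h3 : (n : ℝ) ≤ Real.exp (n - 1) := by linarith [Real.add_one_le_exp ((n : ℝ) - 1)]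
  have h4 : ((n ^ 5 : ℕ) : ℝ) * (1 / (n : ℝ) ^ 2) = (n : ℝ) ^ 3 := by
    push_cast; field_simp
  rw [h4]
  calc (((n ^ 5 + 1) ^ V + 1 : ℕ) : ℝ) ^ 2 * Real.exp (-(n : ℝ) ^ 3)
      ≤ (Real.exp (n - 1) ^ (6 * n + 1)) ^ 2 * Real.exp (-(n : ℝ) ^ 3) := by
        gcongr
        exact h2.trans (pow_le_pow_left₀ hn0.le h3 _)
    _ = Real.exp ((12 * n + 2) * (n - 1) - (n : ℝ) ^ 3) := by
        rw [← pow_mul, ← Real.exp_nat_mul, ← Real.exp_add]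
        congr 1
        push_cast
        ring
    _ < 1 := by
        rw [Real.exp_lt_one_iff]
        have : (12 : ℝ) ≤ n := by exact_mod_cast hn
        nlinarith [mul_nonneg (sq_nonneg (n : ℝ)) (by linarith : (0 : ℝ) ≤ n - 12)]

/-- All error terms are `o(n ^ (-1 / 3))`. The main one is the fluctuation of the truncated risk, which
is of order `n ^ (-5 / 12) √log n` when balls have mass about `n ^ (-11 / 12)`. -/
lemma eventually_remainder_le (M : ℝ) (hM : 0 ≤ M) {a : ℝ} (ha : 0 < a) :
    ∀ᶠ n : ℕ in atTop, 48 / (n : ℝ) + 4 * Real.exp (-(n * (a * (n : ℝ) ^ (-(11 / 12) : ℝ)))) +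
      6 * √(Real.log n) * (9 * (n : ℝ) ^ (-(1 / 2) : ℝ) + 12 * M * (n : ℝ) ^ (-(5 / 12) : ℝ)) ≤
      4 * (n : ℝ) ^ (-(1 / 3) : ℝ) := by
  have hcast : Tendsto (fun n : ℕ => (n : ℝ)) atTop atTop := tendsto_natCast_atTop_atTop
  have t1 : Tendsto (fun n : ℕ => 48 * (n : ℝ) ^ (-(2 / 3) : ℝ)) atTop (𝓝 (48 * 0)) :=
    ((tendsto_rpow_neg_atTop (by norm_num)).comp hcast).const_mul _
  have t2 : Tendsto (fun n : ℕ => 4 * (((n : ℝ) ^ (1 / 12 : ℝ)) ^ (4 : ℝ) *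
      Real.exp (-a * (n : ℝ) ^ (1 / 12 : ℝ)))) atTop (𝓝 (4 * 0)) :=
    ((tendsto_rpow_mul_exp_neg_mul_atTop_nhds_zero 4 a ha).comp
      ((tendsto_rpow_atTop (by norm_num)).comp hcast)).const_mul _
  have t3 : Tendsto (fun n : ℕ => 6 * √12 * (9 + 12 * M) * (n : ℝ) ^ (-(1 / 24) : ℝ)) atTop
      (𝓝 (6 * √12 * (9 + 12 * M) * 0)) :=
    ((tendsto_rpow_neg_atTop (by norm_num)).comp hcast).const_mul _
  have t := (t1.add t2).add t3
  simp only [mul_zero, add_zero] at t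
  filter_upwards [t.eventually_le_const (by norm_num : (0 : ℝ) < 4), eventually_ge_atTop 1]
    with n hn hn1
  have hn0 : (0 : ℝ) < n := by positivity
  have hn1' : (1 : ℝ) ≤ n := by exact_mod_cast hn1
  have e1 : 48 / (n : ℝ) = 48 * (n : ℝ) ^ (-(2 / 3) : ℝ) * (n : ℝ) ^ (-(1 / 3) : ℝ) := by
    rw [mul_assoc, ← Real.rpow_add hn0, div_eq_mul_inv, ← Real.rpow_neg_one]
    norm_num
  have e2 : 4 * Real.exp (-(n * (a * (n : ℝ) ^ (-(11 / 12) : ℝ)))) =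
      4 * (((n : ℝ) ^ (1 / 12 : ℝ)) ^ (4 : ℝ) * Real.exp (-a * (n : ℝ) ^ (1 / 12 : ℝ))) *
        (n : ℝ) ^ (-(1 / 3) : ℝ) := by
    have h1 : (n : ℝ) * (n : ℝ) ^ (-(11 / 12) : ℝ) = (n : ℝ) ^ (1 / 12 : ℝ) := by
      rw [← Real.rpow_one_add' hn0.le (by norm_num)]
      norm_num
    have h2 : ((n : ℝ) ^ (1 / 12 : ℝ)) ^ (4 : ℝ) * (n : ℝ) ^ (-(1 / 3) : ℝ) = 1 := by
      rw [← Real.rpow_mul hn0.le, ← Real.rpow_add hn0]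
      norm_num
    rw [show -((n : ℝ) * (a * (n : ℝ) ^ (-(11 / 12) : ℝ))) = -a * ((n : ℝ) * (n : ℝ) ^ (-(11 / 12) : ℝ)) by
      ring, h1]
    linear_combination (-4 * Real.exp (-a * (n : ℝ) ^ (1 / 12 : ℝ))) * h2
  have e3 : 6 * √(Real.log n) * (9 * (n : ℝ) ^ (-(1 / 2) : ℝ) + 12 * M * (n : ℝ) ^ (-(5 / 12) : ℝ)) ≤
      6 * √12 * (9 + 12 * M) * (n : ℝ) ^ (-(1 / 24) : ℝ) * (n : ℝ) ^ (-(1 / 3) : ℝ) := by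
    have h1 : √(Real.log n) ≤ √12 * (n : ℝ) ^ (1 / 24 : ℝ) := by
      have hsq : (n : ℝ) ^ (1 / 24 : ℝ) = √((n : ℝ) ^ (1 / 12 : ℝ)) := by
        rw [Real.sqrt_eq_rpow, ← Real.rpow_mul hn0.le]
        norm_num
      rw [hsq, ← Real.sqrt_mul (by norm_num)]
      refine Real.sqrt_le_sqrt ((Real.log_le_rpow_div hn0.le (by norm_num : (0 : ℝ) < 1 / 12)).trans_eq ?_)
      ring
    have h2 : (n : ℝ) ^ (-(1 / 2) : ℝ) ≤ (n : ℝ) ^ (-(5 / 12) : ℝ) :=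
      Real.rpow_le_rpow_of_exponent_le hn1' (by norm_num)
    have h3 : (n : ℝ) ^ (1 / 24 : ℝ) * (n : ℝ) ^ (-(5 / 12) : ℝ) =
        (n : ℝ) ^ (-(1 / 24) : ℝ) * (n : ℝ) ^ (-(1 / 3) : ℝ) := by
      rw [← Real.rpow_add hn0, ← Real.rpow_add hn0]
      norm_num
    calc _ ≤ 6 * (√12 * (n : ℝ) ^ (1 / 24 : ℝ)) * (9 * (n : ℝ) ^ (-(5 / 12) : ℝ) +
          12 * M * (n : ℝ) ^ (-(5 / 12) : ℝ)) := by gcongr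
      _ = _ := by linear_combination (6 * √12 * (9 + 12 * M)) * h3
  rw [e1, e2]
  calc _ ≤ _ := add_le_add_right e3 _
    _ = _ := by rw [← add_mul, ← add_mul]
    _ ≤ _ := mul_le_mul_of_nonneg_right hn (by positivity)

lemma eventually_radius_le {d : ℕ} (hd : 1 ≤ d) (v ℓ : ℝ) {ε : ℝ} (hε : 0 < ε) :
    ∀ᶠ n : ℕ in atTop, ℓ * ((n : ℝ) ^ (-(11 / 12) : ℝ) / v) ^ (1 / d : ℝ) ≤ ε := by
  have hd' : (0 : ℝ) < 1 / d := by positivity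
  have h : Tendsto (fun n : ℕ => ℓ * ((n : ℝ) ^ (-(11 / 12) : ℝ) / v) ^ (1 / d : ℝ)) atTop
      (𝓝 (ℓ * (0 / v) ^ (1 / d : ℝ))) :=
    ((((tendsto_rpow_neg_atTop (by norm_num)).comp tendsto_natCast_atTop_atTop).div_const v).rpow_const
      (Or.inr hd'.le)).const_mul ℓ
  rw [zero_div, Real.zero_rpow hd'.ne', mul_zero] at h
  exact h.eventually_le_const hε

/-- The exponent in the tail bounds is controlled by `(√V + √log (1/δ))² log n`. -/
lemma sqrt_exponent_le {n V : ℕ} (hn : 3 ≤ n) (hV : 1 ≤ V) {δ : ℝ} (hδ : 0 < δ) (hδ1 : δ < 1) :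
    √(Real.log (n / δ) + V * Real.log ((n : ℝ) ^ 5 + 1)) ≤
      3 * √(Real.log n) * (√V + √(Real.log (1 / δ))) := by
  have hn0 : (0 : ℝ) < n := by positivity
  have hn3 : (3 : ℝ) ≤ n := by exact_mod_cast hn
  have hV1 : (1 : ℝ) ≤ V := by exact_mod_cast hV
  have hlog : 1 ≤ Real.log n := by
    rw [Real.le_log_iff_exp_le hn0]
    exact Real.exp_one_lt_three.le.trans hn3
  set lam := Real.log (1 / δ) with hlam
  have hlam0 : 0 ≤ lam := Real.log_nonneg (by rw [le_div_iff₀ hδ]; linarith)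
  have h1 : Real.log (n / δ) = Real.log n + lam := by
    rw [hlam, ← Real.log_mul hn0.ne' (by positivity), mul_one_div]
  have h2 : Real.log ((n : ℝ) ^ 5 + 1) ≤ 6 * Real.log n := by
    rw [show (6 : ℝ) * Real.log n = Real.log ((n : ℝ) ^ 6) by rw [Real.log_pow]; norm_num]
    refine Real.log_le_log (by positivity) ?_
    nlinarith [pow_pos hn0 5, one_le_pow₀ (n := 5) (by linarith : (1 : ℝ) ≤ n)]
  have h3 : √V ^ 2 = V := Real.sq_sqrt (by positivity)
  have h4 : √lam ^ 2 = lam := Real.sq_sqrt hlam0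
  have h5 : (V : ℝ) + lam ≤ (√V + √lam) ^ 2 := by
    nlinarith [mul_nonneg (Real.sqrt_nonneg (V : ℝ)) (Real.sqrt_nonneg lam)]
  refine Real.sqrt_le_iff.2 ⟨by positivity, ?_⟩
  rw [mul_pow, mul_pow, Real.sq_sqrt (by linarith), h1]
  have h6 := mul_le_mul_of_nonneg_left h2 (by positivity : (0 : ℝ) ≤ V)
  have h7 : Real.log n ≤ V * Real.log n := le_mul_of_one_le_left (by linarith) hV1
  have h8 : lam ≤ lam * Real.log n := le_mul_of_one_le_right hlam0 hlog
  have h9 := mul_le_mul_of_nonneg_left h5 (by linarith : 0 ≤ Real.log n)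
  nlinarith [mul_nonneg hlam0 (by linarith : 0 ≤ Real.log n)]

end Asymptotics

/-! ### The excess risk -/

section ExcessRisk

variable {dx dy dz n : ℕ} [NeZero n] {L : Bool → Bool → ℝ} {B : ℝ}
  {𝒢 : Set (Sample dx dy dz → Bool)}

lemma lawOutcome_not_erm_le_of_forall (J : JointDensity dx dy dz) {R : ℝ} (p : ℝ≥0∞)
    (h : ∀ g ∈ 𝒢, risk L (J.lawLabelled n) g - (⨅ g' : 𝒢, risk L (J.lawLabelled n) g') ≤ R) :
    J.lawOutcome n {ω | ¬ ∀ g, IsERM L 𝒢 ω g →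
        risk L (J.lawLabelled n) g - (⨅ g' : 𝒢, risk L (J.lawLabelled n) g') ≤ R} ≤ p := by
  have : {ω : Outcome dx dy dz n | ¬ ∀ g, IsERM L 𝒢 ω g →
      risk L (J.lawLabelled n) g - (⨅ g' : 𝒢, risk L (J.lawLabelled n) g') ≤ R} = ∅ :=
    Set.eq_empty_of_forall_notMem fun ω hω => hω fun g hg => h g hg.1
  rw [this, measure_empty]
  exact zero_le

/-- For large `n`, the excess risk is bounded by the cube-root term of `gammaBound` and `G(ε)`. The
truncation radius is that of a ball of volume `n ^ (-11 / 12)`. -/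
theorem lawOutcome_excess_risk_le (J : JointDensity dx dy dz) {ℓ : ℝ≥0}
    (hℓ : LipschitzWith ℓ J.margZ) {ε : ℝ} (hdz : 1 ≤ dz) (hn : 12 ≤ n)
    (hrem : 48 / (n : ℝ) + 4 * Real.exp (-(n * (ε / 2 * (n : ℝ) ^ (-(11 / 12) : ℝ)))) +
      6 * √(Real.log n) * (9 * (n : ℝ) ^ (-(1 / 2) : ℝ) +
        12 * (ℓ + 1 / unitBallVolume dz) * (n : ℝ) ^ (-(5 / 12) : ℝ)) ≤
      4 * (n : ℝ) ^ (-(1 / 3) : ℝ))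
    (hrad : ℓ * ((n : ℝ) ^ (-(11 / 12) : ℝ) / unitBallVolume dz) ^ (1 / dz : ℝ) ≤ ε / 2)
    {δ : ℝ} (hδ : 0 < δ) (hδ1 : δ < 1) (hL : ∀ a b, |L a b| ≤ B) (hB0 : 0 < B)
    (h𝒢 : PointwiseMeasurable 𝒢) {V : ℕ} (hV : vcDim 𝒢 = V) (hV1 : 1 ≤ V) (hVn : V ≤ n) :
    J.lawOutcome n {ω | ¬ ∀ g, IsERM L 𝒢 ω g →
        risk L (J.lawLabelled n) g - (⨅ g' : 𝒢, risk L (J.lawLabelled n) g') ≤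
          4 * B * ((√V + √(Real.log (1 / δ))) * (Real.log (n / δ) / n) ^ (1 / 3 : ℝ) +
            J.lowMass ε)} ≤ ENNReal.ofReal (8 * δ) := by
  have hn0 : (0 : ℝ) < n := by positivity
  have hn12 : (12 : ℝ) ≤ n := by exact_mod_cast hn
  have hv := unitBallVolume_pos dz
  set v := unitBallVolume dz with hv_def
  set q := √(V : ℝ) + √(Real.log (1 / δ)) with hq
  set X := Real.log (n / δ) + V * Real.log ((n : ℝ) ^ 5 + 1) with hX
  set M := (ℓ : ℝ) + 1 / v with hM
  set b := (n : ℝ) ^ (-(11 / 12) : ℝ) with hb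
  have hb0 : 0 < b := by positivity
  set r := (b / v) ^ (1 / dz : ℝ) with hr
  have hr0 : 0 ≤ r := by positivity
  have hM0 : 0 < M := by positivity
  have hrv : r ^ dz * v = b := by
    rw [hr, ← Real.rpow_natCast, ← Real.rpow_mul (by positivity), one_div,
      inv_mul_cancel₀ (by positivity), Real.rpow_one]
    field_simp
  have hq1 : 1 ≤ q := by
    have : 1 ≤ √(V : ℝ) := Real.one_le_sqrt.2 (by exact_mod_cast hV1)
    linarith [Real.sqrt_nonneg (Real.log (1 / δ))]
  have hlog1 : 1 ≤ Real.log (n / δ) := by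
    rw [Real.le_log_iff_exp_le (by positivity), le_div_iff₀ hδ]
    nlinarith [Real.exp_one_lt_three, Real.exp_pos 1]
  have hX0 : 0 ≤ X := by
    have : 0 ≤ Real.log ((n : ℝ) ^ 5 + 1) := Real.log_nonneg (by linarith [pow_pos hn0 5])
    positivity
  have hsX : √X ≤ 3 * √(Real.log n) * q := sqrt_exponent_le (by omega) hV1 hδ hδ1
  have hfin := lawOutcome_erm_le (n := n) (m := n ^ 5) (τ := 1 / (n : ℝ) ^ 2) (X := X) J h𝒢 hV.le hL hB0
    (by positivity) (covering_condition hn hVn) hX0 (K := {z | ε < J.margZ z})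
    (measurableSet_lt measurable_const J.measurable_margZ) (r := r) (κ := M * b) (p := ε / 2 * b)
    (by positivity) (fun a => hrv ▸ JointDensity.law_real_near_le hℓ a hr0)
    (fun z hz => ?_) (R := 4 * B * (q * (Real.log (n / δ) / n) ^ (1 / 3 : ℝ) + J.lowMass ε)) ?_
  · refine hfin.trans (ENNReal.ofReal_le_ofReal ?_)
    have hexp : Real.exp (-X) = δ / n * (((n : ℝ) ^ 5 + 1) ^ V)⁻¹ := by
      rw [hX, neg_add, Real.exp_add, Real.exp_neg, Real.exp_log (by positivity), inv_div,
        Real.exp_neg, Real.exp_nat_mul, Real.exp_log (by positivity)]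
    have hP : 1 ≤ ((n : ℝ) ^ 5 + 1) ^ V := one_le_pow₀ (by linarith [pow_pos hn0 5])
    have hPi : (((n : ℝ) ^ 5 + 1) ^ V)⁻¹ ≤ 1 := inv_le_one_of_one_le₀ hP
    push_cast
    rw [hexp]
    calc (6 * ((n : ℝ) ^ 5 + 1) ^ V + 1 + 4 * n) * (δ / n * (((n : ℝ) ^ 5 + 1) ^ V)⁻¹)
        = δ / n * (6 + (1 + 4 * n) * (((n : ℝ) ^ 5 + 1) ^ V)⁻¹) := by field_simp; ring
      _ ≤ δ / n * (6 + (1 + 4 * n) * 1) := by gcongr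
      _ ≤ δ / n * (8 * n) := by gcongr; linarith
      _ = 8 * δ := by field_simp
  · have h1 := JointDensity.le_law_real_near (J := J) hℓ z hr0
    rw [hrv] at h1
    simp only [dist_comm z]
    refine le_trans ?_ h1
    have hz' : ε < J.margZ z := hz
    gcongr
    linarith
  · have hlow : J.law.real {u : Sample dx dy dz | u.2.2 ∉ {z | ε < J.margZ z}} = J.lowMass ε := by
      simp [JointDensity.lowMass, measureReal_def]
    rw [hlow]
    have s1 : √(n * X) = √n * √X := Real.sqrt_mul hn0.le X
    have s2 : √(2 * n * X) ≤ 2 * (√n * √X) := by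
      rw [mul_assoc, Real.sqrt_mul zero_le_two, s1]
      gcongr
      exact Real.sqrt_le_iff.2 ⟨by norm_num, by norm_num⟩
    have s3 : √(n : ℝ) / n = (n : ℝ) ^ (-(1 / 2) : ℝ) := by
      rw [Real.sqrt_eq_rpow]
      nth_rewrite 2 [← Real.rpow_one (n : ℝ)]
      rw [← Real.rpow_sub hn0]
      norm_num
    have s4 : b * √(n : ℝ) = (n : ℝ) ^ (-(5 / 12) : ℝ) := by
      rw [Real.sqrt_eq_rpow, hb, ← Real.rpow_add hn0]
      norm_num
    have s5 : 1 / (n : ℝ) ^ 2 ≤ 1 / n := by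
      gcongr
      nlinarith
    have s6 : (n : ℝ) * (1 / (n : ℝ) ^ 2) = 1 / n := by field_simp
    have s7 : (n : ℝ) ^ (-(1 / 3) : ℝ) ≤ (Real.log (n / δ) / n) ^ (1 / 3 : ℝ) := by
      rw [Real.rpow_neg hn0.le, ← Real.inv_rpow hn0.le]
      gcongr
      rw [inv_eq_one_div]
      gcongr
    set a := (n : ℝ) ^ (-(1 / 2) : ℝ) with ha
    set c := (n : ℝ) ^ (-(5 / 12) : ℝ) with hc
    set E := Real.exp (-(n * (ε / 2 * b))) with hE
    have ha0 : 0 < a := by positivity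
    have hc0 : 0 < c := by positivity
    have hE0 : 0 < E := Real.exp_pos _
    have key : 2 * (2 * (2 * (4 * B * (1 / (n : ℝ) ^ 2)) + 2 * B / n * √(2 * n * X)) +
        (2 * (4 * B * n * (1 / (n : ℝ) ^ 2)) + 4 * B * (M * b) * √(2 * n * X)) +
        B * (2 * J.lowMass ε + 2 * (M * b) * √(2 * n * X) + 2 * E) + B * (√(n * X) / n)) ≤
        4 * B * J.lowMass ε + B * (48 / n + 4 * E + 2 * (9 * a + 12 * M * c) * √X) := by
      calc _ = 2 * B * (8 * (2 * (1 / (n : ℝ) ^ 2)) + 8 * (n * (1 / (n : ℝ) ^ 2)) +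
              (4 / n + 6 * (M * b)) * √(2 * n * X) + 2 * J.lowMass ε + 2 * E + √(n * X) / n) := by
            ring
        _ ≤ 2 * B * (8 * (2 * (1 / n)) + 8 * (1 / n) +
              (4 / n + 6 * (M * b)) * (2 * (√n * √X)) + 2 * J.lowMass ε + 2 * E +
                (√n * √X) / n) := by
            rw [s1, s6]
            gcongr
        _ = 4 * B * J.lowMass ε + B * (48 * (1 / n) + 4 * E +
              2 * (9 * (√n / n) + 12 * M * (b * √n)) * √X) := by ring
        _ = _ := by rw [s3, s4]; ring
    refine key.trans ?_
    have h2 : 48 / n + 4 * E + 2 * (9 * a + 12 * M * c) * √X ≤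
        q * (4 * (Real.log (n / δ) / n) ^ (1 / 3 : ℝ)) := by
      calc 48 / n + 4 * E + 2 * (9 * a + 12 * M * c) * √X
          ≤ 48 / n + 4 * E + 2 * (9 * a + 12 * M * c) * (3 * √(Real.log n) * q) := by gcongr
        _ ≤ q * (48 / n + 4 * E) + 2 * (9 * a + 12 * M * c) * (3 * √(Real.log n) * q) := by
            gcongr
            exact le_mul_of_one_le_left (by positivity) hq1
        _ = q * (48 / n + 4 * E + 6 * √(Real.log n) * (9 * a + 12 * M * c)) := by ring
        _ ≤ q * (4 * (n : ℝ) ^ (-(1 / 3) : ℝ)) := by gcongr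
        _ ≤ _ := by gcongr
    have h3 := mul_le_mul_of_nonneg_left h2 hB0.le
    linarith

lemma le_gammaBound {C B : ℝ} (hC : 0 ≤ C) (hB : 0 ≤ B) (V dz n : ℕ) (δ o G : ℝ) :
    C * B * ((√V + √(Real.log (1 / δ))) * (Real.log (n / δ) / n) ^ (1 / 3 : ℝ) + G) ≤
      gammaBound C B V dz n δ o G := by
  unfold gammaBound
  gcongr
  exact le_add_of_nonneg_right (Real.sqrt_nonneg _)

lemma lowMass_nonneg (J : JointDensity dx dy dz) (t : ℝ) : 0 ≤ J.lowMass t := ENNReal.toReal_nonneg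

/-- The sample size from which on `lawOutcome_excess_risk_le` applies. -/
lemma exists_sampleSize (dz : ℕ) (hdz : 1 ≤ dz) (ℓ : ℝ≥0) {ε : ℝ} (hε : 0 < ε) :
    ∃ N : ℕ, 12 ≤ N ∧ ∀ n, N ≤ n →
      (48 / (n : ℝ) + 4 * Real.exp (-(n * (ε / 2 * (n : ℝ) ^ (-(11 / 12) : ℝ)))) +
        6 * √(Real.log n) * (9 * (n : ℝ) ^ (-(1 / 2) : ℝ) +
          12 * (ℓ + 1 / unitBallVolume dz) * (n : ℝ) ^ (-(5 / 12) : ℝ)) ≤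
        4 * (n : ℝ) ^ (-(1 / 3) : ℝ)) ∧
      ℓ * ((n : ℝ) ^ (-(11 / 12) : ℝ) / unitBallVolume dz) ^ (1 / dz : ℝ) ≤ ε / 2 := by
  have hv := unitBallVolume_pos dz
  have h1 := eventually_remainder_le (ℓ + 1 / unitBallVolume dz) (by positivity) (half_pos hε)
  have h2 := eventually_radius_le hdz (unitBallVolume dz) ℓ (half_pos hε)
  obtain ⟨N, hN⟩ := eventually_atTop.1 (h1.and h2)
  exact ⟨max 12 N, le_max_left _ _, fun n hn => hN n ((le_max_right _ _).trans hn)⟩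

/-- The function `o_n(1/ε)`: it makes the bound trivial for small `n`, and vanishes for large `n`. -/
noncomputable def remainder (N : ℝ → ℕ) (ε : ℝ) (n : ℕ) : ℝ := if n < N ε then n else 0

lemma tendsto_remainder (N : ℝ → ℕ) (ε : ℝ) : Tendsto (remainder N ε) atTop (𝓝 0) :=
  tendsto_const_nhds.congr' ((eventually_ge_atTop (N ε)).mono fun n hn => by
    rw [remainder, if_neg (not_lt.2 hn)])

/-- The bound on the excess risk for all `n`: it is trivial for `n < N ε` by the choice of the
remainder, and for `V > n` since then `√V (log n / n) ^ (1 / 3) ≥ 1`. -/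
theorem lawOutcome_gammaBound_le (J : JointDensity dx dy dz) {ℓ : ℝ≥0}
    (hℓ : LipschitzWith ℓ J.margZ) (hdz : 1 ≤ dz) {N : ℝ → ℕ}
    (hN : ∀ ε, 0 < ε → 12 ≤ N ε ∧ ∀ n, N ε ≤ n →
      (48 / (n : ℝ) + 4 * Real.exp (-(n * (ε / 2 * (n : ℝ) ^ (-(11 / 12) : ℝ)))) +
        6 * √(Real.log n) * (9 * (n : ℝ) ^ (-(1 / 2) : ℝ) +
          12 * (ℓ + 1 / unitBallVolume dz) * (n : ℝ) ^ (-(5 / 12) : ℝ)) ≤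
        4 * (n : ℝ) ^ (-(1 / 3) : ℝ)) ∧
      ℓ * ((n : ℝ) ^ (-(11 / 12) : ℝ) / unitBallVolume dz) ^ (1 / dz : ℝ) ≤ ε / 2)
    {δ ε : ℝ} (hδ : 0 < δ) (hδ1 : δ < 1) (hε : 0 < ε) (hL : ∀ a b, |L a b| ≤ B)
    (h𝒢 : PointwiseMeasurable 𝒢) {V : ℕ} (hV : vcDim 𝒢 = V) :
    J.lawOutcome n {ω | ¬ ∀ g, IsERM L 𝒢 ω g →
        risk L (J.lawLabelled n) g - (⨅ g' : 𝒢, risk L (J.lawLabelled n) g') ≤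
          gammaBound 4 B V dz n δ (remainder N ε n) (J.lowMass ε)} ≤ ENNReal.ofReal (8 * δ) := by
  have hn0 : (0 : ℝ) < n := by exact_mod_cast Nat.pos_of_neZero n
  have hB : 0 ≤ B := (abs_nonneg _).trans (hL true true)
  have hG := lowMass_nonneg J ε
  have hn1 : (1 : ℝ) ≤ n := by exact_mod_cast Nat.pos_of_neZero n
  have hlog0 : 0 ≤ Real.log (n / δ) := Real.log_nonneg (by rw [le_div_iff₀ hδ]; linarith)
  rcases Nat.eq_zero_or_pos V with rfl | hV1
  · refine lawOutcome_not_erm_le_of_forall J _ fun g hg => ?_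
    rw [← risk_eq_iInf_of_vcDim_eq_zero _ (by simpa using hV) hg, sub_self]
    exact le_trans (by positivity) (le_gammaBound (by norm_num) hB 0 dz n δ _ _)
  have hsV : 1 ≤ √(V : ℝ) := Real.one_le_sqrt.2 (by exact_mod_cast hV1)
  have htriv : 2 * B ≤ gammaBound 4 B V dz n δ (remainder N ε n) (J.lowMass ε) →
      J.lawOutcome n {ω | ¬ ∀ g, IsERM L 𝒢 ω g →
        risk L (J.lawLabelled n) g - (⨅ g' : 𝒢, risk L (J.lawLabelled n) g') ≤
          gammaBound 4 B V dz n δ (remainder N ε n) (J.lowMass ε)} ≤ ENNReal.ofReal (8 * δ) :=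
    fun h => lawOutcome_not_erm_le_of_forall J _ fun g hg => (risk_sub_iInf_le hL _ hg).trans h
  rcases hB.eq_or_lt with rfl | hB0
  · exact htriv (by simp [gammaBound])
  rcases lt_or_ge n (N ε) with hnN | hnN
  · refine htriv ?_
    rw [remainder, if_pos hnN]
    have h1 : 1 ≤ √((4 ^ dz * Real.log (n / δ) + n) / n) := by
      rw [Real.one_le_sqrt, le_div_iff₀ hn0]
      have : 0 ≤ 4 ^ dz * Real.log (n / δ) := by positivity
      linarith
    have h2 : 0 ≤ (Real.log (n / δ) / n) ^ (1 / 3 : ℝ) := by positivity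
    calc 2 * B ≤ 4 * B * ((1 + 0) * (0 + 1) + 0) := by linarith
      _ ≤ _ := by
        unfold gammaBound
        gcongr
        exact Real.sqrt_nonneg _
  have hn12 : 12 ≤ n := (hN ε hε).1.trans hnN
  rcases lt_or_ge n V with hnV | hVn
  · refine htriv (le_trans ?_ (le_gammaBound (by norm_num) hB V dz n δ _ _))
    have h1 : 1 ≤ Real.log (n / δ) := by
      rw [Real.le_log_iff_exp_le (by positivity), le_div_iff₀ hδ]
      have : (12 : ℝ) ≤ n := by exact_mod_cast hn12
      nlinarith [Real.exp_one_lt_three, Real.exp_pos 1]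
    have h2 : 1 ≤ √(V : ℝ) * (Real.log (n / δ) / n) ^ (1 / 3 : ℝ) := by
      calc (1 : ℝ) ≤ (n : ℝ) ^ (1 / 6 : ℝ) := Real.one_le_rpow hn1 (by norm_num)
        _ = √(n : ℝ) * (1 / n) ^ (1 / 3 : ℝ) := by
          rw [one_div (n : ℝ), Real.inv_rpow hn0.le, ← Real.rpow_neg hn0.le, Real.sqrt_eq_rpow,
            ← Real.rpow_add hn0]
          norm_num
        _ ≤ _ := by gcongr
    have h3 : 0 ≤ √(Real.log (1 / δ)) * (Real.log (n / δ) / n) ^ (1 / 3 : ℝ) := by positivity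
    have h4 := mul_le_mul_of_nonneg_left (show (1 : ℝ) ≤ (√V + √(Real.log (1 / δ))) *
      (Real.log (n / δ) / n) ^ (1 / 3 : ℝ) + J.lowMass ε by rw [add_mul]; linarith)
      (by positivity : 0 ≤ 4 * B)
    linarith
  · obtain ⟨hrem, hrad⟩ := (hN ε hε).2 n hnN
    refine (measure_mono fun ω hω => ?_).trans
      (lawOutcome_excess_risk_le J hℓ hdz hn12 hrem hrad hδ hδ1 hL hB0 h𝒢 hV hV1 hVn)
    exact fun h => hω fun g hg => (h g hg).trans (le_gammaBound (by norm_num) hB V dz n δ _ _)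

end ExcessRisk

/-! ### The Hessian bound and Taylor's formula -/

section Taylor

variable {d : ℕ} {F : Eu d → ℝ} {a : Eu d} {β : ℝ}

lemma sum_smul_single (v : Eu d) : ∑ i, v i • EuclideanSpace.single i (1 : ℝ) = v := by
  simpa using (EuclideanSpace.basisFun (Fin d) ℝ).sum_repr v

lemma fderiv_fderiv_apply_eq (v w : Eu d) :
    fderiv ℝ (fderiv ℝ F) a v w = v ⬝ᵥ (hessianMatrix F a).mulVec w := by
  conv_lhs => rw [← sum_smul_single v, ← sum_smul_single w]
  simp only [map_sum, map_smul, _root_.sum_apply, _root_.smul_apply,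
    smul_eq_mul, dotProduct, Matrix.mulVec, hessianMatrix, Matrix.of_apply, iteratedFDeriv_two_apply,
    Matrix.cons_val_zero, Matrix.cons_val_one]
  simp_rw [Finset.mul_sum]
  rw [Finset.sum_comm]
  exact Finset.sum_congr rfl fun i _ => Finset.sum_congr rfl fun j _ => by ring

lemma isHermitian_hessianMatrix (hF : ContDiffAt ℝ 2 F a) : (hessianMatrix F a).IsHermitian := by
  have h := hF.isSymmSndFDerivAt (by simp)
  ext i j
  simp only [hessianMatrix, Matrix.conjTranspose_apply, Matrix.of_apply, iteratedFDeriv_two_apply,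
    Matrix.cons_val_zero, Matrix.cons_val_one, star_trivial]
  exact h.eq _ _

/-- A bound on the eigenvalues of the Hessian matrix bounds the second derivative as a quadratic form. -/
lemma fderiv_fderiv_self_le (hF : ContDiffAt ℝ 2 F a)
    (hβ : ∀ lam : ℝ, Module.End.HasEigenvalue (Matrix.toLin' (hessianMatrix F a)) lam → lam ≤ β)
    (v : Eu d) : fderiv ℝ (fderiv ℝ F) a v v ≤ β * ‖v‖ ^ 2 := by
  have hA := isHermitian_hessianMatrix hF
  set b := hA.eigenvectorBasis with hb
  have hk : ∀ k, fderiv ℝ (fderiv ℝ F) a v (b k) = hA.eigenvalues k * inner ℝ (b k) v := fun k => by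
    rw [fderiv_fderiv_apply_eq, hA.mulVec_eigenvectorBasis, dotProduct_smul,
      EuclideanSpace.inner_eq_star_dotProduct, star_trivial, smul_eq_mul]
  have hle : ∀ k, hA.eigenvalues k ≤ β := fun k => hβ _ <| by
    refine Module.End.hasEigenvalue_of_hasEigenvector (x := (b k).ofLp)
      (Module.End.hasEigenvector_iff.2 ⟨Module.End.mem_eigenspace_iff.2 ?_, fun h => ?_⟩)
    · rw [Matrix.toLin'_apply, hA.mulVec_eigenvectorBasis]
    · have h1 := b.orthonormal.ne_zero k
      exact h1 (by ext i; exact congrFun h i)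
  calc fderiv ℝ (fderiv ℝ F) a v v
      = fderiv ℝ (fderiv ℝ F) a v (∑ k, inner ℝ (b k) v • b k) := by rw [b.sum_repr']
    _ = ∑ k, hA.eigenvalues k * (inner ℝ v (b k) * inner ℝ (b k) v) := by
        rw [map_sum]
        refine Finset.sum_congr rfl fun k _ => ?_
        rw [map_smul, hk, smul_eq_mul, real_inner_comm v (b k)]
        ring
    _ ≤ ∑ k, β * (inner ℝ v (b k) * inner ℝ (b k) v) := by
        refine Finset.sum_le_sum fun k _ => mul_le_mul_of_nonneg_right (hle k) ?_
        rw [real_inner_comm v (b k)]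
        exact mul_self_nonneg _
    _ = β * ‖v‖ ^ 2 := by
        rw [← Finset.mul_sum, b.sum_inner_mul_inner, real_inner_self_eq_norm_sq]

/-- The second-order Taylor bound at a critical zero. -/
lemma le_half_mul_sq_of_fderiv_fderiv_le {z v : Eu d} (h0 : F z = 0) (h1 : fderiv ℝ F z = 0)
    (hF : ∀ t ∈ Set.Icc (0 : ℝ) 1, ContDiffAt ℝ 2 F (z + t • v))
    (hβ : ∀ t ∈ Set.Icc (0 : ℝ) 1, fderiv ℝ (fderiv ℝ F) (z + t • v) v v ≤ β * ‖v‖ ^ 2) :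
    F (z + v) ≤ β / 2 * ‖v‖ ^ 2 := by
  have hline : ∀ t : ℝ, HasDerivAt (fun t : ℝ => z + t • v) v t := fun t => by
    simpa using ((hasDerivAt_id t).smul_const v).const_add z
  have hd1 : ∀ t ∈ Set.Icc (0 : ℝ) 1,
      HasDerivAt (fun t : ℝ => F (z + t • v)) (fderiv ℝ F (z + t • v) v) t := fun t ht =>
    ((hF t ht).differentiableAt two_ne_zero).hasFDerivAt.comp_hasDerivAt t (hline t)
  have hd2 : ∀ t ∈ Set.Icc (0 : ℝ) 1, HasDerivAt (fun t : ℝ => fderiv ℝ F (z + t • v) v)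
      (fderiv ℝ (fderiv ℝ F) (z + t • v) v v) t := fun t ht => by
    have h := (((hF t ht).fderiv_right (m := 1) (by norm_num)).differentiableAt
      one_ne_zero).hasFDerivAt.comp_hasDerivAt t (hline t)
    simpa using h.clm_apply (hasDerivAt_const t v)
  have hsub : interior (Set.Icc (0 : ℝ) 1) ⊆ Set.Icc 0 1 := interior_subset
  have mono1 : MonotoneOn (fun t : ℝ => β * ‖v‖ ^ 2 * t - fderiv ℝ F (z + t • v) v)
      (Set.Icc 0 1) := by
    have hd : ∀ t ∈ Set.Icc (0 : ℝ) 1,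
        HasDerivAt (fun t : ℝ => β * ‖v‖ ^ 2 * t - fderiv ℝ F (z + t • v) v)
          (β * ‖v‖ ^ 2 - fderiv ℝ (fderiv ℝ F) (z + t • v) v v) t := fun t ht => by
      have h3 : HasDerivAt (fun t : ℝ => β * ‖v‖ ^ 2 * t) (β * ‖v‖ ^ 2) t := by
        simpa using (hasDerivAt_id t).const_mul (β * ‖v‖ ^ 2)
      exact h3.sub (hd2 t ht)
    refine monotoneOn_of_deriv_nonneg (convex_Icc 0 1)
      (fun t ht => (hd t ht).continuousAt.continuousWithinAt)
      (fun t ht => (hd t (hsub ht)).differentiableAt.differentiableWithinAt) fun t ht => ?_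
    rw [(hd t (hsub ht)).deriv]
    linarith [hβ t (hsub ht)]
  have h2 : ∀ t ∈ Set.Icc (0 : ℝ) 1, fderiv ℝ F (z + t • v) v ≤ β * ‖v‖ ^ 2 * t := fun t ht => by
    have := mono1 (Set.left_mem_Icc.2 zero_le_one) ht ht.1
    simp [h1] at this
    linarith
  have mono2 : MonotoneOn (fun t : ℝ => β * ‖v‖ ^ 2 * (t ^ 2 / 2) - F (z + t • v))
      (Set.Icc 0 1) := by
    have hd : ∀ t ∈ Set.Icc (0 : ℝ) 1,
        HasDerivAt (fun t : ℝ => β * ‖v‖ ^ 2 * (t ^ 2 / 2) - F (z + t • v))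
          (β * ‖v‖ ^ 2 * t - fderiv ℝ F (z + t • v) v) t := fun t ht => by
      have h3 : HasDerivAt (fun t : ℝ => t ^ 2 / 2) t t := by
        simpa using ((hasDerivAt_id t).pow 2).div_const 2
      exact (h3.const_mul (β * ‖v‖ ^ 2)).sub (hd1 t ht)
    refine monotoneOn_of_deriv_nonneg (convex_Icc 0 1)
      (fun t ht => (hd t ht).continuousAt.continuousWithinAt)
      (fun t ht => (hd t (hsub ht)).differentiableAt.differentiableWithinAt) fun t ht => ?_
    rw [(hd t (hsub ht)).deriv]
    linarith [h2 t (hsub ht)]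
  have := mono2 (Set.left_mem_Icc.2 zero_le_one) (Set.right_mem_Icc.2 zero_le_one) zero_le_one
  simp [h0] at this
  linarith

end Taylor

/-! ### From the Kullback-Leibler divergence to the `L¹` distance -/

section Hellinger

variable {α : Type*} [MeasurableSpace α] {μ : Measure α}

/-- The pointwise comparison of the Hellinger and Kullback-Leibler integrands, `log x ≤ x - 1` with
`x = √q / √p`. -/
lemma sq_sqrt_sub_sqrt_le {p q : ℝ} (hp : 0 ≤ p) (hq : 0 ≤ q) (h : 0 < p → 0 < q) :
    (√p - √q) ^ 2 ≤ Real.log (p / q) * p - p + q := by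
  rcases hp.eq_or_lt with rfl | hp
  · simp [Real.sq_sqrt hq]
  have hq := h hp
  have e : Real.log (p / q) = -2 * Real.log (√q / √p) := by
    rw [Real.log_div hp.ne' hq.ne', Real.log_div (by positivity) (by positivity),
      Real.log_sqrt hp.le, Real.log_sqrt hq.le]
    ring
  have h1 := Real.log_le_sub_one_of_pos (show 0 < √q / √p by positivity)
  have h2 : Real.log (√q / √p) * p ≤ √q * √p - p := by
    have h3 := mul_le_mul_of_nonneg_right h1 hp.le
    have h4 : (√q / √p - 1) * p = √q * √p - p := by
      have h5 : √p ≠ 0 := by positivity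
      calc (√q / √p - 1) * p = √q / √p * p - p := by ring
        _ = √q / √p * (√p * √p) - p := by rw [Real.mul_self_sqrt hp.le]
        _ = √q * √p - p := by field_simp
    linarith
  rw [e, sub_sq, Real.sq_sqrt hp.le, Real.sq_sqrt hq.le]
  linarith

/-- The inequality of arithmetic and geometric means for `p - q = (√p - √q) (√p + √q)`. -/
lemma abs_sub_le_hellinger {p q t : ℝ} (hp : 0 ≤ p) (hq : 0 ≤ q) (ht : 0 < t) :
    |p - q| ≤ t / 2 * (√p - √q) ^ 2 + 1 / (2 * t) * (2 * (p + q)) := by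
  have e : p - q = (√p - √q) * (√p + √q) := by
    linear_combination (-1) * Real.sq_sqrt hp + Real.sq_sqrt hq
  have h1 : (√p + √q) ^ 2 ≤ 2 * (p + q) := by
    have := sq_nonneg (√p - √q)
    nlinarith [Real.sq_sqrt hp, Real.sq_sqrt hq]
  have h2 : 1 / (2 * t) * (√p + √q) ^ 2 ≤ 1 / (2 * t) * (2 * (p + q)) :=
    mul_le_mul_of_nonneg_left h1 (by positivity)
  have h3 : ∀ x y : ℝ, x * y ≤ t / 2 * x ^ 2 + 1 / (2 * t) * y ^ 2 := fun x y => by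
    have h4 : t / 2 * x ^ 2 + 1 / (2 * t) * y ^ 2 - x * y = (t * x - y) ^ 2 / (2 * t) := by
      field_simp
      ring
    have : 0 ≤ (t * x - y) ^ 2 / (2 * t) := by positivity
    linarith
  rw [e, abs_le]
  have h5 := h3 (√p - √q) (√p + √q)
  have h6 := h3 (-(√p - √q)) (√p + √q)
  rw [neg_sq] at h6
  constructor <;> linarith

variable {p q : α → ℝ}

lemma hellinger_le_klDiv (hp : ∀ x, 0 ≤ p x) (hq : ∀ x, 0 ≤ q x) (hpm : Measurable p)
    (hqm : Measurable q) (hpi : Integrable p μ) (hqi : Integrable q μ)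
    (h1 : ∫ x, p x ∂μ = 1) (h2 : ∫ x, q x ∂μ = 1) (hac : ∀ᵐ x ∂μ, 0 < p x → 0 < q x)
    (hi : Integrable (fun x => Real.log (p x / q x) * p x) μ) :
    Integrable (fun x => (√(p x) - √(q x)) ^ 2) μ ∧
      ∫ x, (√(p x) - √(q x)) ^ 2 ∂μ ≤ ∫ x, Real.log (p x / q x) * p x ∂μ := by
  have hle : ∀ᵐ x ∂μ, (√(p x) - √(q x)) ^ 2 ≤ Real.log (p x / q x) * p x - p x + q x :=
    hac.mono fun x hx => sq_sqrt_sub_sqrt_le (hp x) (hq x) hx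
  have hI : Integrable (fun x => Real.log (p x / q x) * p x - p x + q x) μ := (hi.sub hpi).add hqi
  have hH : Integrable (fun x => (√(p x) - √(q x)) ^ 2) μ := by
    refine hI.mono ((hpm.sqrt.sub hqm.sqrt).pow_const 2).aestronglyMeasurable (hle.mono fun x hx => ?_)
    rw [Real.norm_eq_abs, Real.norm_eq_abs, abs_of_nonneg (sq_nonneg _)]
    exact hx.trans (le_abs_self _)
  refine ⟨hH, (integral_mono_ae hH hI hle).trans_eq ?_⟩
  have h3 : ∫ x, (Real.log (p x / q x) * p x - p x + q x) ∂μ =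
      ∫ x, (Real.log (p x / q x) * p x - p x) ∂μ + ∫ x, q x ∂μ := integral_add (hi.sub hpi) hqi
  rw [h3, integral_sub hi hpi, h1, h2]
  ring

/-- The `L¹` distance of two densities is at most twice the square root of the Kullback-Leibler
divergence, by way of the Hellinger distance. -/
lemma sq_integral_abs_sub_le (hp : ∀ x, 0 ≤ p x) (hq : ∀ x, 0 ≤ q x) (hpm : Measurable p)
    (hqm : Measurable q) (hpi : Integrable p μ) (hqi : Integrable q μ)
    (h1 : ∫ x, p x ∂μ = 1) (h2 : ∫ x, q x ∂μ = 1) (hac : ∀ᵐ x ∂μ, 0 < p x → 0 < q x)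
    (hi : Integrable (fun x => Real.log (p x / q x) * p x) μ) :
    (∫ x, |p x - q x| ∂μ) ^ 2 ≤ 4 * ∫ x, Real.log (p x / q x) * p x ∂μ := by
  obtain ⟨hH, hle⟩ := hellinger_le_klDiv hp hq hpm hqm hpi hqi h1 h2 hac hi
  set D := ∫ x, |p x - q x| ∂μ with hD
  have hD0 : 0 ≤ D := integral_nonneg fun x => abs_nonneg _
  have hH0 : 0 ≤ ∫ x, (√(p x) - √(q x)) ^ 2 ∂μ := integral_nonneg fun x => sq_nonneg _
  rcases hD0.eq_or_lt with h0 | h0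
  · rw [← h0]
    linarith
  have ht : ∀ t : ℝ, 0 < t → D ≤ t / 2 * ∫ x, (√(p x) - √(q x)) ^ 2 ∂μ + 1 / (2 * t) * 4 :=
    fun t ht => by
    have h3 : D ≤ ∫ x, (t / 2 * (√(p x) - √(q x)) ^ 2 + 1 / (2 * t) * (2 * (p x + q x))) ∂μ :=
      integral_mono (hpi.sub hqi).abs
        ((hH.const_mul _).add (((hpi.add hqi).const_mul 2).const_mul _))
        fun x => abs_sub_le_hellinger (hp x) (hq x) ht
    have h4 : ∫ x, (t / 2 * (√(p x) - √(q x)) ^ 2 + 1 / (2 * t) * (2 * (p x + q x))) ∂μ =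
        ∫ x, t / 2 * (√(p x) - √(q x)) ^ 2 ∂μ + ∫ x, 1 / (2 * t) * (2 * (p x + q x)) ∂μ :=
      integral_add (hH.const_mul _) (((hpi.add hqi).const_mul 2).const_mul _)
    rw [h4, integral_const_mul, integral_const_mul, integral_const_mul, integral_add hpi hqi, h1,
      h2] at h3
    linarith
  -- the choice of `t` that makes the second summand half of the left-hand side
  have h4 := ht (4 / D) (by positivity)
  have h5 : 1 / (2 * (4 / D)) * 4 = D / 2 := by field_simp
  rw [h5] at h4
  have h6 : D ^ 2 ≤ 4 * ∫ x, (√(p x) - √(q x)) ^ 2 ∂μ := by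
    have h7 : D / 2 ≤ 4 / D / 2 * ∫ x, (√(p x) - √(q x)) ^ 2 ∂μ := by linarith
    have h8 := mul_le_mul_of_nonneg_left h7 (show 0 ≤ 2 * D by positivity)
    have h9 : 2 * D * (4 / D / 2 * ∫ x, (√(p x) - √(q x)) ^ 2 ∂μ) =
      4 * ∫ x, (√(p x) - √(q x)) ^ 2 ∂μ := by field_simp
    nlinarith
  linarith

end Hellinger

/-! ### Conditional densities and resampling -/

namespace JointDensity

variable {dx dy dz : ℕ} (J : JointDensity dx dy dz)

lemma measurable_condX : Measurable fun p : Eu dx × Eu dz => J.condX p.1 p.2 := by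
  have h : Measurable fun q : (Eu dx × Eu dz) × Eu dy => J.cond q.1.1 q.2 q.1.2 :=
    J.measurable_cond.comp (by fun_prop : Measurable fun q : (Eu dx × Eu dz) × Eu dy =>
      ((q.1.1, q.2, q.1.2) : Sample dx dy dz))
  exact h.stronglyMeasurable.integral_prod_right.measurable

lemma measurable_condY : Measurable fun p : Eu dy × Eu dz => J.condY p.1 p.2 := by
  have h : Measurable fun q : (Eu dy × Eu dz) × Eu dx => J.cond q.2 q.1.1 q.1.2 :=
    J.measurable_cond.comp (by fun_prop : Measurable fun q : (Eu dy × Eu dz) × Eu dx =>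
      ((q.2, q.1.1, q.1.2) : Sample dx dy dz))
  exact h.stronglyMeasurable.integral_prod_right.measurable

lemma condX_nonneg (x : Eu dx) (z : Eu dz) : 0 ≤ J.condX x z :=
  integral_nonneg fun y => J.cond_nonneg x y z

lemma condY_nonneg (y : Eu dy) (z : Eu dz) : 0 ≤ J.condY y z :=
  integral_nonneg fun x => J.cond_nonneg x y z

lemma measurable_cond_xy (z : Eu dz) :
    Measurable fun p : Eu dx × Eu dy => ENNReal.ofReal (J.cond p.1 p.2 z) :=
  measurable_section_xy J.measurable_ofReal_cond z

lemma ofReal_integral_of_lintegral_ne_top {α : Type*} [MeasurableSpace α] {μ : Measure α}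
    {f : α → ℝ} (hf : Measurable f) (h0 : ∀ x, 0 ≤ f x) (h : ∫⁻ x, ENNReal.ofReal (f x) ∂μ ≠ ⊤) :
    ENNReal.ofReal (∫ x, f x ∂μ) = ∫⁻ x, ENNReal.ofReal (f x) ∂μ := by
  refine ofReal_integral_eq_lintegral_ofReal ⟨hf.aestronglyMeasurable, ?_⟩ (ae_of_all _ h0)
  rw [hasFiniteIntegral_iff_ofReal (ae_of_all _ h0)]
  exact h.lt_top

lemma lintegral_condX_mul (z : Eu dz) (k : Eu dx → ℝ≥0∞) :
    ∫⁻ x, ENNReal.ofReal (J.condX x z) * k x =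
      ∫⁻ x, ∫⁻ y, ENNReal.ofReal (J.cond x y z) * k x := by
  have hm := J.measurable_cond_xy z
  have hae : ∀ᵐ x, ∫⁻ y, ENNReal.ofReal (J.cond x y z) < ⊤ := by
    refine ae_lt_top hm.lintegral_prod_right' ?_
    rw [J.lintegral_cond]
    exact ENNReal.one_ne_top
  refine lintegral_congr_ae (hae.mono fun x hx => ?_)
  have hx' : Measurable fun y => J.cond x y z :=
    J.measurable_cond.comp (by fun_prop : Measurable fun y : Eu dy => ((x, y, z) : Sample dx dy dz))
  simp only [condX]
  rw [ofReal_integral_of_lintegral_ne_top hx' (fun y => J.cond_nonneg x y z) hx.ne,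
    lintegral_mul_const _ hx'.ennreal_ofReal]

lemma lintegral_condY_mul (z : Eu dz) {k : Eu dy → ℝ≥0∞} (hk : Measurable k) :
    ∫⁻ y, ENNReal.ofReal (J.condY y z) * k y =
      ∫⁻ x, ∫⁻ y, ENNReal.ofReal (J.cond x y z) * k y := by
  have hm := J.measurable_cond_xy z
  have hm' : Measurable fun p : Eu dx × Eu dy => ENNReal.ofReal (J.cond p.1 p.2 z) * k p.2 :=
    hm.mul (hk.comp measurable_snd)
  have hae : ∀ᵐ y, ∫⁻ x, ENNReal.ofReal (J.cond x y z) < ⊤ := by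
    refine ae_lt_top hm.lintegral_prod_left' ?_
    rw [← lintegral_lintegral_swap hm.aemeasurable, J.lintegral_cond]
    exact ENNReal.one_ne_top
  rw [lintegral_lintegral_swap hm'.aemeasurable]
  refine lintegral_congr_ae (hae.mono fun y hy => ?_)
  have hy' : Measurable fun x => J.cond x y z :=
    J.measurable_cond.comp (by fun_prop : Measurable fun x : Eu dx => ((x, y, z) : Sample dx dy dz))
  simp only [condY]
  rw [ofReal_integral_of_lintegral_ne_top hy' (fun x => J.cond_nonneg x y z) hy.ne,
    lintegral_mul_const _ hy'.ennreal_ofReal]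

lemma lintegral_condY (z : Eu dz) : ∫⁻ y, ENNReal.ofReal (J.condY y z) = 1 := by
  simpa [J.lintegral_cond] using J.lintegral_condY_mul z (k := 1) measurable_one

lemma measurable_condY_left (z : Eu dz) : Measurable fun y => J.condY y z :=
  J.measurable_condY.comp measurable_prodMk_right

lemma integrable_condY (z : Eu dz) : Integrable fun y => J.condY y z := by
  refine ⟨(J.measurable_condY_left z).aestronglyMeasurable, ?_⟩
  rw [hasFiniteIntegral_iff_ofReal (ae_of_all _ fun y => J.condY_nonneg y z), J.lintegral_condY]
  exact ENNReal.one_lt_top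

lemma integral_condY (z : Eu dz) : ∫ y, J.condY y z = 1 := by
  rw [integral_eq_lintegral_of_nonneg_ae (ae_of_all _ fun y => J.condY_nonneg y z)
    (J.measurable_condY_left z).aestronglyMeasurable, J.lintegral_condY, ENNReal.toReal_one]

/-- `∫ f(y | z') h(x, y, z) dy`: the mean of `h` when `y` is drawn as if the third coordinate
were `z'`. -/
noncomputable def resample (h : Sample dx dy dz → ℝ≥0∞) (u : Sample dx dy dz) (z' : Eu dz) : ℝ≥0∞ :=
  ∫⁻ y, ENNReal.ofReal (J.condY y z') * h (u.1, y, u.2.2)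

lemma measurable_resample {h : Sample dx dy dz → ℝ≥0∞} (hh : Measurable h) :
    Measurable fun p : Sample dx dy dz × Eu dz => J.resample h p.1 p.2 := by
  refine Measurable.lintegral_prod_right' (f := fun q : (Sample dx dy dz × Eu dz) × Eu dy =>
    ENNReal.ofReal (J.condY q.2 q.1.2) * h (q.1.1.1, q.2, q.1.1.2.2)) (Measurable.mul ?_ ?_)
  · exact (J.measurable_condY.comp (by fun_prop :
      Measurable fun q : (Sample dx dy dz × Eu dz) × Eu dy => (q.2, q.1.2))).ennreal_ofReal
  · exact hh.comp (by fun_prop)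

lemma resample_one (u : Sample dx dy dz) (z' : Eu dz) : J.resample 1 u z' = 1 := by
  simp [resample, J.lintegral_condY]

/-- Under `f^CI`, the `y`-coordinate is redrawn given `z`. -/
lemma lintegral_lawCI {h : Sample dx dy dz → ℝ≥0∞} (hh : Measurable h) :
    ∫⁻ u, h u ∂J.lawCI = ∫⁻ u, J.resample h u u.2.2 ∂J.law := by
  have hX : Measurable fun u : Sample dx dy dz => ENNReal.ofReal (J.condX u.1 u.2.2) :=
    (J.measurable_condX.comp (by fun_prop :
      Measurable fun u : Sample dx dy dz => (u.1, u.2.2))).ennreal_ofReal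
  have hY : Measurable fun u : Sample dx dy dz => ENNReal.ofReal (J.condY u.2.1 u.2.2) :=
    (J.measurable_condY.comp (by fun_prop :
      Measurable fun u : Sample dx dy dz => (u.2.1, u.2.2))).ennreal_ofReal
  have hZ : Measurable fun u : Sample dx dy dz => ENNReal.ofReal (J.margZ u.2.2) :=
    (J.measurable_margZ.comp (by fun_prop)).ennreal_ofReal
  have hd : (fun u : Sample dx dy dz => ENNReal.ofReal (J.densityCI u)) =
      fun u => ENNReal.ofReal (J.condX u.1 u.2.2) * ENNReal.ofReal (J.condY u.2.1 u.2.2) *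
        ENNReal.ofReal (J.margZ u.2.2) := by
    funext u
    rw [densityCI, ENNReal.ofReal_mul (mul_nonneg (J.condX_nonneg _ _) (J.condY_nonneg _ _)),
      ENNReal.ofReal_mul (J.condX_nonneg _ _)]
  have hr : Measurable fun u : Sample dx dy dz => J.resample h u u.2.2 :=
    (J.measurable_resample hh).comp (by fun_prop : Measurable fun u : Sample dx dy dz => (u, u.2.2))
  rw [J.lintegral_law hr, lawCI, hd,
    lintegral_withDensity_eq_lintegral_mul _ (by exact (hX.mul hY).mul hZ) hh,
    lintegral_sample (by exact ((hX.mul hY).mul hZ).mul hh)]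
  refine lintegral_congr fun z => ?_
  have hk : Measurable fun x : Eu dx => ∫⁻ y, ENNReal.ofReal (J.condY y z) * h (x, y, z) :=
    (measurable_section_xy (hY.mul hh) z).lintegral_prod_right'
  have hk' := J.lintegral_condX_mul z
    fun x => ∫⁻ y, ENNReal.ofReal (J.condY y z) * h (x, y, z)
  simp only [resample]
  rw [← hk', ← lintegral_const_mul _ (by
    exact ((J.measurable_condX.comp measurable_prodMk_right).ennreal_ofReal).mul hk)]
  refine lintegral_congr fun x => ?_
  have hy : Measurable fun y => ENNReal.ofReal (J.condY y z) * h (x, y, z) :=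
    (measurable_section_xy (hY.mul hh) z).comp measurable_prodMk_left
  rw [← mul_assoc, ← lintegral_const_mul _ hy]
  refine lintegral_congr fun y => ?_
  simp only [Pi.mul_apply]
  ring

instance isProbabilityMeasure_lawCI : IsProbabilityMeasure J.lawCI := by
  constructor
  have h := J.lintegral_lawCI (h := 1) measurable_one
  simpa [resample_one] using h

/-- Given `z`, the `y`-coordinate of a sample has density `f(y | z)`. -/
lemma lintegral_law_yz {k : Eu dy × Eu dz → ℝ≥0∞} (hk : Measurable k) :
    ∫⁻ w, k (w.2.1, w.2.2) ∂J.law =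
      ∫⁻ w, (∫⁻ y, ENNReal.ofReal (J.condY y w.2.2) * k (y, w.2.2)) ∂J.law := by
  have h1 : Measurable fun w : Sample dx dy dz => k (w.2.1, w.2.2) := hk.comp (by fun_prop)
  have h2 : Measurable fun z : Eu dz => ∫⁻ y, ENNReal.ofReal (J.condY y z) * k (y, z) :=
    Measurable.lintegral_prod_left' (f := fun q : Eu dy × Eu dz =>
      ENNReal.ofReal (J.condY q.1 q.2) * k (q.1, q.2)) (J.measurable_condY.ennreal_ofReal.mul hk)
  have h2' : Measurable fun w : Sample dx dy dz =>
      ∫⁻ y, ENNReal.ofReal (J.condY y w.2.2) * k (y, w.2.2) := h2.comp (by fun_prop)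
  rw [J.lintegral_law h1, J.lintegral_law h2']
  refine lintegral_congr fun z => ?_
  congr 1
  have h3 : ∀ x : Eu dx, ∫⁻ y, ENNReal.ofReal (J.cond x y z) *
      ∫⁻ y, ENNReal.ofReal (J.condY y z) * k (y, z) =
      (∫⁻ y, ENNReal.ofReal (J.cond x y z)) * ∫⁻ y, ENNReal.ofReal (J.condY y z) * k (y, z) :=
    fun x => lintegral_mul_const _ ((J.measurable_cond_xy z).comp measurable_prodMk_left)
  change _ = ∫⁻ x : Eu dx, ∫⁻ y, ENNReal.ofReal (J.cond x y z) *
      ∫⁻ y, ENNReal.ofReal (J.condY y z) * k (y, z)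
  simp_rw [h3]
  rw [lintegral_mul_const _ (J.measurable_cond_xy z).lintegral_prod_right', J.lintegral_cond,
    one_mul, J.lintegral_condY_mul z (k := fun y => k (y, z)) (hk.comp measurable_prodMk_right)]

end JointDensity

/-! ### The law of the nearest neighbour -/

section Nearest

variable {dx dy dz n : ℕ} [NeZero n]

lemma nearest_congr (z : Eu dz) {v w : Fin n → Sample dx dy dz}
    (h : ∀ j, (v j).2.2 = (w j).2.2) : nearest z v = nearest z w := by
  simp only [nearest, h]

lemma measurable_nearest :
    Measurable fun p : Eu dz × (Fin n → Sample dx dy dz) => nearest p.1 p.2 := by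
  have hS : ∀ j : Fin n, MeasurableSet {p : Eu dz × (Fin n → Sample dx dy dz) |
      ∀ k, dist p.1 (p.2 j).2.2 ≤ dist p.1 (p.2 k).2.2} := fun j => by
    rw [Set.ofPred_forall]
    exact MeasurableSet.iInter fun k => measurableSet_le (by fun_prop) (by fun_prop)
  refine measurable_to_countable' fun j => ?_
  have : (fun p : Eu dz × (Fin n → Sample dx dy dz) => nearest p.1 p.2) ⁻¹' {j} =
      {p | ∀ k, dist p.1 (p.2 j).2.2 ≤ dist p.1 (p.2 k).2.2} ∩
      ⋂ i : {i : Fin n // i < j}, {p | ∀ k, dist p.1 (p.2 i.1).2.2 ≤ dist p.1 (p.2 k).2.2}ᶜ := by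
    ext p
    simp only [Set.mem_preimage, Set.mem_singleton_iff, nearest, Finset.min'_eq_iff,
      Finset.mem_filter, Finset.mem_univ, true_and, Set.mem_inter_iff, Set.mem_ofPred_eq,
      Set.mem_iInter, Set.mem_compl_iff, Subtype.forall]
    exact and_congr_right fun _ => forall_congr' fun i =>
      ⟨fun h hi hk => absurd (h hk) (not_le.2 hi), fun h hk => not_lt.1 fun hi => h hi hk⟩
  rw [this]
  exact (hS j).inter (MeasurableSet.iInter fun i => (hS i.1).compl)

lemma measurable_nearest_z :
    Measurable fun p : Eu dz × (Fin n → Sample dx dy dz) => (p.2 (nearest p.1 p.2)).2.2 := by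
  have h : Measurable fun q : Fin n × (Fin n → Sample dx dy dz) => (q.2 q.1).2.2 :=
    measurable_from_prod_countable_right fun j =>
      (by fun_prop : Measurable fun v : Fin n → Sample dx dy dz => (v j).2.2)
  exact h.comp (measurable_nearest.prodMk measurable_snd)

lemma measurableSet_nearest_eq (z : Eu dz) (j : Fin n) :
    MeasurableSet {v : Fin n → Sample dx dy dz | nearest z v = j} := by
  have h : Measurable ((fun p : Eu dz × (Fin n → Sample dx dy dz) => nearest p.1 p.2) ∘ Prod.mk z) :=
    measurable_nearest.comp measurable_prodMk_left
  exact h (measurableSet_singleton j)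

lemma lintegral_nearest_eq_sum (z : Eu dz) (μ : Measure (Fin n → Sample dx dy dz))
    {a : Sample dx dy dz → ℝ≥0∞} (ha : Measurable a) :
    ∫⁻ v, a (v (nearest z v)) ∂μ =
      ∑ j, ∫⁻ v, {v : Fin n → Sample dx dy dz | nearest z v = j}.indicator (fun v => a (v j)) v ∂μ := by
  rw [← lintegral_finsetSum _ fun j _ => by
    exact (ha.comp (measurable_pi_apply j)).indicator (measurableSet_nearest_eq z j)]
  refine lintegral_congr fun v => ?_
  rw [Finset.sum_eq_single (nearest z v)]
  · rw [Set.indicator_of_mem (by exact rfl)]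
  · exact fun j _ hj => Set.indicator_of_notMem (fun h => hj h.symm) _
  · simp

lemma nearest_update_eq (z : Eu dz) (v : Fin n → Sample dx dy dz) (j : Fin n)
    (w : Sample dx dy dz) : nearest z (Function.update v j w) =
      nearest z (Function.update v j (0, 0, w.2.2)) := by
  refine nearest_congr z fun i => ?_
  by_cases hi : i = j
  · subst hi; simp
  · simp [hi]

lemma measurable_resampled (J : JointDensity dx dy dz) {k : Eu dy → ℝ≥0∞} (hk : Measurable k) :
    Measurable fun z => ∫⁻ y, ENNReal.ofReal (J.condY y z) * k y :=
  Measurable.lintegral_prod_left' (f := fun q : Eu dy × Eu dz =>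
    ENNReal.ofReal (J.condY q.1 q.2) * k q.1)
    (J.measurable_condY.ennreal_ofReal.mul (hk.comp measurable_fst))

lemma lintegral_indicator_yz (J : JointDensity dx dy dz) {k : Eu dy → ℝ≥0∞} (hk : Measurable k)
    {S : Set (Eu dz)} (hS : MeasurableSet S) :
    ∫⁻ w, S.indicator (fun _ => k w.2.1) w.2.2 ∂J.law =
      ∫⁻ w, S.indicator (fun z => ∫⁻ y, ENNReal.ofReal (J.condY y z) * k y) w.2.2 ∂J.law := by
  have hkk : Measurable fun q : Eu dy × Eu dz => S.indicator (fun _ => k q.1) q.2 :=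
    (hk.comp measurable_fst).indicator (hS.preimage measurable_snd)
  refine (J.lintegral_law_yz hkk).trans (lintegral_congr fun w => ?_)
  by_cases hw : w.2.2 ∈ S <;> simp [hw]

/-- The choice of the nearest neighbour involves only the `z`-coordinates, so its `y`-coordinate
still has density `f(y | z)` at its own `z`. -/
lemma lintegral_nearest_y (J : JointDensity dx dy dz) (z : Eu dz) {k : Eu dy → ℝ≥0∞}
    (hk : Measurable k) :
    ∫⁻ v, k (v (nearest z v)).2.1 ∂(Measure.pi fun _ : Fin n => J.law) =
      ∫⁻ v, (∫⁻ y, ENNReal.ofReal (J.condY y (v (nearest z v)).2.2) * k y)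
        ∂(Measure.pi fun _ : Fin n => J.law) := by
  have hΦ := measurable_resampled J hk
  generalize hΦe : (fun z' => ∫⁻ y, ENNReal.ofReal (J.condY y z') * k y) = Φ at hΦ
  have e0 : ∀ z', ∫⁻ y, ENNReal.ofReal (J.condY y z') * k y = Φ z' := fun z' => congrFun hΦe z'
  simp only [e0]
  have m1 : Measurable fun w : Sample dx dy dz => k w.2.1 := hk.comp (by fun_prop)
  have m2 : Measurable fun w : Sample dx dy dz => Φ w.2.2 := hΦ.comp (by fun_prop)
  have s1 := lintegral_nearest_eq_sum z (Measure.pi fun _ : Fin n => J.law) m1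
  have s2 := lintegral_nearest_eq_sum z (Measure.pi fun _ : Fin n => J.law) m2
  refine s1.trans (Eq.trans (Finset.sum_congr rfl fun j _ => ?_) s2.symm)
  refine lintegral_eq_of_lmarginal_eq {j}
    ((m1.comp (measurable_pi_apply j)).indicator (measurableSet_nearest_eq z j))
    ((m2.comp (measurable_pi_apply j)).indicator (measurableSet_nearest_eq z j)) ?_
  funext v
  rw [lmarginal_singleton, lmarginal_singleton]
  set S : Set (Eu dz) := {a | nearest z (Function.update v j ((0, 0, a) : Sample dx dy dz)) = j}
    with hSdef
  have hSm : MeasurableSet S := (measurableSet_nearest_eq z j).preimage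
    (by fun_prop : Measurable fun a : Eu dz => Function.update v j ((0, 0, a) : Sample dx dy dz))
  have e1 : ∀ a : Sample dx dy dz → ℝ≥0∞, ∀ w : Sample dx dy dz,
      {v : Fin n → Sample dx dy dz | nearest z v = j}.indicator (fun v => a (v j))
        (Function.update v j w) = S.indicator (fun _ => a w) w.2.2 := fun a w => by
    have hup : Function.update v j w ∈ {v : Fin n → Sample dx dy dz | nearest z v = j} ↔
        w.2.2 ∈ S := by
      rw [hSdef, Set.mem_ofPred_eq, Set.mem_ofPred_eq, nearest_update_eq]
    by_cases hw : w.2.2 ∈ S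
    · rw [Set.indicator_of_mem hw, Set.indicator_of_mem (hup.2 hw), Function.update_self]
    · rw [Set.indicator_of_notMem hw, Set.indicator_of_notMem (mt hup.1 hw)]
  refine (lintegral_congr (e1 fun w => k w.2.1)).trans
    (Eq.trans ?_ (lintegral_congr (e1 fun w => Φ w.2.2)).symm)
  refine (lintegral_indicator_yz J hk hSm).trans (lintegral_congr fun w => ?_)
  rw [hΦe]
  rfl

/-- A bootstrapped sample is drawn like one from `f^CI`, but with `y` drawn given the `z` of the
nearest neighbour. -/
lemma lintegral_lawBoot (J : JointDensity dx dy dz) {h : Sample dx dy dz → ℝ≥0∞}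
    (hh : Measurable h) :
    ∫⁻ u, h u ∂(J.lawBoot n) = ∫⁻ q, J.resample h q.1 (q.2 (nearest q.1.2.2 q.2)).2.2
      ∂(J.law.prod (Measure.pi fun _ : Fin n => J.law)) := by
  rw [JointDensity.lawBoot, lintegral_map hh measurable_bootstrap,
    lintegral_prod _ (by exact (hh.comp measurable_bootstrap).aemeasurable), lintegral_prod _ (by
      refine Measurable.aemeasurable ?_
      exact (J.measurable_resample hh).comp (measurable_fst.prodMk
        (measurable_nearest_z.comp (by fun_prop :
          Measurable fun q : Sample dx dy dz × (Fin n → Sample dx dy dz) => (q.1.2.2, q.2)))))]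
  refine lintegral_congr fun u => ?_
  exact lintegral_nearest_y J u.2.2 (k := fun y => h (u.1, y, u.2.2)) (hh.comp (by fun_prop))

end Nearest

/-! ### Continuity of the conditional density in `z` -/

/-- A Lipschitz bound at small scales extends to all scales along segments, by the triangle
inequality. -/
lemma le_mul_norm_sub_of_forall_norm_sub_le {E : Type*} [NormedAddCommGroup E] [NormedSpace ℝ E]
    {D : E → E → ℝ} (hD : ∀ x y z, D x z ≤ D x y + D y z) {ε Λ : ℝ} (hε : 0 < ε)
    (h : ∀ x y, ‖y - x‖ ≤ ε → D x y ≤ Λ * ‖y - x‖) (x y : E) : D x y ≤ Λ * ‖y - x‖ := by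
  have key : ∀ n : ℕ, ∀ x y : E, ‖y - x‖ ≤ n * ε → D x y ≤ Λ * ‖y - x‖ := by
    intro n
    induction n with
    | zero => exact fun x y hxy => h x y (by simp at hxy; simp [hxy, hε.le])
    | succ n ih =>
      intro x y hxy
      push_cast at hxy
      set t : ℝ := 1 / (n + 1) with ht
      have hn : (0 : ℝ) < n + 1 := by positivity
      have ht0 : 0 ≤ t := by positivity
      have ht1 : t ≤ 1 := by rw [ht, div_le_one hn]; linarith [Nat.cast_nonneg (α := ℝ) n]
      have e1 : ‖x + t • (y - x) - x‖ = t * ‖y - x‖ := by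
        rw [add_sub_cancel_left, norm_smul, Real.norm_of_nonneg ht0]
      have e2 : ‖y - (x + t • (y - x))‖ = (1 - t) * ‖y - x‖ := by
        rw [show y - (x + t • (y - x)) = (1 - t) • (y - x) by module, norm_smul,
          Real.norm_of_nonneg (by linarith)]
      have h1 : t * ‖y - x‖ ≤ ε := by
        rw [ht, one_div, inv_mul_le_iff₀ hn]; exact hxy
      have h2 : (1 - t) * ‖y - x‖ ≤ n * ε := by
        have e3 : 1 - t = n * t := by rw [ht]; field_simp; ring
        rw [e3, mul_assoc]
        exact mul_le_mul_of_nonneg_left h1 (Nat.cast_nonneg n)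
      have h3 := h x _ (e1.trans_le h1)
      have h4 := ih _ y (e2.trans_le h2)
      rw [e1] at h3
      rw [e2] at h4
      linarith [hD x (x + t • (y - x)) y]
  obtain ⟨n, hn⟩ := exists_nat_ge (‖y - x‖ / ε)
  exact key n x y ((div_le_iff₀ hε).1 hn)

namespace JointDensity

variable {dx dy dz : ℕ} {J : JointDensity dx dy dz} {ε₁ β : ℝ}

lemma klTo_self (z : Eu dz) : J.klTo z z = 0 := by
  have h : ∀ y, J.klIntegrand z z y = 0 := fun y => by
    rcases eq_or_ne (J.condY y z) 0 with h | h <;> simp [klIntegrand, h]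
  simp [klTo, h]

variable (J) in
/-- The `L¹` distance of the densities `f(y | z)` and `f(y | a)`. -/
noncomputable def condDist (z a : Eu dz) : ℝ := ∫ y, |J.condY y z - J.condY y a|

lemma condDist_triangle (a b c : Eu dz) : J.condDist a c ≤ J.condDist a b + J.condDist b c := by
  have hi : ∀ a b : Eu dz, Integrable fun y => |J.condY y a - J.condY y b| := fun a b =>
    ((J.integrable_condY a).sub (J.integrable_condY b)).abs
  rw [condDist, condDist, condDist, ← integral_add (hi a b) (hi b c)]
  exact integral_mono (hi a c) ((hi a b).add (hi b c)) fun y => abs_sub_le _ _ _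

lemma sq_condDist_le (hJ : J.SmoothCond ε₁ β) {z a : Eu dz} (h : ‖a - z‖ ≤ ε₁) :
    J.condDist z a ^ 2 ≤ 4 * J.klTo z a :=
  sq_integral_abs_sub_le (fun y => J.condY_nonneg y z) (fun y => J.condY_nonneg y a)
    (J.measurable_condY_left z) (J.measurable_condY_left a) (J.integrable_condY z)
    (J.integrable_condY a) (J.integral_condY z) (J.integral_condY a) (hJ.support z a h)
    (hJ.integrable z a h)

lemma klTo_nonneg (hJ : J.SmoothCond ε₁ β) {z a : Eu dz} (h : ‖a - z‖ ≤ ε₁) : 0 ≤ J.klTo z a := by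
  linarith [sq_condDist_le hJ h, sq_nonneg (J.condDist z a)]

/-- The divergence `z' ↦ D_z(z')` has a zero minimum at `z`, so the Hessian bound controls it near `z`. -/
lemma klTo_le (hJ : J.SmoothCond ε₁ β) (hε₁ : 0 < ε₁) {z a : Eu dz} (h : ‖a - z‖ ≤ ε₁) :
    J.klTo z a ≤ β / 2 * ‖a - z‖ ^ 2 := by
  have hmin : IsLocalMin (J.klTo z) z := by
    filter_upwards [Metric.closedBall_mem_nhds z hε₁] with b hb
    rw [klTo_self]
    exact klTo_nonneg hJ (by rwa [mem_closedBall_iff_norm] at hb)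
  have hseg : ∀ t ∈ Set.Icc (0 : ℝ) 1, ‖z + t • (a - z) - z‖ ≤ ε₁ := fun t ht => by
    rw [add_sub_cancel_left, norm_smul, Real.norm_of_nonneg ht.1]
    exact (mul_le_of_le_one_left (norm_nonneg _) ht.2).trans h
  have := le_half_mul_sq_of_fderiv_fderiv_le (F := J.klTo z) (v := a - z) (klTo_self z)
    hmin.fderiv_eq_zero (fun t ht => hJ.contDiffAt z _ (hseg t ht)) fun t ht =>
    fderiv_fderiv_self_le (hJ.contDiffAt z _ (hseg t ht)) (hJ.eigenvalue_le z _ (hseg t ht)) _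
  rwa [add_sub_cancel] at this

/-- The conditional density `f(y | z)` depends Lipschitz continuously on `z` in `L¹`. -/
lemma condDist_le (hJ : J.SmoothCond ε₁ β) (hε₁ : 0 < ε₁) (z a : Eu dz) :
    J.condDist z a ≤ √(2 * β) * ‖a - z‖ := by
  refine le_mul_norm_sub_of_forall_norm_sub_le condDist_triangle hε₁ (fun z a h => ?_) z a
  have h1 : J.condDist z a ^ 2 ≤ 2 * β * ‖a - z‖ ^ 2 := by
    linarith [sq_condDist_le hJ h, klTo_le hJ hε₁ h]
  have h2 := Real.le_sqrt_of_sq_le h1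
  rwa [Real.sqrt_mul' _ (sq_nonneg _), Real.sqrt_sq (norm_nonneg _)] at h2

section Resample

variable {P : Sample dx dy dz → ℝ}

variable (J) in
/-- The real form of `resample`. -/
noncomputable def resampleReal (P : Sample dx dy dz → ℝ) (u : Sample dx dy dz) (z' : Eu dz) : ℝ :=
  (J.resample (fun u => ENNReal.ofReal (P u)) u z').toReal

lemma resample_le_one (hP1 : ∀ u, P u ≤ 1) (u : Sample dx dy dz) (z' : Eu dz) :
    J.resample (fun u => ENNReal.ofReal (P u)) u z' ≤ 1 := by
  rw [← J.resample_one u z']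
  refine lintegral_mono fun y => ?_
  gcongr
  exact (ENNReal.ofReal_le_ofReal (hP1 _)).trans_eq ENNReal.ofReal_one

lemma resampleReal_mem_Icc (hP1 : ∀ u, P u ≤ 1) (u : Sample dx dy dz) (z' : Eu dz) :
    J.resampleReal P u z' ∈ Set.Icc (0 : ℝ) 1 :=
  ⟨ENNReal.toReal_nonneg, ENNReal.toReal_le_of_le_ofReal zero_le_one
    ((resample_le_one hP1 u z').trans_eq ENNReal.ofReal_one.symm)⟩

lemma measurable_resampleReal (hP : Measurable P) :
    Measurable fun p : Sample dx dy dz × Eu dz => J.resampleReal P p.1 p.2 :=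
  (J.measurable_resample hP.ennreal_ofReal).ennreal_toReal

lemma integrable_condY_mul (hP : Measurable P) (hP0 : ∀ u, 0 ≤ P u) (hP1 : ∀ u, P u ≤ 1)
    (u : Sample dx dy dz) (z' : Eu dz) :
    Integrable fun y => J.condY y z' * P (u.1, y, u.2.2) := by
  refine (J.integrable_condY z').mul_bdd (c := 1) ?_ (ae_of_all _ fun y => ?_)
  · exact (hP.comp (by fun_prop :
      Measurable fun y : Eu dy => ((u.1, y, u.2.2) : Sample dx dy dz))).aestronglyMeasurable
  · rw [Real.norm_of_nonneg (hP0 _)]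
    exact hP1 _

lemma resampleReal_eq_integral (hP : Measurable P) (hP0 : ∀ u, 0 ≤ P u) (hP1 : ∀ u, P u ≤ 1)
    (u : Sample dx dy dz) (z' : Eu dz) :
    J.resampleReal P u z' = ∫ y, J.condY y z' * P (u.1, y, u.2.2) := by
  rw [integral_eq_lintegral_of_nonneg_ae
    (ae_of_all _ fun y => mul_nonneg (J.condY_nonneg _ _) (hP0 _))
    (integrable_condY_mul hP hP0 hP1 u z').1]
  simp_rw [ENNReal.ofReal_mul (J.condY_nonneg _ _)]
  rfl

lemma abs_resampleReal_sub_le (hP : Measurable P) (hP0 : ∀ u, 0 ≤ P u) (hP1 : ∀ u, P u ≤ 1)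
    (u : Sample dx dy dz) (a b : Eu dz) :
    |J.resampleReal P u a - J.resampleReal P u b| ≤ J.condDist b a := by
  have ha := integrable_condY_mul (J := J) hP hP0 hP1 u a
  have hb := integrable_condY_mul (J := J) hP hP0 hP1 u b
  rw [resampleReal_eq_integral hP hP0 hP1, resampleReal_eq_integral hP hP0 hP1,
    ← integral_sub ha hb]
  refine abs_integral_le_integral_abs.trans (integral_mono (ha.sub hb).abs
    ((J.integrable_condY b).sub (J.integrable_condY a)).abs fun y => ?_)
  simp only
  rw [← sub_mul, abs_mul, abs_of_nonneg (hP0 _), abs_sub_comm (J.condY y b)]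
  exact mul_le_of_le_one_right (abs_nonneg _) (hP1 _)

lemma integral_lawCI (hP : Measurable P) (hP0 : ∀ u, 0 ≤ P u) (hP1 : ∀ u, P u ≤ 1) :
    ∫ u, P u ∂J.lawCI = ∫ u, J.resampleReal P u u.2.2 ∂J.law := by
  rw [integral_eq_lintegral_of_nonneg_ae (ae_of_all _ hP0) hP.aestronglyMeasurable,
    J.lintegral_lawCI hP.ennreal_ofReal]
  refine (integral_toReal ?_ (ae_of_all _ fun u =>
    (resample_le_one hP1 u _).trans_lt ENNReal.one_lt_top)).symm
  exact ((J.measurable_resample hP.ennreal_ofReal).comp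
    (by fun_prop : Measurable fun u : Sample dx dy dz => (u, u.2.2))).aemeasurable

end Resample

end JointDensity

/-! ### The bootstrap and conditional independence -/

section BootVsCI

variable {dx dy dz n : ℕ} [NeZero n] {J : JointDensity dx dy dz} {P : Sample dx dy dz → ℝ}

lemma measurable_nearest_z_pair :
    Measurable fun q : Sample dx dy dz × (Fin n → Sample dx dy dz) =>
      (q.1, (q.2 (nearest q.1.2.2 q.2)).2.2) :=
  measurable_fst.prodMk (measurable_nearest_z.comp (by fun_prop :
    Measurable fun q : Sample dx dy dz × (Fin n → Sample dx dy dz) => (q.1.2.2, q.2)))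

lemma integral_lawBoot_eq_resampleReal (hP : Measurable P) (hP0 : ∀ u, 0 ≤ P u)
    (hP1 : ∀ u, P u ≤ 1) : ∫ u, P u ∂(J.lawBoot n) =
      ∫ q, J.resampleReal P q.1 (q.2 (nearest q.1.2.2 q.2)).2.2
        ∂(J.law.prod (Measure.pi fun _ : Fin n => J.law)) := by
  rw [integral_eq_lintegral_of_nonneg_ae (ae_of_all _ hP0) hP.aestronglyMeasurable,
    lintegral_lawBoot J hP.ennreal_ofReal]
  refine (integral_toReal ?_ (ae_of_all _ fun q : Sample dx dy dz × (Fin n → Sample dx dy dz) =>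
    (JointDensity.resample_le_one hP1 q.1 _).trans_lt ENNReal.one_lt_top)).symm
  exact ((J.measurable_resample hP.ennreal_ofReal).comp measurable_nearest_z_pair).aemeasurable

/-- If `f(y | z)` does not depend on `z`, the bootstrap gives exactly `f^CI`. -/
lemma integral_lawBoot_eq_integral_lawCI (hP : Measurable P) (hP0 : ∀ u, 0 ≤ P u)
    (hP1 : ∀ u, P u ≤ 1) (hD : ∀ z a, J.condDist z a ≤ 0) :
    ∫ u, P u ∂(J.lawBoot n) = ∫ u, P u ∂J.lawCI := by
  rw [integral_lawBoot_eq_resampleReal hP hP0 hP1, JointDensity.integral_lawCI hP hP0 hP1]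
  have h : ∀ q : Sample dx dy dz × (Fin n → Sample dx dy dz),
      J.resampleReal P q.1 (q.2 (nearest q.1.2.2 q.2)).2.2 = J.resampleReal P q.1 q.1.2.2 :=
    fun q => sub_eq_zero.1 <| abs_nonpos_iff.1 <|
      (JointDensity.abs_resampleReal_sub_le hP hP0 hP1 q.1 _ _).trans (hD _ _)
  simp_rw [h]
  have := integral_fun_fst (μ := J.law) (ν := Measure.pi fun _ : Fin n => J.law)
    fun u => J.resampleReal P u u.2.2
  simpa using this

/-- The bootstrap changes the mean of a test function by no more than the probability that the
nearest neighbour is far off, plus the `L¹` modulus of continuity of `f(y | z)` in `z`. -/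
lemma abs_integral_lawBoot_sub_lawCI_le (hP : Measurable P) (hP0 : ∀ u, 0 ≤ P u)
    (hP1 : ∀ u, P u ≤ 1) {Λ : ℝ} (hΛ : 0 ≤ Λ) (hD : ∀ z a, J.condDist z a ≤ Λ * ‖a - z‖)
    {K : Set (Eu dz)} (hK : MeasurableSet K) {s p : ℝ} (hs : 0 ≤ s)
    (hp : ∀ z ∈ K, p ≤ J.law.real {u | dist z u.2.2 ≤ s}) :
    |∫ u, P u ∂(J.lawBoot n) - ∫ u, P u ∂J.lawCI| ≤
      J.law.real {u | u.2.2 ∉ K} + Real.exp (-(n * p)) + Λ * s := by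
  set π : Measure (Fin n → Sample dx dy dz) := Measure.pi fun _ => J.law with hπ
  have hKc : MeasurableSet {u : Sample dx dy dz | u.2.2 ∉ K} := hK.compl.preimage (by fun_prop)
  have hF := measurableSet_farSet (n := n) (dx := dx) (dy := dy) hK s
  set F := {q : Sample dx dy dz × (Fin n → Sample dx dy dz) | q.1 ∈ farSet K s q.2} with hFdef
  have hcom : ∫ u, J.resampleReal P u u.2.2 ∂J.law =
      ∫ q, J.resampleReal P q.1 q.1.2.2 ∂(J.law.prod π) := by
    have := integral_fun_fst (μ := J.law) (ν := π) fun u => J.resampleReal P u u.2.2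
    simpa using this.symm
  have hbdd : ∀ {φ : Sample dx dy dz × (Fin n → Sample dx dy dz) → Eu dz},
      Measurable (fun q => (q.1, φ q)) →
      Integrable (fun q => J.resampleReal P q.1 (φ q)) (J.law.prod π) := fun {φ} hφ => by
    refine Integrable.of_bound
      ((JointDensity.measurable_resampleReal hP).comp hφ).aestronglyMeasurable 1
      (ae_of_all _ fun q => ?_)
    have h := JointDensity.resampleReal_mem_Icc (J := J) hP1 q.1 (φ q)
    rw [Real.norm_of_nonneg h.1]
    exact h.2
  have i1 := hbdd (φ := fun q => (q.2 (nearest q.1.2.2 q.2)).2.2) measurable_nearest_z_pair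
  have i2 := hbdd (φ := fun q => q.1.2.2) (by fun_prop)
  have iK : Integrable (fun q : Sample dx dy dz × (Fin n → Sample dx dy dz) =>
      {u : Sample dx dy dz | u.2.2 ∉ K}.indicator (1 : Sample dx dy dz → ℝ) q.1) (J.law.prod π) :=
    ((integrable_const (1 : ℝ)).indicator hKc).comp_fst π
  have iF : Integrable (F.indicator (1 : Sample dx dy dz × (Fin n → Sample dx dy dz) → ℝ)) (J.law.prod π) :=
    (integrable_const (1 : ℝ)).indicator hF
  have hpt : ∀ q : Sample dx dy dz × (Fin n → Sample dx dy dz),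
      |J.resampleReal P q.1 (q.2 (nearest q.1.2.2 q.2)).2.2 - J.resampleReal P q.1 q.1.2.2| ≤
        {u : Sample dx dy dz | u.2.2 ∉ K}.indicator (1 : Sample dx dy dz → ℝ) q.1 +
          F.indicator (1 : Sample dx dy dz × (Fin n → Sample dx dy dz) → ℝ) q + Λ * s := by
    rintro ⟨u, v⟩
    have h1 := JointDensity.resampleReal_mem_Icc (J := J) hP1 u (v (nearest u.2.2 v)).2.2
    have h2 := JointDensity.resampleReal_mem_Icc (J := J) hP1 u u.2.2
    have h3 : |J.resampleReal P u (v (nearest u.2.2 v)).2.2 - J.resampleReal P u u.2.2| ≤ 1 :=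
      abs_le.2 ⟨by linarith [h1.1, h2.2], by linarith [h1.2, h2.1]⟩
    have h4 : 0 ≤ Λ * s := mul_nonneg hΛ hs
    have h5 : 0 ≤ F.indicator (1 : Sample dx dy dz × (Fin n → Sample dx dy dz) → ℝ) (u, v) := Set.indicator_nonneg (by simp) _
    by_cases hu : u.2.2 ∈ K
    · rw [Set.indicator_of_notMem (by simpa using hu), zero_add]
      by_cases hf : (u, v) ∈ F
      · rw [Set.indicator_of_mem hf, Pi.one_apply]
        linarith
      · rw [Set.indicator_of_notMem hf, zero_add]
        have hex : ∃ j, dist u.2.2 (v j).2.2 ≤ s := by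
          by_contra! hno
          exact hf ⟨hu, hno⟩
        obtain ⟨j, hj⟩ := hex
        have h6 : ‖(v (nearest u.2.2 v)).2.2 - u.2.2‖ ≤ s := by
          rw [← dist_eq_norm, dist_comm]
          exact (dist_nearest_le u.2.2 v j).trans hj
        exact (JointDensity.abs_resampleReal_sub_le hP hP0 hP1 u _ _).trans
          ((hD _ _).trans (mul_le_mul_of_nonneg_left h6 hΛ))
    · rw [Set.indicator_of_mem (by exact hu), Pi.one_apply]
      linarith
  rw [integral_lawBoot_eq_resampleReal hP hP0 hP1, JointDensity.integral_lawCI hP hP0 hP1, hcom,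
    ← integral_sub i1 i2]
  refine abs_integral_le_integral_abs.trans ((integral_mono (i1.sub i2).abs
    ((iK.add iF).add (integrable_const _)) hpt).trans ?_)
  have eK : ∫ q, {u : Sample dx dy dz | u.2.2 ∉ K}.indicator (1 : Sample dx dy dz → ℝ) q.1
      ∂(J.law.prod π) = J.law.real {u | u.2.2 ∉ K} := by
    have := integral_fun_fst (μ := J.law) (ν := π)
      ({u : Sample dx dy dz | u.2.2 ∉ K}.indicator (1 : Sample dx dy dz → ℝ))
    rw [this, integral_indicator_one hKc]
    simp
  have eF : ∫ q, F.indicator (1 : Sample dx dy dz × (Fin n → Sample dx dy dz) → ℝ) q ∂(J.law.prod π) ≤ Real.exp (-(n * p)) := by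
    rw [integral_prod_symm _ iF]
    refine le_trans (le_of_eq (integral_congr_ae (ae_of_all _ fun v => ?_)))
      (integral_farMass_le (n := n) hK hp)
    exact integral_indicator_one (measurableSet_farSet_section hK s v)
  have e : ∫ q, ({u : Sample dx dy dz | u.2.2 ∉ K}.indicator (1 : Sample dx dy dz → ℝ) q.1 +
      F.indicator (1 : Sample dx dy dz × (Fin n → Sample dx dy dz) → ℝ) q + Λ * s) ∂(J.law.prod π) =
      ∫ q, {u : Sample dx dy dz | u.2.2 ∉ K}.indicator (1 : Sample dx dy dz → ℝ) q.1
        ∂(J.law.prod π) + ∫ q, F.indicator (1 : Sample dx dy dz × (Fin n → Sample dx dy dz) → ℝ) q ∂(J.law.prod π) + Λ * s := by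
    have e1 := integral_add (iK.add iF) (integrable_const (μ := J.law.prod π) (Λ * s))
    have e2 := integral_add iK iF
    simp only [Pi.add_apply] at e1
    rw [e1, e2]
    simp
  refine e.trans_le ?_
  rw [eK]
  linarith

end BootVsCI

/-! ### Total variation, Bayes risk, and the bound `b(n)` -/

section TotalVariation

variable {α : Type*} [MeasurableSpace α] {μ ν ν' : Measure α} [IsProbabilityMeasure μ]
  [IsProbabilityMeasure ν]

lemma integral_mem_Icc {p : α → ℝ} (hp : ∀ a, p a ∈ Set.Icc (0 : ℝ) 1) :
    ∫ a, p a ∂μ ∈ Set.Icc (0 : ℝ) 1 := by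
  refine ⟨integral_nonneg fun a => (hp a).1, ?_⟩
  have h := norm_integral_le_of_norm_le_const (μ := μ) (C := 1) (f := p) (ae_of_all _ fun a => by
    rw [Real.norm_of_nonneg (hp a).1]
    exact (hp a).2)
  simpa using (le_abs_self _).trans h

lemma abs_integral_sub_le_tvDist {p : α → ℝ} (hpm : Measurable p)
    (hp : ∀ a, p a ∈ Set.Icc (0 : ℝ) 1) : |∫ a, p a ∂μ - ∫ a, p a ∂ν| ≤ tvDist μ ν := by
  refine le_csSup ⟨1, ?_⟩ ⟨p, hpm, hp, rfl⟩
  rintro r ⟨q, -, hq, rfl⟩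
  have h1 := integral_mem_Icc (μ := μ) hq
  have h2 := integral_mem_Icc (μ := ν) hq
  exact abs_le.2 ⟨by linarith [h1.1, h2.2], by linarith [h1.2, h2.1]⟩

lemma tvDist_le_add {b : ℝ} (h : ∀ p : α → ℝ, Measurable p → (∀ a, p a ∈ Set.Icc (0 : ℝ) 1) →
    |∫ a, p a ∂ν' - ∫ a, p a ∂ν| ≤ b) : tvDist μ ν' ≤ tvDist μ ν + b := by
  refine csSup_le ⟨_, 0, measurable_const, fun _ => by simp, rfl⟩ ?_
  rintro r ⟨p, hpm, hp, rfl⟩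
  have h1 := abs_integral_sub_le_tvDist (μ := μ) (ν := ν) hpm hp
  have h2 := h p hpm hp
  rw [abs_sub_comm] at h2
  linarith [abs_sub_le (∫ a, p a ∂μ) (∫ a, p a ∂ν) (∫ a, p a ∂ν')]

end TotalVariation

/-- A classifier is a test of the two class laws, so the risk of the `0`-`1` loss is at least the
Bayes risk. -/
lemma half_one_sub_tvDist_le_risk {dx dy dz n : ℕ} [NeZero n] (J : JointDensity dx dy dz)
    {g : Sample dx dy dz → Bool} (hg : Measurable g) :
    1 / 2 * (1 - tvDist J.law (J.lawBoot n)) ≤ risk zeroOneLoss (J.lawLabelled n) g := by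
  set p : Sample dx dy dz → ℝ := fun u => if g u = true then 1 else 0 with hp
  have hpm : Measurable p := (measurable_of_finite fun b : Bool => if b = true then (1 : ℝ) else 0).comp hg
  have hp01 : ∀ u, p u ∈ Set.Icc (0 : ℝ) 1 := fun u => by
    by_cases h : g u = true <;> simp [hp, h]
  have h1 : ∀ u, zeroOneLoss (g u) true = 1 - p u := fun u => by
    by_cases h : g u = true <;> simp [hp, h, zeroOneLoss]
  have h0 : ∀ u, zeroOneLoss (g u) false = p u := fun u => by
    by_cases h : g u = true <;> simp [hp, h, zeroOneLoss]
  have hint : Integrable p J.law := Integrable.of_bound hpm.aestronglyMeasurable 1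
    (ae_of_all _ fun u => by rw [Real.norm_of_nonneg (hp01 u).1]; exact (hp01 u).2)
  rw [risk_lawLabelled J zeroOneLoss hg]
  simp_rw [h1, h0]
  rw [integral_sub (integrable_const _) hint]
  have h := (le_abs_self _).trans (abs_integral_sub_le_tvDist (μ := J.law) (ν := J.lawBoot n) hpm hp01)
  simp only [integral_const, probReal_univ, smul_eq_mul, mul_one]
  linarith

/-- The constant in the tail bound is positive, since the density of `Z` is not almost everywhere
zero. -/
lemma JointDensity.TailBound.pos {dx dy dz : ℕ} {J : JointDensity dx dy dz} {c₃ : ℝ}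
    (h : J.TailBound c₃) : 0 < c₃ := by
  by_contra! hc
  have he : (1 - 1 / (max dz 2 : ℕ) : ℝ) ≠ 0 := by
    have h2 : (2 : ℝ) ≤ (max dz 2 : ℕ) := by exact_mod_cast le_max_right dz 2
    have h3 : 1 / ((max dz 2 : ℕ) : ℝ) ≤ 1 / 2 := one_div_le_one_div_of_le two_pos h2
    linarith
  have h0 := h
  rw [JointDensity.TailBound, ENNReal.ofReal_of_nonpos hc, nonpos_iff_eq_zero,
    lintegral_eq_zero_iff (J.measurable_margZ.pow_const _).ennreal_ofReal] at h0
  have h1 : ∫⁻ z, ENNReal.ofReal (J.margZ z) = 0 := by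
    rw [lintegral_eq_zero_iff J.measurable_margZ.ennreal_ofReal]
    refine h0.mono fun z hz => ?_
    have h2 : J.margZ z ^ (1 - 1 / (max dz 2 : ℕ) : ℝ) = 0 :=
      le_antisymm (ENNReal.ofReal_eq_zero.1 hz) (Real.rpow_nonneg (J.margZ_nonneg z) _)
    rw [Real.rpow_eq_zero (J.margZ_nonneg z) he] at h2
    simp [h2]
  rw [J.lintegral_margZ] at h1
  exact one_ne_zero h1

lemma bootBound_eq_sqrt_div {β c₃ c ε G : ℝ} {dz n : ℕ} :
    bootBound β c₃ c ε dz n G =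
      1 / 2 * √(β / 4 * (c₃ * 2 ^ (1 / dz : ℝ) * Real.Gamma (1 / dz)) /
        (unitBallVolume dz ^ (1 / dz : ℝ) * dz) / (n : ℝ) ^ (1 / dz : ℝ) + β * ε * G / 4) +
      Real.exp (-(1 / 2) * n * unitBallVolume dz * c * ε ^ (dz + 2)) + G := by
  rw [bootBound, Real.mul_rpow (Nat.cast_nonneg n) (unitBallVolume_pos dz).le, div_div]
  congr 6
  ring

/-- With the radius `n ^ (-3 / (4 d))`, the nearest neighbour is far off with probability
`exp (-a n ^ (1 / 4))`, and this as well as the radius is negligible against `n ^ (-1 / (2 d))`. -/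
lemma exists_radius {d : ℕ} (hd : 1 ≤ d) {a A s₀ : ℝ} (Λ : ℝ) (ha : 0 < a) (hA : 0 < A)
    (hs₀ : 0 < s₀) : ∃ N : ℕ, ∀ n : ℕ, N ≤ n → ∃ s : ℝ, 0 ≤ s ∧ s ≤ s₀ ∧
      Real.exp (-(n * (a * s ^ d))) + Λ * s ≤ 1 / 2 * √(A / (n : ℝ) ^ (1 / d : ℝ)) := by
  have hd0 : (0 : ℝ) < d := by exact_mod_cast hd
  have hA' : 0 < √A := Real.sqrt_pos.2 hA
  have hn := tendsto_natCast_atTop_atTop (R := ℝ)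
  have t1 : Tendsto (fun n : ℕ => (n : ℝ) ^ (-(3 / (4 * d)) : ℝ)) atTop (𝓝 0) :=
    (tendsto_rpow_neg_atTop (by positivity)).comp hn
  have t2 : Tendsto (fun n : ℕ => Λ * (n : ℝ) ^ (-(1 / (4 * d)) : ℝ)) atTop (𝓝 0) := by
    simpa using ((tendsto_rpow_neg_atTop (y := 1 / (4 * (d : ℝ))) (by positivity)).comp hn).const_mul Λ
  have t3 : Tendsto (fun n : ℕ => ((n : ℝ) ^ (1 / 4 : ℝ)) ^ (2 / d : ℝ) *
      Real.exp (-a * (n : ℝ) ^ (1 / 4 : ℝ))) atTop (𝓝 0) :=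
    (tendsto_rpow_mul_exp_neg_mul_atTop_nhds_zero (2 / d) a ha).comp
      ((tendsto_rpow_atTop (by positivity)).comp hn)
  obtain ⟨N, hN⟩ := eventually_atTop.1 ((t1.eventually_le_const hs₀).and
    (((t2.eventually_le_const (show 0 < √A / 4 by positivity))).and
      ((t3.eventually_le_const (show 0 < √A / 4 by positivity)).and (eventually_ge_atTop 1))))
  refine ⟨N, fun n hNn => ?_⟩
  obtain ⟨h1, h2, h3, h4⟩ := hN n hNn
  have hn0 : (0 : ℝ) < n := by exact_mod_cast h4
  refine ⟨(n : ℝ) ^ (-(3 / (4 * d)) : ℝ), by positivity, h1, ?_⟩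
  set w : ℝ := (n : ℝ) ^ (-(1 / (2 * d)) : ℝ) with hw
  have hw0 : 0 < w := by positivity
  have e1 : √(A / (n : ℝ) ^ (1 / d : ℝ)) = √A * w := by
    rw [Real.sqrt_div hA.le, div_eq_mul_inv, Real.sqrt_eq_rpow ((n : ℝ) ^ (1 / d : ℝ)),
      ← Real.rpow_mul hn0.le, ← Real.rpow_neg hn0.le, hw]
    congr 3
    field_simp
  have e2 : (n : ℝ) * (a * ((n : ℝ) ^ (-(3 / (4 * d)) : ℝ)) ^ d) = a * (n : ℝ) ^ (1 / 4 : ℝ) := by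
    rw [← Real.rpow_natCast, ← Real.rpow_mul hn0.le, mul_left_comm]
    congr 1
    nth_rewrite 1 [← Real.rpow_one (n : ℝ)]
    rw [← Real.rpow_add hn0]
    congr 1
    field_simp
    norm_num
  have e3 : (n : ℝ) ^ (-(3 / (4 * d)) : ℝ) = (n : ℝ) ^ (-(1 / (4 * d)) : ℝ) * w := by
    rw [hw, ← Real.rpow_add hn0]
    congr 1
    field_simp
    norm_num
  have e4 : ((n : ℝ) ^ (1 / 4 : ℝ)) ^ (2 / d : ℝ) * w = 1 := by
    rw [hw, ← Real.rpow_mul hn0.le, ← Real.rpow_add hn0,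
      show (1 / 4 * (2 / d) + -(1 / (2 * d)) : ℝ) = 0 by field_simp; norm_num, Real.rpow_zero]
  rw [e1, e2, e3]
  have h5 : Real.exp (-(a * (n : ℝ) ^ (1 / 4 : ℝ))) ≤ √A / 4 * w := by
    have := mul_le_mul_of_nonneg_right h3 hw0.le
    rw [mul_right_comm, e4, one_mul, neg_mul] at this
    exact this
  have h6 := mul_le_mul_of_nonneg_right h2 hw0.le
  rw [← mul_assoc]
  linarith

/-- For large `n`, every test function has nearly the same mean under `φ` and under `f^CI`. -/
lemma exists_abs_integral_lawBoot_sub_lawCI_le_bootBound {dz : ℕ} (hdz : 1 ≤ dz) (c : ℝ) (ℓ : ℝ≥0)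
    {ε₁ ε' : ℝ} (β c₃ : ℝ) (hε' : 0 < ε') (hε₁ : ε' < ε₁) :
    ∃ N : ℕ, ∀ (dx dy : ℕ) (J : JointDensity dx dy dz), J.SmoothMarg c ℓ → J.SmoothCond ε₁ β →
      J.TailBound c₃ → ∀ (n : ℕ) [NeZero n], N ≤ n →
      ∀ p : Sample dx dy dz → ℝ, Measurable p → (∀ u, p u ∈ Set.Icc (0 : ℝ) 1) →
        |∫ u, p u ∂(J.lawBoot n) - ∫ u, p u ∂J.lawCI| ≤
          bootBound β c₃ c ε' dz n (J.lowMass (2 * c * ε' ^ 2)) := by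
  have hv := unitBallVolume_pos dz
  have hd0 : (0 : ℝ) < dz := by exact_mod_cast hdz
  have hle1 : ∀ (dx dy : ℕ) (J : JointDensity dx dy dz) (n : ℕ) [NeZero n]
      (p : Sample dx dy dz → ℝ), (∀ u, p u ∈ Set.Icc (0 : ℝ) 1) →
      |∫ u, p u ∂(J.lawBoot n) - ∫ u, p u ∂J.lawCI| ≤ 1 := fun dx dy J n _ p hp => by
    have h1 := integral_mem_Icc (μ := J.lawBoot n) hp
    have h2 := integral_mem_Icc (μ := J.lawCI) hp
    exact abs_le.2 ⟨by linarith [h1.1, h2.2], by linarith [h1.2, h2.1]⟩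
  rcases le_or_gt c 0 with hc | hc
  · -- the exponential in the bound is at least one
    refine ⟨0, fun dx dy J _ _ _ n _ _ p _ hp => (hle1 dx dy J n p hp).trans ?_⟩
    have h1 : 1 ≤ Real.exp (-(1 / 2) * n * unitBallVolume dz * c * ε' ^ (dz + 2)) := by
      refine Real.one_le_exp ?_
      have h2 : 0 ≤ 1 / 2 * (n * (unitBallVolume dz * (-c * ε' ^ (dz + 2)))) := by
        have : 0 ≤ -c := by linarith
        positivity
      linarith
    have h2 := lowMass_nonneg J (2 * c * ε' ^ 2)
    rw [bootBound]
    have h3 := Real.sqrt_nonneg (β / 4 * (c₃ * 2 ^ (1 / dz : ℝ) * Real.Gamma (1 / dz)) /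
      ((n * unitBallVolume dz) ^ (1 / dz : ℝ) * dz) + β * ε' * J.lowMass (2 * c * ε' ^ 2) / 4)
    linarith
  rcases le_or_gt β 0 with hβ | hβ
  · -- the density `f(y | z)` does not depend on `z`
    refine ⟨0, fun dx dy J hJ hC _ n _ _ p hpm hp => ?_⟩
    have hD : ∀ z a, J.condDist z a ≤ 0 := fun z a => by
      have := JointDensity.condDist_le hC (hε'.trans hε₁) z a
      rwa [Real.sqrt_eq_zero_of_nonpos (by linarith), zero_mul] at this
    rw [integral_lawBoot_eq_integral_lawCI hpm (fun u => (hp u).1) (fun u => (hp u).2) hD, sub_self,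
      abs_zero, bootBound]
    have := lowMass_nonneg J (2 * c * ε' ^ 2)
    positivity
  -- in the main case, the first term of `b(n)` has order `n ^ (-1 / (2 d))`
  rcases le_or_gt c₃ 0 with hc₃ | hc₃
  · exact ⟨0, fun dx dy J _ _ hT => absurd hT.pos hc₃.not_gt⟩
  have hm : 0 < c * ε' ^ 2 := by positivity
  have hΓ : 0 < Real.Gamma (1 / dz) := Real.Gamma_pos_of_pos (by positivity)
  obtain ⟨N, hN⟩ := exists_radius hdz (a := c * ε' ^ 2 * unitBallVolume dz)
    (A := β / 4 * (c₃ * 2 ^ (1 / dz : ℝ) * Real.Gamma (1 / dz)) /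
      (unitBallVolume dz ^ (1 / dz : ℝ) * dz)) (s₀ := c * ε' ^ 2 / (ℓ + 1)) (√(2 * β))
    (by positivity) (by positivity) (by positivity)
  refine ⟨N, fun dx dy J hJ hC _ n _ hn p hpm hp => ?_⟩
  obtain ⟨s, hs, hs₀, hle⟩ := hN n hn
  have hℓs : ℓ * s ≤ c * ε' ^ 2 := by
    rw [le_div_iff₀ (by positivity)] at hs₀
    linarith
  have hK : MeasurableSet {z | 2 * c * ε' ^ 2 < J.margZ z} :=
    measurableSet_lt measurable_const J.measurable_margZ
  have hp' : ∀ z ∈ {z | 2 * c * ε' ^ 2 < J.margZ z},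
      c * ε' ^ 2 * unitBallVolume dz * s ^ dz ≤ J.law.real {u | dist z u.2.2 ≤ s} := fun z hz => by
    have h := JointDensity.le_law_real_near hJ.lipschitz z hs
    simp_rw [dist_comm _ z] at h
    refine le_trans ?_ h
    have h1 : c * ε' ^ 2 ≤ J.margZ z - ℓ * s := by
      rw [Set.mem_ofPred_eq] at hz
      linarith
    have h2 := mul_le_mul_of_nonneg_right h1 (show 0 ≤ s ^ dz * unitBallVolume dz by positivity)
    linarith
  have h := abs_integral_lawBoot_sub_lawCI_le (n := n) hpm (fun u => (hp u).1) (fun u => (hp u).2)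
    (Real.sqrt_nonneg (2 * β)) (JointDensity.condDist_le hC (hε'.trans hε₁)) hK hs hp'
  have hG : J.law.real {u : Sample dx dy dz | u.2.2 ∉ {z | 2 * c * ε' ^ 2 < J.margZ z}} =
      J.lowMass (2 * c * ε' ^ 2) := by
    simp only [Set.mem_ofPred_eq, not_lt]
    rfl
  rw [hG] at h
  refine h.trans ?_
  have hG0 := lowMass_nonneg J (2 * c * ε' ^ 2)
  have h3 : √(β / 4 * (c₃ * 2 ^ (1 / dz : ℝ) * Real.Gamma (1 / dz)) /
      (unitBallVolume dz ^ (1 / dz : ℝ) * dz) / (n : ℝ) ^ (1 / dz : ℝ)) ≤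
      √(β / 4 * (c₃ * 2 ^ (1 / dz : ℝ) * Real.Gamma (1 / dz)) /
        (unitBallVolume dz ^ (1 / dz : ℝ) * dz) / (n : ℝ) ^ (1 / dz : ℝ) +
        β * ε' * J.lowMass (2 * c * ε' ^ 2) / 4) :=
    Real.sqrt_le_sqrt (le_add_of_nonneg_right (by positivity))
  have h4 := Real.exp_pos (-(1 / 2) * n * unitBallVolume dz * c * ε' ^ (dz + 2))
  rw [bootBound_eq_sqrt_div]
  linarith

lemma abs_tvDist_lawBoot_sub_le {dx dy dz n : ℕ} [NeZero n] (J : JointDensity dx dy dz) {b : ℝ}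
    (h : ∀ p : Sample dx dy dz → ℝ, Measurable p → (∀ u, p u ∈ Set.Icc (0 : ℝ) 1) →
      |∫ u, p u ∂(J.lawBoot n) - ∫ u, p u ∂J.lawCI| ≤ b) :
    |tvDist J.law (J.lawBoot n) - tvDist J.law J.lawCI| ≤ b := by
  have h1 := tvDist_le_add (μ := J.law) h
  have h2 := tvDist_le_add (μ := J.law) (ν := J.lawBoot n) (ν' := J.lawCI) (b := b)
    fun p hpm hp => by
      rw [abs_sub_comm]
      exact h p hpm hp
  exact abs_le.2 ⟨by linarith, by linarith⟩

lemma abs_zeroOneLoss_le (a b : Bool) : |zeroOneLoss a b| ≤ 1 := by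
  rw [zeroOneLoss]
  split_ifs <;> simp

end CondIndep

theorem theorem2 :
    ∃ C : ℝ, 0 < C ∧ ∀ (dz : ℕ) (_ : 1 ≤ dz) (c : ℝ) (ℓ : ℝ≥0),
      ∃ o : ℝ → ℕ → ℝ, (∀ ε : ℝ, 0 < ε → Tendsto (o ε) atTop (𝓝 0)) ∧
      -- part (i)
      (∀ (dx dy : ℕ) (J : CondIndep.JointDensity dx dy dz), J.SmoothMarg c ℓ →
        ∀ (n : ℕ) [NeZero n] (δ ε : ℝ), 0 < δ → δ < 1 → 0 < ε →
        ∀ (L : Bool → Bool → ℝ) (B : ℝ), (∀ a b, |L a b| ≤ B) →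
        ∀ (𝒢 : Set (CondIndep.Sample dx dy dz → Bool)), CondIndep.PointwiseMeasurable 𝒢 →
        ∀ V : ℕ, CondIndep.vcDim 𝒢 = V →
          J.lawOutcome n {ω | ¬ ∀ g, CondIndep.IsERM L 𝒢 ω g →
            CondIndep.risk L (J.lawLabelled n) g
                - (⨅ g' : 𝒢, CondIndep.risk L (J.lawLabelled n) g') ≤
              CondIndep.gammaBound C B V dz n δ (o ε n) (J.lowMass ε)}
            ≤ ENNReal.ofReal (8 * δ)) ∧
      -- part (ii)
      (∀ (ε₁ β c₃ ε' : ℝ), 0 < ε' → ε' < ε₁ → ∃ N : ℕ,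
        ∀ (dx dy : ℕ) (J : CondIndep.JointDensity dx dy dz), J.SmoothMarg c ℓ →
          J.SmoothCond ε₁ β → J.TailBound c₃ →
        ∀ (n : ℕ) [NeZero n] (δ ε η : ℝ), N ≤ n → 0 < δ → δ < 1 → 0 < ε →
        ∀ (𝒢 : Set (CondIndep.Sample dx dy dz → Bool)), CondIndep.PointwiseMeasurable 𝒢 →
        ∀ V : ℕ, CondIndep.vcDim 𝒢 = V →
          (⨅ g' : 𝒢, CondIndep.risk CondIndep.zeroOneLoss (J.lawLabelled n) g') ≤
            1 / 2 * (1 - CondIndep.tvDist J.law (J.lawBoot n)) + η →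
          J.lawOutcome n {ω | ¬ ∀ g, CondIndep.IsERM CondIndep.zeroOneLoss 𝒢 ω g →
            1 / 2 * (1 - CondIndep.tvDist J.law J.lawCI)
                - CondIndep.bootBound β c₃ c ε' dz n (J.lowMass (2 * c * ε' ^ 2)) / 2 ≤
              CondIndep.risk CondIndep.zeroOneLoss (J.lawLabelled n) g ∧
            CondIndep.risk CondIndep.zeroOneLoss (J.lawLabelled n) g ≤
              1 / 2 * (1 - CondIndep.tvDist J.law J.lawCI)
                + CondIndep.bootBound β c₃ c ε' dz n (J.lowMass (2 * c * ε' ^ 2)) / 2 + η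
                + CondIndep.gammaBound C 1 V dz n δ (o ε n) (J.lowMass ε)}
            ≤ ENNReal.ofReal (8 * δ)) := by
  refine ⟨4, by norm_num, fun dz hdz c ℓ => ?_⟩
  have hex : ∀ ε : ℝ, ∃ N : ℕ, 0 < ε → 12 ≤ N ∧ ∀ n, N ≤ n →
      (48 / (n : ℝ) + 4 * Real.exp (-(n * (ε / 2 * (n : ℝ) ^ (-(11 / 12) : ℝ)))) +
        6 * √(Real.log n) * (9 * (n : ℝ) ^ (-(1 / 2) : ℝ) +
          12 * (ℓ + 1 / CondIndep.unitBallVolume dz) * (n : ℝ) ^ (-(5 / 12) : ℝ)) ≤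
        4 * (n : ℝ) ^ (-(1 / 3) : ℝ)) ∧
      ℓ * ((n : ℝ) ^ (-(11 / 12) : ℝ) / CondIndep.unitBallVolume dz) ^ (1 / dz : ℝ) ≤ ε / 2 :=
    fun ε => by
      by_cases hε : 0 < ε
      · exact (CondIndep.exists_sampleSize dz hdz ℓ hε).imp fun N hN _ => hN
      · exact ⟨0, fun h => absurd h hε⟩
  choose N hN using hex
  refine ⟨CondIndep.remainder N, fun ε _ => CondIndep.tendsto_remainder N ε, ?_, ?_⟩
  · intro dx dy J hJ n _ δ ε hδ hδ1 hε L B hL 𝒢 h𝒢 V hV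
    exact CondIndep.lawOutcome_gammaBound_le J hJ.lipschitz hdz hN hδ hδ1 hε hL h𝒢 hV
  · intro ε₁ β c₃ ε' hε' hε₁
    obtain ⟨M, hM⟩ := CondIndep.exists_abs_integral_lawBoot_sub_lawCI_le_bootBound hdz c ℓ β c₃
      hε' hε₁
    refine ⟨M, fun dx dy J hJ hC hT n _ δ ε η hn hδ hδ1 hε 𝒢 h𝒢 V hV hη => ?_⟩
    refine le_trans (measure_mono fun ω hω => ?_) (CondIndep.lawOutcome_gammaBound_le J
      hJ.lipschitz hdz hN hδ hδ1 hε CondIndep.abs_zeroOneLoss_le h𝒢 hV)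
    have hTV := abs_le.1 (CondIndep.abs_tvDist_lawBoot_sub_le J
      (hM dx dy J hJ hC hT n hn))
    by_contra hgood
    simp only [Set.mem_ofPred_eq, not_not] at hgood
    refine hω fun g hg => ?_
    have h1 := CondIndep.half_one_sub_tvDist_le_risk (n := n) J (h𝒢.1 g hg.1)
    have h2 := hgood g hg
    exact ⟨by linarith [hTV.1, hTV.2], by linarith [hTV.1, hTV.2]⟩
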